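/- **Setting.** For $f:\{-1,1\}^n\to\{-1,1\}$ let $\chi_S(x)=\prod_{i\in S}x_i$, $\hat f(S)=\mathbf E_x[f(x)\chi_S(x)]$, $\mathrm{Inf}_i^{\le k}(f)=\sum_{S\ni i,\,|S|\le k}\hat f(S)^2$ and $\mathrm{Dict}_i(x)=x_i$. Two functions are $\nu$-close if they differ on at most a $\nu$ fraction of the cube. Algorithms are randomized and query $f$; query bounds hold for every run. A procedure *computes* a function $g$ with $q(\delta')$ queries if for every $x$ and every $\delta'\in(0,1)$ it outputs $g(x)$ with probability at least $1-\delta'$ after at most $q(\delta')$ queries to $f$. A list of procedures is a *$\nu$-oracle* for $S\subseteq[n]$ (with evaluation cost $q$) if they compute, with $q(\delta')$ queries, pairwise distinct functions $g_1,\dots,g_r$ such that each $g_j$ is $\nu$-close to $\mathrm{Dict}_i$ or $-\mathrm{Dict}_i$ for some $i\in S$, and for each $i\in S$ exactly one $g_j$ is $\nu$-close to $\mathrm{Dict}_i$ or $-\mathrm{Dict}_i$. For a restriction $\rho\in\{-1,1,*\}^n$ let $f_\rho(x)$ be $f$ at the point obtained from $x$ by overwriting the coordinates fixed by $\rho$.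 For $\eta\in[-1,1]^n$ let $H_\eta h(x)=\mathbf E[h(y_1)h(y_2)h(x\,y_1y_2y_3)]$, with $y_1,y_2$ uniform, $y_3$ from the product distribution with $\mathbf E[(y_3)_i]=\eta_i$, and coordinatewise products. Put $\kappa=\tau/(4k)$, $\alpha=\kappa^3/16$, and for $\eta\in\{0,\alpha\}^n$ let $g_{\rho,\eta}(x)=\mathrm{sgn}\big(H_\eta f_\rho(x)-\mathbf E[f_\rho]^3\big)$, with $\mathrm{sgn}(0)=1$. Say that $\eta$ *isolates* $i$ in $h=f_\rho$ if $|\hat h(\{i\})|\ge\kappa$ and $|H_\eta h(x)-\hat h(\emptyset)^3-\alpha\hat h(\{i\})^3x_i|\le\frac\alpha4|\hat h(\{i\})|^3$ for all $x$. **Algorithm** Construct-coordinate-oracle, with inputs $k,\tau,\nu,\delta$, query access to $f$, a constant $C$ and two subroutines Eval and Test. Let $T=\lceil Ck^5\tau^{-5}\log(1/\delta)\rceil$, $M=\lceil Ck^7\tau^{-7}\log(1/\delta)\rceil$, $\tilde\delta=\delta/(MT)$, $N=\lceil C\log(MT/\delta)\rceil$. Repeat $T$ times: draw $\rho$ with independent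 coordinates, each $*$ with probability $1/k$ and otherwise a uniform sign; then $M$ times draw $\eta\in\{0,\alpha\}^n$ with independent coordinates, each equal to $\alpha$ with probability $\kappa^6/16$, run $\mathrm{Test}(\rho,\eta,\nu,\tilde\delta)$, and if it accepts add $(\rho,\eta)$ to $\mathcal D$. Then draw $N$ uniform points, evaluate every member of $\mathcal D$ at them by $\mathrm{Eval}(\rho,\eta)$ with confidence parameter $\delta/(CMTN)$, and, as long as two members have empirical correlation at least $1/2$ in absolute value, remove one of them. Output the procedures $\mathrm{Eval}(\rho,\eta)$ for the remaining $(\rho,\eta)\in\mathcal D$. **Lemma.** There are a constant $C>0$, real polynomials $P_{\rm eval},P_{\rm test},P_{\rm size},P_{\rm query}$ in three variables, and subroutines Eval and Test (depending on $n,k,\tau$ but not on $f$) such that the following holds for all $n\ge0$, $k\ge1$ and $0<\tau\le1$, where $q(\delta')=P_{\rm eval}(k,1/\tau,\log(1/\delta'))$. (a) For all $f,\rho,\eta$: if $\eta$ isolates some coordinate in $f_\rho$, then $\mathrm{Eval}(\rho,\eta)$ computes $g_{\rho,\eta}$ with $q(\delta')$ queries. (b) For all $f,\rho,\eta$, all $0<\nu\le1/8$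 and $0<\tilde\delta<1$: $\mathrm{Test}(\rho,\eta,\nu,\tilde\delta)$ makes at most $\nu^{-1}P_{\rm test}(k,1/\tau,\log(1/\tilde\delta))$ queries; it accepts with probability at least $1-\tilde\delta$ if $\eta$ isolates some coordinate in $f_\rho$; and it accepts with probability at most $\tilde\delta$ unless $\mathrm{Eval}(\rho,\eta)$ computes, with $q(\delta')$ queries, some function that is $\nu$-close to some $\mathrm{Dict}_i$ or $-\mathrm{Dict}_i$. (c) For all $0<\nu\le1/8$, $0<\delta\le1/2$ and $f:\{-1,1\}^n\to\{-1,1\}$: 1. with probability at least $1-\delta$ there is a set $S\supseteq\{i:\mathrm{Inf}_i^{\le k}(f)\ge\tau^2/k^2\}$ such that the output of Construct-coordinate-oracle is a $\nu$-oracle for $S$ (with evaluation cost $q$); 2. the output always has at most $P_{\rm size}(k,1/\tau,\log(1/\delta))$ members; 3. the algorithm always makes at most $\nu^{-1}P_{\rm query}(k,1/\tau,\log(1/\delta))$ queries to $f$. -/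

import Mathlib

open scoped BigOperators

namespace CoordOracle

noncomputable section

/-- The Boolean cube `{-1, 1}ⁿ`; multiplication is coordinatewise. -/
abbrev Cube (n : ℕ) : Type := Fin n → ℤˣ

/-- A sign, as a real number. -/
def toReal (s : ℤˣ) : ℝ := ((s : ℤ) : ℝ)

/-! ### Fourier analysis on the cube -/

/-- The character `χ_S(x) = ∏_{i ∈ S} x_i`. -/
def chi {n : ℕ} (S : Finset (Fin n)) (x : Cube n) : ℝ := ∏ i ∈ S, toReal (x i)

/-- The Fourier coefficient `E_x [f(x) χ_S(x)]`. -/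
def fourierCoeff {n : ℕ} (f : Cube n → ℤˣ) (S : Finset (Fin n)) : ℝ :=
  𝔼 x : Cube n, toReal (f x) * chi S x

/-- The low-degree influence `∑_{S ∋ i, |S| ≤ k} f̂(S)²`. -/
def lowDegInfluence {n : ℕ} (k : ℕ) (f : Cube n → ℤˣ) (i : Fin n) : ℝ :=
  ∑ S : Finset (Fin n), if i ∈ S ∧ S.card ≤ k then fourierCoeff f S ^ 2 else 0

/-- The dictator function `x ↦ x_i`. -/
def Dict {n : ℕ} (i : Fin n) : Cube n → ℤˣ := fun x => x i

/-- `g` and `h` are `ν`-close: they differ on at most a `ν` fraction of the cube. -/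
def Close {n : ℕ} (ν : ℝ) (g h : Cube n → ℤˣ) : Prop :=
  ((Finset.univ.filter fun x : Cube n => g x ≠ h x).card : ℝ) / 2 ^ n ≤ ν

/-- `g` is `ν`-close to `Dict_i` or to `-Dict_i`. -/
def NearDict {n : ℕ} (ν : ℝ) (g : Cube n → ℤˣ) (i : Fin n) : Prop :=
  Close ν g (Dict i) ∨ Close ν g (fun x => -Dict i x)

/-! ### Randomized query algorithms -/

/-- Randomized algorithms with query access to an unknown function `X → {-1, 1}` and with
output in `α`: stop, query the function at a point, or draw a random value. -/
inductive QueryAlg (X : Type) (α : Type) : Type 1 where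
  | ret (a : α) : QueryAlg X α
  | query (x : X) (next : ℤˣ → QueryAlg X α) : QueryAlg X α
  | rand {Ω : Type} (p : PMF Ω) (next : Ω → QueryAlg X α) : QueryAlg X α

namespace QueryAlg

variable {X α β : Type}

/-- The law of the output when the unknown function is `f`; all draws are independent. -/
def output (f : X → ℤˣ) : QueryAlg X α → PMF α
  | ret a => PMF.pure a
  | query x next => output f (next (f x))
  | rand p next => p.bind fun ω => output f (next ω)

/-- Every possible run on `f` makes at most `q` queries. -/
def QueriesAtMost (f : X → ℤˣ) : QueryAlg X α → ℕ → Prop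
  | ret _, _ => True
  | query _ _, 0 => False
  | query x next, q + 1 => QueriesAtMost f (next (f x)) q
  | rand p next, q => ∀ ω ∈ p.support, QueriesAtMost f (next ω) q

/-- Sequential composition. -/
def bind : QueryAlg X α → (α → QueryAlg X β) → QueryAlg X β
  | ret a, F => F a
  | query x next, F => query x fun s => bind (next s) F
  | rand p next, F => rand p fun ω => bind (next ω) F

instance : Monad (QueryAlg X) where
  pure := ret
  bind := bind

/-- Draw one value from `p`. -/
def sample (p : PMF α) : QueryAlg X α := rand p ret

/-- Run `A 0, …, A (m - 1)` one after the other, with independent randomness. -/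
def seq : (m : ℕ) → (Fin m → QueryAlg X α) → QueryAlg X (Fin m → α)
  | 0, _ => ret Fin.elim0
  | m + 1, A => bind (A 0) fun a => bind (seq m fun j => A j.succ) fun r => ret (Fin.cons a r)

end QueryAlg

/-- `true` with probability `p` (for `0 ≤ p ≤ 1`). -/
def coin (p : ℝ) : PMF Bool :=
  PMF.ofFintype (fun b => cond b (min (ENNReal.ofReal p) 1) (1 - min (ENNReal.ofReal p) 1))
    (by simp [add_tsub_cancel_of_le])

/-! ### Approximate coordinate oracles -/

/-- A randomized procedure which, given a point and a confidence parameter, tries to compute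
the value of some function at that point by querying `f`. -/
abbrev Evaluator (n : ℕ) : Type 1 := Cube n → ℝ → QueryAlg (Cube n) ℤˣ

/-- With queries to `f`, the procedure `E` computes `g`: at every point and for every
confidence `δ'` it is correct with probability at least `1 - δ'`, with at most `q δ'` queries. -/
def Computes {n : ℕ} (f : Cube n → ℤˣ) (q : ℝ → ℝ) (E : Evaluator n) (g : Cube n → ℤˣ) : Prop :=
  ∀ (x : Cube n) (δ' : ℝ), 0 < δ' → δ' < 1 →
    ENNReal.ofReal (1 - δ') ≤ (E x δ').output f (g x) ∧
    ∃ m : ℕ, (m : ℝ) ≤ q δ' ∧ (E x δ').QueriesAtMost f m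

/-- The procedures in `D` form a `ν`-oracle for the coordinates `S`. The set of functions of the
oracle is `{g j}`, and `g j` is computed by the `j`-th procedure. -/
def IsNuOracle {n : ℕ} (f : Cube n → ℤˣ) (ν : ℝ) (q : ℝ → ℝ) (D : List (Evaluator n))
    (S : Set (Fin n)) : Prop :=
  ∃ g : Fin D.length → (Cube n → ℤˣ), Function.Injective g ∧
    (∀ j, ∃ i ∈ S, NearDict ν (g j) i) ∧
    (∀ i ∈ S, ∃! j, NearDict ν (g j) i) ∧
    (∀ j, Computes f q (D.get j) (g j))

/-! ### The function attached to a restriction and a noise pattern -/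

/-- A restriction in `{-1, 1, ∗}ⁿ`; `none` is `∗`. -/
abbrev Restriction (n : ℕ) : Type := Fin n → Option ℤˣ

/-- The restricted function, regarded as a function on the whole cube which ignores the
coordinates fixed by `ρ`. -/
def restrict {n : ℕ} (f : Cube n → ℤˣ) (ρ : Restriction n) : Cube n → ℤˣ :=
  fun x => f fun i => (ρ i).getD (x i)

/-- The probability of `y` under the product distribution on the cube whose `i`-th bit has
expectation `η i`. -/
def noiseWeight {n : ℕ} (η : Fin n → ℝ) (y : Cube n) : ℝ := ∏ i, (1 + η i * toReal (y i)) / 2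

/-- `E [f(y₁) f(y₂) f(x y₁ y₂ y₃)]` with `y₁, y₂` uniform and `y₃` drawn from `noiseWeight η`. -/
def hastad {n : ℕ} (η : Fin n → ℝ) (f : Cube n → ℤˣ) (x : Cube n) : ℝ :=
  𝔼 y₁ : Cube n, 𝔼 y₂ : Cube n, ∑ y₃ : Cube n,
    noiseWeight η y₃ * (toReal (f y₁) * toReal (f y₂) * toReal (f (x * y₁ * y₂ * y₃)))

/-- The noise size `α = κ³/16`. -/
def alpha (κ : ℝ) : ℝ := κ ^ 3 / 16

/-- The vector `η ∈ {0, α}ⁿ` which is `α` exactly on the coordinates marked by `b`. -/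
def noiseVec {n : ℕ} (κ : ℝ) (b : Fin n → Bool) : Fin n → ℝ := fun i => if b i then alpha κ else 0

/-- The candidate function `sgn(H_η h - E[h]³)`. -/
def candidate {n : ℕ} (κ : ℝ) (h : Cube n → ℤˣ) (b : Fin n → Bool) : Cube n → ℤˣ := fun x =>
  if 0 ≤ hastad (noiseVec κ b) h x - (𝔼 y : Cube n, toReal (h y)) ^ 3 then 1 else -1

/-- The noise pattern `b` isolates coordinate `i` of `h`: the coefficient of `i` is at least `κ`
in absolute value, and `H_η h` is uniformly close to `ĥ(∅)³ + α ĥ({i})³ x_i`. -/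
def Isolates {n : ℕ} (κ : ℝ) (h : Cube n → ℤˣ) (b : Fin n → Bool) (i : Fin n) : Prop :=
  κ ≤ |fourierCoeff h {i}| ∧
  ∀ x : Cube n, |hastad (noiseVec κ b) h x - fourierCoeff h ∅ ^ 3
      - alpha κ * fourierCoeff h {i} ^ 3 * toReal (x i)| ≤ alpha κ / 4 * |fourierCoeff h {i}| ^ 3

/-- A sample of the random restriction in which every coordinate is `∗` with probability `1/k`
and otherwise a uniformly random sign. -/
def sampleRestriction (n k : ℕ) : QueryAlg (Cube n) (Restriction n) :=
  QueryAlg.seq n fun _ => QueryAlg.sample <|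
    (coin (1 / k)).bind fun star =>
      if star then PMF.pure none else (PMF.uniformOfFintype ℤˣ).map some

/-- A sample of the noise pattern: each coordinate is marked with probability `κ⁶/16`. -/
def sampleNoise (n : ℕ) (κ : ℝ) : QueryAlg (Cube n) (Fin n → Bool) :=
  QueryAlg.seq n fun _ => QueryAlg.sample (coin (κ ^ 6 / 16))

/-! ### The algorithm -/

/-- An evaluation procedure for each candidate `(ρ, b)`. -/
abbrev EvalRoutine (n : ℕ) : Type 1 := Restriction n → (Fin n → Bool) → Evaluator n

/-- A test for each candidate `(ρ, b)`, with accuracy and confidence parameters. -/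
abbrev TestRoutine (n : ℕ) : Type 1 :=
  Restriction n → (Fin n → Bool) → ℝ → ℝ → QueryAlg (Cube n) Bool

/-- The empirical correlation of two vectors of values. -/
def empCorr {N : ℕ} (v w : Fin N → ℤˣ) : ℝ := (∑ l, toReal (v l) * toReal (w l)) / N

open Classical in
/-- Remove entries which have empirical correlation at least `1/2`, in absolute value, with
another entry, until there is no such pair. -/
def clean {γ : Type} {N : ℕ} : List (γ × (Fin N → ℤˣ)) → List (γ × (Fin N → ℤˣ))
  | [] => []
  | c :: l => if ∃ d ∈ clean l, 1 / 2 ≤ |empCorr c.2 d.2| then clean l else c :: clean l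

/-- The threshold `κ = τ/(4k)` for the Fourier coefficients of the restricted functions. -/
def kappa (k : ℕ) (τ : ℝ) : ℝ := τ / (4 * k)

/-- The number `T = C k⁵ τ⁻⁵ log(1/δ)` of outer rounds. -/
def outerRounds (C : ℝ) (k : ℕ) (τ δ : ℝ) : ℕ := ⌈C * k ^ 5 * τ⁻¹ ^ 5 * Real.log (1 / δ)⌉₊

/-- The number `M = C k⁷ τ⁻⁷ log(1/δ)` of inner rounds. -/
def innerRounds (C : ℝ) (k : ℕ) (τ δ : ℝ) : ℕ := ⌈C * k ^ 7 * τ⁻¹ ^ 7 * Real.log (1 / δ)⌉₊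

/-- Construct-coordinate-oracle. It outputs the list of the candidates that it keeps; these stand
for the corresponding evaluation procedures. -/
def constructCoordinateOracle {n : ℕ} (C : ℝ) (eval : EvalRoutine n) (test : TestRoutine n)
    (k : ℕ) (τ ν δ : ℝ) : QueryAlg (Cube n) (List (Restriction n × (Fin n → Bool))) :=
  let T := outerRounds C k τ δ
  let M := innerRounds C k τ δ
  let δt : ℝ := δ / (M * T)
  let N : ℕ := ⌈C * Real.log (M * T / δ)⌉₊
  do
    let rounds ← QueryAlg.seq T fun _ => do
      let ρ ← sampleRestriction n k
      QueryAlg.seq M fun _ => do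
        let b ← sampleNoise n (kappa k τ)
        let accepted ← test ρ b ν δt
        pure (if accepted then some (ρ, b) else none)
    let D := (List.ofFn fun t => (List.ofFn (rounds t)).reduceOption).flatten
    let pts ← QueryAlg.seq N fun _ => QueryAlg.sample (PMF.uniformOfFintype (Cube n))
    let vals ← QueryAlg.seq D.length fun j => QueryAlg.seq N fun l =>
      eval (D.get j).1 (D.get j).2 (pts l) (δ / (C * M * T * N))
    pure ((clean (List.ofFn fun j => (D.get j, vals j))).map Prod.fst)

/-- The oracle represented by a list of candidates. -/
def evaluators {n : ℕ} (eval : EvalRoutine n) (L : List (Restriction n × (Fin n → Bool))) :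
    List (Evaluator n) := L.map fun c => eval c.1 c.2

/-! ### What the two subroutines do -/

/-- The value of the polynomial `P` at `(k, 1/τ, log(1/δ))`. -/
def polyVal (P : MvPolynomial (Fin 3) ℝ) (k : ℕ) (τ δ : ℝ) : ℝ :=
  MvPolynomial.eval ![(k : ℝ), τ⁻¹, Real.log (1 / δ)] P

/-- `eval` computes the candidate function of `(ρ, b)` whenever `b` isolates a coordinate of the
restricted function. -/
def EvaluatesCandidates {n : ℕ} (κ : ℝ) (q : ℝ → ℝ) (eval : EvalRoutine n) : Prop :=
  ∀ (f : Cube n → ℤˣ) (ρ : Restriction n) (b : Fin n → Bool),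
    (∃ i, Isolates κ (restrict f ρ) b i) →
      Computes f q (eval ρ b) (candidate κ (restrict f ρ) b)

/-- `test` is a dictator test for the functions computed by `eval`. For accuracy `ν` and
confidence `δt` it makes at most `ν⁻¹ qt(δt)` queries; it accepts, except with probability `δt`,
if `b` isolates a coordinate of the restricted function; and it accepts with probability at most
`δt` if `eval ρ b` does not compute a function that is `ν`-close to some `±Dict_i`. -/
def TestsDictators {n : ℕ} (κ : ℝ) (q qt : ℝ → ℝ) (eval : EvalRoutine n) (test : TestRoutine n) :
    Prop :=
  ∀ (f : Cube n → ℤˣ) (ρ : Restriction n) (b : Fin n → Bool) (ν δt : ℝ),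
    0 < ν → ν ≤ 1 / 8 → 0 < δt → δt < 1 →
      (∃ m : ℕ, (m : ℝ) ≤ ν⁻¹ * qt δt ∧ (test ρ b ν δt).QueriesAtMost f m) ∧
      ((∃ i, Isolates κ (restrict f ρ) b i) →
        ENNReal.ofReal (1 - δt) ≤ (test ρ b ν δt).output f true) ∧
      ((¬ ∃ (g : Cube n → ℤˣ) (i : Fin n), Computes f q (eval ρ b) g ∧ NearDict ν g i) →
        (test ρ b ν δt).output f true ≤ ENNReal.ofReal δt)

end

end CoordOracle

open CoordOracle

namespace CoordOracle

noncomputable section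

open scoped ENNReal

/-! Put h = f_ρ and φ = (H_η h − E[h]³)/2, the `signal`. Its Fourier coefficients are ĥ(S)³ ∏_{i∈S}
η_i / 2 for S ≠ ∅, and 0 at ∅. It is also the mean of a random bit that costs three queries
(`mean_signalBit`). Noise rates are at most α, so coefficients of degree at least 2 are at most
α²/2. Isolation of i, in contrast, forces |φ̂({i})| ≥ 6α² and puts nearly all of the Fourier weight
on {i} (`isolated_estimates`).

Both subroutines exploit this gap. Eval estimates not φ(x) but the sign of the self-corrected value
∑ φ̂(S)³ χ_S(x), again the mean of a bit. If one linear coefficient carries two thirds of the weight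
(`Dominant`), its cube outweighs all the others at every x, so Eval computes a signed dictator
exactly. Test estimates ∑ φ̂⁴ − (2/3)(∑ φ̂²)², a linearity test normalized by the weight of φ. If
this exceeds a suitable multiple of α⁸, then the largest coefficient dominates, and by the gap it is
linear (`exists_dominant`). Usable candidates thus compute functions at distance 0 from ±Dict_i,
which are ν-close for every ν.

Coverage is a moment computation. The mean square of the coefficient of {i} in f_ρ is at least
Inf_i^{≤k}(f)/(4k), so a random restriction makes this coefficient at least κ with probability of
order τ²/k³ (`le_pr_fourierCoeff_restrict`). A first-moment bound then shows that the noise pattern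
isolates i with probability of order κ⁶ (`le_pr_isolates`). At most k³/τ² coordinates are
influential, so independent repetition and a union bound cover all of them (`pr_goodRounds_compl`).

Signed dictators have correlation ±1 or 0 according to whether their coordinates agree. Empirical
correlations therefore recognize repetitions, and the clean-up keeps one candidate per coordinate
(`pr_removeRepetitions`). The set S consists of the coordinates that remain. -/

/-! ### Expectations with respect to a `PMF` -/

/-- The expectation of a nonnegative function. -/
def lexp {α : Type} (p : PMF α) (φ : α → ℝ≥0∞) : ℝ≥0∞ := ∑' a, p a * φ a

/-- The expectation of a real function on a finite type. -/
def rexp {α : Type} [Fintype α] (p : PMF α) (φ : α → ℝ) : ℝ := ∑ a, (p a).toReal * φ a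

section PMF

variable {α β : Type}

lemma lexp_mono (p : PMF α) {φ ψ : α → ℝ≥0∞} (h : ∀ a, φ a ≤ ψ a) : lexp p φ ≤ lexp p ψ :=
  ENNReal.tsum_le_tsum fun a => by gcongr; exact h a

lemma lexp_const (p : PMF α) (c : ℝ≥0∞) : lexp p (fun _ => c) = c := by
  simp [lexp, ENNReal.tsum_mul_right]

lemma lexp_pure (a : α) (φ : α → ℝ≥0∞) : lexp (PMF.pure a) φ = φ a := by
  rw [lexp, tsum_eq_single a]
  · simp
  · intro b hb; simp [hb]

lemma lexp_bind (p : PMF α) (q : α → PMF β) (φ : β → ℝ≥0∞) :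
    lexp (p.bind q) φ = lexp p fun a => lexp (q a) φ := by
  simp only [lexp, PMF.bind_apply, ← ENNReal.tsum_mul_right, ← ENNReal.tsum_mul_left]
  rw [ENNReal.tsum_comm]
  simp only [mul_assoc]

lemma lexp_add (p : PMF α) (φ ψ : α → ℝ≥0∞) :
    lexp p (fun a => φ a + ψ a) = lexp p φ + lexp p ψ := by
  simp only [lexp, mul_add, ENNReal.tsum_add]

lemma lexp_mul_const (p : PMF α) (φ : α → ℝ≥0∞) (c : ℝ≥0∞) :
    lexp p (fun a => φ a * c) = lexp p φ * c := by
  simp only [lexp, ← mul_assoc, ENNReal.tsum_mul_right]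

lemma lexp_const_mul (p : PMF α) (φ : α → ℝ≥0∞) (c : ℝ≥0∞) :
    lexp p (fun a => c * φ a) = c * lexp p φ := by
  simp only [mul_comm c, lexp_mul_const]

lemma toOuterMeasure_eq_lexp (p : PMF α) (s : Set α) :
    p.toOuterMeasure s = lexp p (s.indicator 1) := by
  rw [PMF.toOuterMeasure_apply, lexp]
  congr 1 with a
  by_cases h : a ∈ s <;> simp [h]

lemma apply_eq_lexp (p : PMF α) (a : α) : p a = lexp p (({a} : Set α).indicator 1) := by
  rw [← toOuterMeasure_eq_lexp, PMF.toOuterMeasure_apply_singleton]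

lemma lexp_eq_ofReal [Fintype α] (p : PMF α) (φ : α → ℝ) (h : ∀ a, 0 ≤ φ a) :
    lexp p (fun a => ENNReal.ofReal (φ a)) = ENNReal.ofReal (rexp p φ) := by
  rw [lexp, tsum_fintype, rexp, ENNReal.ofReal_sum_of_nonneg]
  · refine Finset.sum_congr rfl fun a _ => ?_
    rw [ENNReal.ofReal_mul ENNReal.toReal_nonneg, ENNReal.ofReal_toReal (p.apply_ne_top a)]
  · intro a _
    exact mul_nonneg ENNReal.toReal_nonneg (h a)

/-- The probability of the event `s`. -/
def pr (p : PMF α) (s : Set α) : ℝ≥0∞ := p.toOuterMeasure s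

lemma pr_eq_lexp (p : PMF α) (s : Set α) : pr p s = lexp p (s.indicator 1) :=
  toOuterMeasure_eq_lexp p s

lemma pr_mono (p : PMF α) {s t : Set α} (h : s ⊆ t) : pr p s ≤ pr p t :=
  p.toOuterMeasure.mono h

lemma pr_univ (p : PMF α) : pr p Set.univ = 1 := by
  rw [pr_eq_lexp, Set.indicator_univ]
  exact lexp_const p 1

lemma pr_le_one (p : PMF α) (s : Set α) : pr p s ≤ 1 :=
  (pr_mono p (Set.subset_univ s)).trans_eq (pr_univ p)

lemma pr_ne_top (p : PMF α) (s : Set α) : pr p s ≠ ⊤ :=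
  ne_top_of_le_ne_top ENNReal.one_ne_top (pr_le_one p s)

lemma pr_singleton (p : PMF α) (a : α) : pr p {a} = p a :=
  p.toOuterMeasure_apply_singleton a

lemma pr_union_le (p : PMF α) (s t : Set α) : pr p (s ∪ t) ≤ pr p s + pr p t :=
  MeasureTheory.measure_union_le s t

lemma pr_biUnion_le {ι : Type} (p : PMF α) (I : Finset ι) (s : ι → Set α) :
    pr p (⋃ i ∈ I, s i) ≤ ∑ i ∈ I, pr p (s i) :=
  MeasureTheory.measure_biUnion_finset_le I s

lemma pr_add_compl (p : PMF α) (s : Set α) : pr p s + pr p sᶜ = 1 := by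
  rw [pr_eq_lexp, pr_eq_lexp, ← lexp_add, ← lexp_const p 1]
  congr 1 with a
  by_cases h : a ∈ s <;> simp [h]

lemma le_pr_of_compl_le (p : PMF α) {s : Set α} {ε : ℝ} (hε : 0 ≤ ε)
    (h : pr p sᶜ ≤ ENNReal.ofReal ε) : ENNReal.ofReal (1 - ε) ≤ pr p s := by
  rw [ENNReal.ofReal_sub _ hε, ENNReal.ofReal_one, tsub_le_iff_right, ← pr_add_compl p s]
  gcongr

lemma pr_compl_le (p : PMF α) {s : Set α} {ε : ℝ}
    (h : ENNReal.ofReal (1 - ε) ≤ pr p s) : pr p sᶜ ≤ ENNReal.ofReal ε := by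
  have h1 := pr_add_compl p s
  have h2 : pr p sᶜ ≤ 1 - pr p s := by
    rw [← h1]
    exact (ENNReal.add_sub_cancel_left (pr_ne_top p s)).ge
  refine h2.trans (tsub_le_iff_right.2 ?_)
  calc (1 : ℝ≥0∞) = ENNReal.ofReal (ε + (1 - ε)) := by simp
    _ ≤ ENNReal.ofReal ε + ENNReal.ofReal (1 - ε) := ENNReal.ofReal_add_le
    _ ≤ _ := by gcongr

lemma pr_bind (p : PMF α) (q : α → PMF β) (s : Set β) :
    pr (p.bind q) s = lexp p fun a => pr (q a) s := by
  simp only [pr_eq_lexp, lexp_bind]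

/-- Union bound for a two-stage experiment: t is the failure event of the first stage and ε bounds
the conditional failure probability of the second. With t = ∅ or ε = 0 only one stage can fail. -/
lemma pr_bind_le (p : PMF α) (q : α → PMF β) (s : Set β) (t : Set α) {ε : ℝ≥0∞}
    (h : ∀ a ∉ t, pr (q a) s ≤ ε) : pr (p.bind q) s ≤ pr p t + ε := by
  rw [pr_bind, pr_eq_lexp, ← lexp_const p ε, ← lexp_add]
  refine lexp_mono p fun a => ?_
  by_cases ha : a ∈ t
  · simpa [ha] using (pr_le_one _ _).trans le_self_add
  · simpa [ha] using h a ha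

lemma le_pr_bind (p : PMF α) (q : α → PMF β) (s : Set β) (t : Set α) {ε : ℝ≥0∞}
    (h : ∀ a ∈ t, ε ≤ pr (q a) s) : pr p t * ε ≤ pr (p.bind q) s := by
  rw [pr_bind, pr_eq_lexp, ← lexp_mul_const]
  refine lexp_mono p fun a => ?_
  by_cases ha : a ∈ t
  · simpa [ha] using h a ha
  · simp [ha]

lemma rexp_pure [Fintype α] (a : α) (φ : α → ℝ) : rexp (PMF.pure a) φ = φ a := by
  classical
  rw [rexp, Finset.sum_eq_single a]
  · simp
  · intro b _ hb; simp [hb]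
  · simp

lemma rexp_bind [Fintype α] [Fintype β] (p : PMF α) (q : α → PMF β) (φ : β → ℝ) :
    rexp (p.bind q) φ = rexp p fun a => rexp (q a) φ := by
  simp only [rexp, PMF.bind_apply, tsum_fintype, Finset.mul_sum]
  rw [Finset.sum_comm]
  refine Finset.sum_congr rfl fun b _ => ?_
  rw [ENNReal.toReal_sum fun a _ => ENNReal.mul_ne_top (p.apply_ne_top _) ((q a).apply_ne_top _),
    Finset.sum_mul]
  simp only [ENNReal.toReal_mul, mul_assoc]

lemma rexp_const [Fintype α] (p : PMF α) (c : ℝ) : rexp p (fun _ => c) = c := by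
  rw [rexp, ← Finset.sum_mul, ← ENNReal.toReal_sum fun a _ => p.apply_ne_top a,
    ← tsum_fintype (L := .unconditional _), p.tsum_coe]
  simp

lemma rexp_add [Fintype α] (p : PMF α) (φ ψ : α → ℝ) :
    rexp p (fun a => φ a + ψ a) = rexp p φ + rexp p ψ := by
  simp only [rexp, mul_add, Finset.sum_add_distrib]

lemma rexp_const_mul [Fintype α] (p : PMF α) (c : ℝ) (φ : α → ℝ) :
    rexp p (fun a => c * φ a) = c * rexp p φ := by
  simp only [rexp, Finset.mul_sum, mul_left_comm]

lemma rexp_mul_const [Fintype α] (p : PMF α) (c : ℝ) (φ : α → ℝ) :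
    rexp p (fun a => φ a * c) = rexp p φ * c := by
  simp only [mul_comm _ c, rexp_const_mul]

lemma rexp_neg [Fintype α] (p : PMF α) (φ : α → ℝ) :
    rexp p (fun a => -φ a) = -rexp p φ := by
  simp only [rexp, mul_neg, Finset.sum_neg_distrib]

lemma rexp_sum [Fintype α] {ι : Type} (p : PMF α) (s : Finset ι) (φ : ι → α → ℝ) :
    rexp p (fun a => ∑ i ∈ s, φ i a) = ∑ i ∈ s, rexp p (φ i) := by
  simp only [rexp, Finset.mul_sum]
  exact Finset.sum_comm

lemma rexp_mono [Fintype α] (p : PMF α) {φ ψ : α → ℝ} (h : ∀ a, φ a ≤ ψ a) :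
    rexp p φ ≤ rexp p ψ :=
  Finset.sum_le_sum fun a _ => mul_le_mul_of_nonneg_left (h a) ENNReal.toReal_nonneg

lemma pr_eq_ofReal_rexp [Fintype α] (p : PMF α) (s : Set α) :
    pr p s = ENNReal.ofReal (rexp p (s.indicator 1)) := by
  rw [← lexp_eq_ofReal, pr_eq_lexp]
  · congr 1 with a
    by_cases h : a ∈ s <;> simp [h]
  · intro a
    by_cases h : a ∈ s <;> simp [h]

lemma rexp_uniform [Fintype α] [Nonempty α] (φ : α → ℝ) :
    rexp (PMF.uniformOfFintype α) φ = 𝔼 a, φ a := by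
  simp [rexp, PMF.uniformOfFintype_apply, Fintype.expect_eq_sum_div_card,
    div_eq_inv_mul, Finset.mul_sum]

lemma rexp_coin {p : ℝ} (h0 : 0 ≤ p) (h1 : p ≤ 1) (φ : Bool → ℝ) :
    rexp (coin p) φ = p * φ true + (1 - p) * φ false := by
  have h : ENNReal.ofReal p ≤ 1 := by simpa using h1
  simp [rexp, coin, PMF.ofFintype_apply, min_eq_left h, ENNReal.toReal_sub_of_le h, h0]

end PMF

/-! ### Laws and query counts of composite algorithms -/

namespace QueryAlg

variable {X α β : Type} {f : X → ℤˣ}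

lemma output_ret (a : α) : output f (ret a : QueryAlg X α) = PMF.pure a := rfl

lemma pr_ret_of_mem {a : α} {s : Set α} (h : a ∈ s) :
    pr (output f (ret a : QueryAlg X α)) s = 1 := by
  rw [output_ret, pr_eq_lexp, lexp_pure, Set.indicator_of_mem h, Pi.one_apply]

lemma pr_ret_of_notMem {a : α} {s : Set α} (h : a ∉ s) :
    pr (output f (ret a : QueryAlg X α)) s = 0 := by
  rw [output_ret, pr_eq_lexp, lexp_pure, Set.indicator_of_notMem h]

lemma output_bind (A : QueryAlg X α) (F : α → QueryAlg X β) :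
    output f (A.bind F) = (output f A).bind fun a => output f (F a) := by
  induction A with
  | ret a => simp [bind, output]
  | query x next ih => simpa [bind, output] using ih _
  | rand p next ih => simp [bind, output, ih]

lemma output_sample (p : PMF α) : output f (sample p) = p := by
  simp [sample, output]

/-- Independence, as multiplicativity of expectations of products. Indicators give the joint law and
the marginals, exponentials give the tail bounds. -/
lemma lexp_seq (m : ℕ) (A : Fin m → QueryAlg X α) (g : Fin m → α → ℝ≥0∞) :
    lexp (output f (seq m A)) (fun v => ∏ j, g j (v j)) =
      ∏ j, lexp (output f (A j)) (g j) := by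
  induction m with
  | zero => simp [lexp_const]
  | succ m ih =>
    simp only [seq, output_bind, lexp_bind, output_ret, lexp_pure, Fin.prod_univ_succ,
      Fin.cons_zero, Fin.cons_succ, lexp_const_mul]
    rw [ih (fun j => A j.succ) (fun j => g j.succ), lexp_mul_const]

lemma output_seq_apply (m : ℕ) (A : Fin m → QueryAlg X α) (v : Fin m → α) :
    output f (seq m A) v = ∏ j, output f (A j) (v j) := by
  simp only [apply_eq_lexp]
  rw [← lexp_seq]
  congr 1 with w
  by_cases h : w = v
  · simp [h]
  · obtain ⟨j, hj⟩ := Function.ne_iff.1 h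
    rw [Finset.prod_eq_zero (Finset.mem_univ j)] <;> simp [h, hj]

lemma rexp_seq [Fintype α] (m : ℕ) (A : Fin m → QueryAlg X α) (g : Fin m → α → ℝ) :
    rexp (output f (seq m A)) (fun v => ∏ j, g j (v j)) =
      ∏ j, rexp (output f (A j)) (g j) := by
  classical
  simp only [rexp, Finset.prod_univ_sum, Fintype.piFinset_univ, output_seq_apply,
    ENNReal.toReal_prod, Finset.prod_mul_distrib]

/-- The marginals of independent runs. -/
lemma pr_seq_apply_mem (m : ℕ) (A : Fin m → QueryAlg X α) (j : Fin m) (s : Set α) :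
    pr (output f (seq m A)) {v | v j ∈ s} = pr (output f (A j)) s := by
  classical
  have h := lexp_seq (f := f) m A fun i => if i = j then s.indicator 1 else fun _ => 1
  rw [Finset.prod_eq_single j] at h
  · rw [pr_eq_lexp, pr_eq_lexp]
    convert h using 2
    · ext v
      rw [Finset.prod_eq_single j]
      · by_cases hv : v j ∈ s <;> simp [hv]
      · intro i _ hi; simp [hi]
      · simp
    · simp
  · intro i _ hi; simp [hi, lexp_const]
  · simp

lemma pr_seq_exists_le (m : ℕ) (A : Fin m → QueryAlg X α) (s : Fin m → Set α) {ε : ℝ≥0∞}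
    (h : ∀ j, pr (output f (A j)) (s j) ≤ ε) :
    pr (output f (seq m A)) {v | ∃ j, v j ∈ s j} ≤ m * ε := by
  have h1 : {v : Fin m → α | ∃ j, v j ∈ s j} = ⋃ j ∈ Finset.univ, {v | v j ∈ s j} := by
    ext v; simp
  rw [h1]
  refine (pr_biUnion_le _ _ _).trans ?_
  refine (Finset.sum_le_sum fun j _ => ((pr_seq_apply_mem m A j (s j)).trans_le (h j))).trans ?_
  simp

/-- All m independent attempts miss with probability at most (1 − p)^m ≤ e^{−pm}. -/
lemma pr_seq_forall_le (m : ℕ) (A : QueryAlg X α) (s : Set α) {p : ℝ}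
    (h : ENNReal.ofReal p ≤ pr (output f A) s) :
    pr (output f (seq m fun _ => A)) {v | ∀ j, v j ∉ s} ≤ ENNReal.ofReal (Real.exp (-(p * m))) := by
  have h1 : pr (output f (seq m fun _ => A)) {v | ∀ j, v j ∉ s}
      = ∏ _j : Fin m, pr (output f A) sᶜ := by
    simp only [pr_eq_lexp]
    rw [← lexp_seq]
    congr 1 with v
    by_cases hv : ∀ j, v j ∉ s
    · simp [hv]
    · push Not at hv
      obtain ⟨j, hj⟩ := hv
      rw [Finset.prod_eq_zero (Finset.mem_univ j)]
      · simp only [Set.indicator_apply_eq_zero, Set.mem_ofPred_eq]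
        exact fun h => absurd hj (h j)
      · simp [hj]
  have h2 : pr (output f A) sᶜ ≤ ENNReal.ofReal (1 - p) := by
    apply pr_compl_le
    simpa using h
  have h3 : pr (output f A) sᶜ ≤ ENNReal.ofReal (Real.exp (-p)) :=
    h2.trans (ENNReal.ofReal_le_ofReal (by linarith [Real.add_one_le_exp (-p)]))
  rw [h1, Finset.prod_const, Finset.card_univ, Fintype.card_fin]
  calc _ ≤ ENNReal.ofReal (Real.exp (-p)) ^ m := by gcongr
    _ = _ := by
      rw [← ENNReal.ofReal_pow (Real.exp_pos _).le, ← Real.exp_nat_mul]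
      ring_nf

/-- A Hoeffding bound for independent copies of a random variable with values in `[-1, 1]`. -/
lemma pr_seq_sum_ge [Fintype α] (m : ℕ) (A : QueryAlg X α) (Y : α → ℝ) (hY : ∀ a, |Y a| ≤ 1)
    {μ ε : ℝ} (hμ : rexp (output f A) Y = μ) (h0 : 0 ≤ ε) (h1 : ε ≤ 1) :
    pr (output f (seq m fun _ => A)) {v | (μ + ε) * m ≤ ∑ j, Y (v j)} ≤
      ENNReal.ofReal (Real.exp (-(ε ^ 2 / 4 * m))) := by
  have hμ1 : |μ| ≤ 1 := by
    rw [abs_le, ← hμ]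
    constructor
    · rw [← rexp_const (output f A) (-1)]
      exact rexp_mono _ fun a => (abs_le.1 (hY a)).1
    · rw [← rexp_const (output f A) 1]
      exact rexp_mono _ fun a => (abs_le.1 (hY a)).2
  have hmgf : rexp (output f A) (fun a => Real.exp (ε / 2 * (Y a - μ - ε))) ≤
      Real.exp (-(ε ^ 2 / 4)) := by
    -- Chernoff's method with parameter ε/2: use e^t ≤ 1 + t + t² for t = (ε/2)(Y − μ), |t| ≤ 1, and
    -- replace Y² by 1. The bound becomes affine in Y, so only the mean enters.
    have hb : ∀ a, Real.exp (ε / 2 * (Y a - μ - ε)) ≤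
        Real.exp (-(ε ^ 2 / 2)) *
          ((1 - ε / 2 * μ + ε ^ 2 / 4 * (1 + μ ^ 2)) + (ε / 2 - ε ^ 2 / 2 * μ) * Y a) := by
      intro a
      have ht : |ε / 2 * (Y a - μ)| ≤ 1 := by
        rw [abs_mul, abs_of_nonneg (by positivity)]
        have : |Y a - μ| ≤ 2 := (abs_sub _ _).trans (by linarith [hY a])
        nlinarith [abs_nonneg (Y a - μ)]
      have h2 := (abs_le.1 (Real.abs_exp_sub_one_sub_id_le ht)).2
      have h3 : Y a ^ 2 ≤ 1 := by
        rw [← sq_abs]; exact pow_le_one₀ (abs_nonneg _) (hY a)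
      have h4 : ε ^ 2 / 4 * Y a ^ 2 ≤ ε ^ 2 / 4 * 1 := by gcongr
      rw [show ε / 2 * (Y a - μ - ε) = -(ε ^ 2 / 2) + ε / 2 * (Y a - μ) by ring, Real.exp_add]
      gcongr
      nlinarith
    refine (rexp_mono _ hb).trans ?_
    rw [rexp_const_mul, rexp_add, rexp_const, rexp_const_mul, hμ,
      show -(ε ^ 2 / 4) = -(ε ^ 2 / 2) + ε ^ 2 / 4 by ring, Real.exp_add]
    gcongr
    nlinarith [Real.add_one_le_exp (ε ^ 2 / 4), mul_nonneg (sq_nonneg ε) (sq_nonneg μ)]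
  calc pr (output f (seq m fun _ => A)) {v | (μ + ε) * m ≤ ∑ j, Y (v j)}
      ≤ lexp (output f (seq m fun _ => A)) fun v =>
          ∏ j, ENNReal.ofReal (Real.exp (ε / 2 * (Y (v j) - μ - ε))) := by
        rw [pr_eq_lexp]
        refine lexp_mono _ fun v => ?_
        by_cases hv : v ∈ {v : Fin m → α | (μ + ε) * m ≤ ∑ j, Y (v j)}
        swap
        · simp [Set.indicator_of_notMem hv]
        rw [Set.indicator_of_mem hv]
        rw [← ENNReal.ofReal_prod_of_nonneg fun j _ => (Real.exp_pos _).le, ← Real.exp_sum,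
          Pi.one_apply, ← ENNReal.ofReal_one]
        refine ENNReal.ofReal_le_ofReal (Real.one_le_exp ?_)
        rw [← Finset.mul_sum, Finset.sum_sub_distrib, Finset.sum_sub_distrib]
        simp only [Finset.sum_const, Finset.card_univ, Fintype.card_fin, nsmul_eq_mul]
        have : (μ + ε) * m ≤ ∑ j, Y (v j) := hv
        refine mul_nonneg (by positivity) (by linarith)
    _ ≤ ∏ _j : Fin m, ENNReal.ofReal (Real.exp (-(ε ^ 2 / 4))) := by
        rw [lexp_seq m (fun _ => A)
          fun _ a => ENNReal.ofReal (Real.exp (ε / 2 * (Y a - μ - ε)))]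
        refine Finset.prod_le_prod' fun j _ => ?_
        rw [lexp_eq_ofReal _ _ fun a => (Real.exp_pos _).le]
        exact ENNReal.ofReal_le_ofReal hmgf
    _ = _ := by
        rw [Finset.prod_const, Finset.card_univ, Fintype.card_fin,
          ← ENNReal.ofReal_pow (Real.exp_pos _).le, ← Real.exp_nat_mul]
        ring_nf

lemma pr_seq_sum_le [Fintype α] (m : ℕ) (A : QueryAlg X α) (Y : α → ℝ) (hY : ∀ a, |Y a| ≤ 1)
    {μ ε : ℝ} (hμ : rexp (output f A) Y = μ) (h0 : 0 ≤ ε) (h1 : ε ≤ 1) :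
    pr (output f (seq m fun _ => A)) {v | ∑ j, Y (v j) ≤ (μ - ε) * m} ≤
      ENNReal.ofReal (Real.exp (-(ε ^ 2 / 4 * m))) := by
  have h := pr_seq_sum_ge (f := f) m A (fun a => -Y a) (fun a => by simpa using hY a)
    (μ := -μ) (by rw [rexp_neg, hμ]) h0 h1
  refine (pr_mono _ fun v hv => ?_).trans h
  simp only [Finset.sum_neg_distrib, Set.mem_ofPred_eq] at hv ⊢
  linarith

/-! #### Query counts -/

lemma QueriesAtMost.mono {A : QueryAlg X α} {q r : ℕ} (h : QueriesAtMost f A q) (hqr : q ≤ r) :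
    QueriesAtMost f A r := by
  induction A generalizing q r with
  | ret a => trivial
  | query x next ih =>
    match q, r, h with
    | q + 1, r + 1, h => exact ih _ h (by omega)
  | rand p next ih => exact fun ω hω => ih ω (h ω hω) hqr

lemma QueriesAtMost.bind {A : QueryAlg X α} {F : α → QueryAlg X β} {q r : ℕ}
    (hA : QueriesAtMost f A q) (hF : ∀ a ∈ (output f A).support, QueriesAtMost f (F a) r) :
    QueriesAtMost f (A.bind F) (q + r) := by
  induction A generalizing q with
  | ret a => exact (hF a (by simp [output])).mono (by omega)
  | query x next ih =>
    match q, hA with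
    | q + 1, hA =>
      rw [show q + 1 + r = (q + r) + 1 by omega]
      exact ih _ hA hF
  | rand p next ih =>
    intro ω hω
    refine ih ω (hA ω hω) fun a ha => hF a ?_
    simp only [output, PMF.mem_support_bind_iff]
    exact ⟨ω, hω, ha⟩

lemma QueriesAtMost.bind' {A : QueryAlg X α} {F : α → QueryAlg X β} {q r : ℕ}
    (hA : QueriesAtMost f A q) (hF : ∀ a, QueriesAtMost f (F a) r) :
    QueriesAtMost f (A.bind F) (q + r) :=
  hA.bind fun a _ => hF a

lemma queriesAtMost_ret (a : α) (q : ℕ) : QueriesAtMost f (ret a : QueryAlg X α) q := trivial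

lemma queriesAtMost_sample (p : PMF α) (q : ℕ) : QueriesAtMost f (sample p : QueryAlg X α) q :=
  fun _ _ => trivial

lemma queriesAtMost_seq {m : ℕ} {A : Fin m → QueryAlg X α} {q : ℕ}
    (h : ∀ j, QueriesAtMost f (A j) q) : QueriesAtMost f (seq m A) (m * q) := by
  induction m with
  | zero => trivial
  | succ m ih =>
    rw [show (m + 1) * q = q + (m * q + 0) by ring]
    exact (h 0).bind' fun a => ((ih fun j => h j.succ).bind' (r := 0) fun r => trivial)

end QueryAlg

/-! ### Fourier analysis on the cube -/

/-- The Fourier coefficient of a real function on the cube. -/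
def coef {n : ℕ} (φ : Cube n → ℝ) (S : Finset (Fin n)) : ℝ := 𝔼 x : Cube n, φ x * chi S x

lemma toReal_one : toReal 1 = 1 := by simp [toReal]

lemma toReal_neg (s : ℤˣ) : toReal (-s) = -toReal s := by simp [toReal]

lemma toReal_mul (s t : ℤˣ) : toReal (s * t) = toReal s * toReal t := by simp [toReal]

lemma toReal_mul_self (s : ℤˣ) : toReal s * toReal s = 1 := by
  rcases Int.units_eq_one_or s with rfl | rfl <;> simp [toReal]

lemma abs_toReal (s : ℤˣ) : |toReal s| = 1 := by
  rcases Int.units_eq_one_or s with rfl | rfl <;> simp [toReal]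

lemma sum_units (g : ℤˣ → ℝ) : ∑ s, g s = g 1 + g (-1) := by
  rw [UnitsInt.univ, Finset.sum_pair (by decide)]

section

variable {n : ℕ}

lemma fourierCoeff_eq_coef (f : Cube n → ℤˣ) (S : Finset (Fin n)) :
    fourierCoeff f S = coef (fun x => toReal (f x)) S := rfl

lemma chi_mul (S : Finset (Fin n)) (x y : Cube n) : chi S (x * y) = chi S x * chi S y := by
  simp [chi, toReal_mul, Finset.prod_mul_distrib]

lemma chi_empty (x : Cube n) : chi ∅ x = 1 := rfl

lemma chi_singleton (i : Fin n) (x : Cube n) : chi {i} x = toReal (x i) := by simp [chi]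

lemma abs_chi (S : Finset (Fin n)) (x : Cube n) : |chi S x| = 1 := by
  simp [chi, Finset.abs_prod, abs_toReal]

lemma chi_eq_prod (S : Finset (Fin n)) (x : Cube n) :
    chi S x = ∏ i, if i ∈ S then toReal (x i) else 1 := by
  simp [chi, Finset.prod_ite_mem]

lemma card_cube : (Fintype.card (Cube n) : ℝ) = 2 ^ n := by simp

lemma sum_cube_prod (g : Fin n → ℤˣ → ℝ) :
    ∑ x : Cube n, ∏ i, g i (x i) = ∏ i, (g i 1 + g i (-1)) := by
  simp only [← sum_units, Finset.prod_univ_sum, Fintype.piFinset_univ]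

lemma expect_cube_prod (g : Fin n → ℤˣ → ℝ) :
    𝔼 x : Cube n, ∏ i, g i (x i) = ∏ i, ((g i 1 + g i (-1)) / 2) := by
  rw [Fintype.expect_eq_sum_div_card, sum_cube_prod, card_cube, Finset.prod_div_distrib]
  simp

lemma expect_chi_mul_chi (S T : Finset (Fin n)) :
    𝔼 x : Cube n, chi S x * chi T x = if S = T then 1 else 0 := by
  simp only [chi_eq_prod, ← Finset.prod_mul_distrib]
  rw [expect_cube_prod fun i s => (if i ∈ S then toReal s else 1) * if i ∈ T then toReal s else 1]
  split_ifs with h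
  · subst h
    refine Finset.prod_eq_one fun i _ => ?_
    split_ifs <;> norm_num [toReal]
  · obtain ⟨i, hi⟩ : ∃ i, ¬ (i ∈ S ↔ i ∈ T) := by
      by_contra hc; push Not at hc; exact h (Finset.ext hc)
    refine Finset.prod_eq_zero (Finset.mem_univ i) ?_
    by_cases h1 : i ∈ S <;> by_cases h2 : i ∈ T <;> simp [h1, h2, toReal] at hi ⊢

/-- The sum is the expansion of ∏ (1 + x_i y_i), whose factors are 2 where x and y agree and 0
elsewhere. -/
lemma sum_chi_mul_chi (x y : Cube n) :
    ∑ S : Finset (Fin n), chi S x * chi S y = if x = y then 2 ^ n else 0 := by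
  have h : ∏ i : Fin n, (toReal (x i) * toReal (y i) + 1) =
      ∑ S : Finset (Fin n), chi S x * chi S y := by
    rw [Finset.prod_add_one, Finset.powerset_univ]
    simp [chi, Finset.prod_mul_distrib]
  rw [← h]
  split_ifs with hxy
  · subst hxy; simp [toReal_mul_self]; norm_num
  · obtain ⟨i, hi⟩ := Function.ne_iff.1 hxy
    refine Finset.prod_eq_zero (Finset.mem_univ i) ?_
    rcases Int.units_eq_one_or (x i) with h1 | h1 <;> rcases Int.units_eq_one_or (y i) with h2 | h2
      <;> simp [h1, h2, toReal] at hi ⊢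

/-- Fourier inversion. -/
lemma eq_sum_coef (φ : Cube n → ℝ) (x : Cube n) : φ x = ∑ S, coef φ S * chi S x := by
  have h : ∀ S, coef φ S * chi S x = (∑ y : Cube n, φ y * (chi S y * chi S x)) / 2 ^ n := by
    intro S
    rw [coef, Fintype.expect_eq_sum_div_card, card_cube, div_mul_eq_mul_div, Finset.sum_mul]
    simp only [mul_assoc]
  simp only [h, ← Finset.sum_div]
  rw [Finset.sum_comm]
  simp only [← Finset.mul_sum, sum_chi_mul_chi]
  simp

lemma coef_sum (c : Finset (Fin n) → ℝ) (S : Finset (Fin n)) :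
    coef (fun x => ∑ T, c T * chi T x) S = c S := by
  simp only [coef, Finset.sum_mul, Finset.expect_sum_comm, mul_assoc, ← Finset.mul_expect,
    expect_chi_mul_chi]
  simp

lemma expect_mul_sum (φ : Cube n → ℝ) (c : Finset (Fin n) → ℝ) :
    𝔼 x, φ x * ∑ S, c S * chi S x = ∑ S, c S * coef φ S := by
  simp only [coef, Finset.mul_sum, Finset.expect_sum_comm, Finset.mul_expect]
  simp only [mul_left_comm]

/-- Parseval's identity. -/
lemma expect_sq (φ : Cube n → ℝ) : 𝔼 x, φ x ^ 2 = ∑ S, coef φ S ^ 2 := by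
  simp only [sq, ← expect_mul_sum, ← eq_sum_coef]

/-- A threefold convolution cubes Fourier coefficients. It serves twice: for h inside `hastad`, and
for the signal in the self-correction. -/
lemma expect_conv (φ : Cube n → ℝ) (x : Cube n) :
    𝔼 y, 𝔼 z, φ (x * y * z) * φ y * φ z = ∑ S, coef φ S ^ 3 * chi S x := by
  have h : ∀ y, 𝔼 z, φ (x * y * z) * φ y * φ z =
      φ y * ∑ S, (coef φ S ^ 2 * chi S x) * chi S y := by
    intro y
    have h1 : ∀ z, φ (x * y * z) * φ y * φ z =
        φ y * (φ z * ∑ S, (coef φ S * chi S x * chi S y) * chi S z) := by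
      intro z
      rw [eq_sum_coef φ (x * y * z)]
      simp only [chi_mul, mul_assoc]
      ring
    simp only [h1, ← Finset.mul_expect, expect_mul_sum]
    congr 1
    refine Finset.sum_congr rfl fun S _ => ?_
    ring
  simp only [h, expect_mul_sum]
  refine Finset.sum_congr rfl fun S _ => ?_
  ring

lemma sum_noiseWeight_mul_chi (η : Fin n → ℝ) (S : Finset (Fin n)) :
    ∑ y, noiseWeight η y * chi S y = ∏ i ∈ S, η i := by
  simp only [noiseWeight, chi_eq_prod, ← Finset.prod_mul_distrib]
  rw [sum_cube_prod fun i s => (1 + η i * toReal s) / 2 * if i ∈ S then toReal s else 1,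
    show ∏ i ∈ S, η i = ∏ i, if i ∈ S then η i else 1 by simp [Finset.prod_ite_mem]]
  refine Finset.prod_congr rfl fun i _ => ?_
  split_ifs <;> simp [toReal] <;> ring

/-- The uniform y₁, y₂ cube the coefficients, and averaging χ_S over the noise y₃ contributes
∏_{i∈S} η_i. -/
lemma hastad_eq_sum (η : Fin n → ℝ) (f : Cube n → ℤˣ) (x : Cube n) :
    hastad η f x = ∑ S, (fourierCoeff f S ^ 3 * ∏ i ∈ S, η i) * chi S x := by
  have h : hastad η f x = ∑ w, noiseWeight η w *
      𝔼 y, 𝔼 z, toReal (f (x * w * y * z)) * toReal (f y) * toReal (f z) := by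
    simp only [hastad, Finset.expect_sum_comm, Finset.mul_expect]
    refine Finset.sum_congr rfl fun w _ => Finset.expect_congr rfl fun y _ =>
      Finset.expect_congr rfl fun z _ => ?_
    rw [show x * y * z * w = x * w * y * z by
      rw [mul_assoc x w y, mul_comm w y, ← mul_assoc, mul_assoc _ w z, mul_comm w z, ← mul_assoc]]
    ring
  rw [h]
  simp only [expect_conv (fun x => toReal (f x)), chi_mul, Finset.mul_sum]
  rw [Finset.sum_comm]
  refine Finset.sum_congr rfl fun S _ => ?_
  rw [← sum_noiseWeight_mul_chi, Finset.mul_sum, Finset.sum_mul]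
  refine Finset.sum_congr rfl fun w _ => ?_
  rw [fourierCoeff_eq_coef]
  ring

lemma sum_fourierCoeff_sq (f : Cube n → ℤˣ) : ∑ S, fourierCoeff f S ^ 2 = 1 := by
  simp only [fourierCoeff_eq_coef]
  rw [← expect_sq]
  simp [sq, toReal_mul_self]

lemma abs_fourierCoeff_le_one (f : Cube n → ℤˣ) (S : Finset (Fin n)) :
    |fourierCoeff f S| ≤ 1 := by
  rw [← sq_le_one_iff_abs_le_one, ← sum_fourierCoeff_sq f]
  exact Finset.single_le_sum (f := fun S => fourierCoeff f S ^ 2)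
    (fun _ _ => sq_nonneg _) (Finset.mem_univ S)

lemma sum_abs_fourierCoeff_cube_le (f : Cube n → ℤˣ) (I : Finset (Finset (Fin n))) :
    ∑ S ∈ I, |fourierCoeff f S| ^ 3 ≤ 1 := by
  rw [← sum_fourierCoeff_sq f]
  refine (Finset.sum_le_sum fun S _ => ?_).trans
    (Finset.sum_le_sum_of_subset_of_nonneg (Finset.subset_univ I) fun S _ _ => sq_nonneg _)
  rw [pow_succ, sq_abs]
  exact mul_le_of_le_one_right (sq_nonneg _) (abs_fourierCoeff_le_one f S)

end

/-! ### Functions with a dominant linear coefficient -/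

section

variable {n : ℕ}

/-- The coefficient of `{i}` is at least `3α²` in absolute value and carries at least two thirds
of the Fourier weight of `φ`. -/
def Dominant (α : ℝ) (φ : Cube n → ℝ) (i : Fin n) : Prop :=
  3 * α ^ 2 ≤ |coef φ {i}| ∧ ∑ S ∈ Finset.univ.erase {i}, coef φ S ^ 2 ≤ coef φ {i} ^ 2 / 2

/-- No other coefficient exceeds |φ̂({i})| in absolute value, so their cubes sum to at most
|φ̂({i})| times the remaining weight, which is at most φ̂({i})²/2. -/
lemma Dominant.abs_cube_sub_le {α : ℝ} {φ : Cube n → ℝ} {i : Fin n} (h : Dominant α φ i)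
    (x : Cube n) :
    |∑ S, coef φ S ^ 3 * chi S x - coef φ {i} ^ 3 * toReal (x i)| ≤ |coef φ {i}| ^ 3 / 2 := by
  have hS : ∀ S ∈ Finset.univ.erase ({i} : Finset (Fin n)),
      |coef φ S ^ 3 * chi S x| ≤ |coef φ {i}| * coef φ S ^ 2 := by
    intro S hS
    have h1 : coef φ S ^ 2 ≤ coef φ {i} ^ 2 / 2 :=
      (Finset.single_le_sum (f := fun S => coef φ S ^ 2) (fun _ _ => sq_nonneg _) hS).trans h.2
    have h2 : |coef φ S| ≤ |coef φ {i}| :=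
      sq_le_sq.1 (h1.trans (by linarith [sq_nonneg (coef φ {i})]))
    rw [abs_mul, abs_chi, mul_one, pow_succ, abs_mul, abs_of_nonneg (sq_nonneg _), mul_comm]
    gcongr
  rw [← Finset.add_sum_erase _ _ (Finset.mem_univ {i}), chi_singleton, add_sub_cancel_left]
  refine (Finset.abs_sum_le_sum_abs _ _).trans ((Finset.sum_le_sum hS).trans ?_)
  rw [← Finset.mul_sum]
  refine (mul_le_mul_of_nonneg_left h.2 (abs_nonneg _)).trans_eq ?_
  rw [← sq_abs (coef φ {i})]
  ring

/-- With A = ∑ φ̂² and m = max φ̂², one has ∑ φ̂⁴ ≤ mA. The hypothesis then yields m ≥ 2A/3, so the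
weight off the maximum is at most m/2, and also a lower bound for m of order α⁴. The latter rules
out a maximizer of degree 0 or of degree at least 2. -/
lemma exists_dominant {α : ℝ} (hα : 0 < α) {φ : Cube n → ℝ} (h0 : coef φ ∅ = 0)
    (h2 : ∀ S : Finset (Fin n), 2 ≤ S.card → |coef φ S| ≤ α ^ 2 / 2)
    (h : 2 / 3 * (∑ S, coef φ S ^ 2) ^ 2 + 133 * α ^ 8 ≤ ∑ S, coef φ S ^ 4) :
    ∃ i, Dominant α φ i := by
  obtain ⟨T, -, hT⟩ := Finset.exists_max_image Finset.univ (fun S => coef φ S ^ 2)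
    ⟨∅, Finset.mem_univ _⟩
  have hB : ∑ S, coef φ S ^ 4 ≤ coef φ T ^ 2 * ∑ S, coef φ S ^ 2 := by
    rw [Finset.mul_sum]
    refine Finset.sum_le_sum fun S hS => ?_
    rw [show coef φ S ^ 4 = coef φ S ^ 2 * coef φ S ^ 2 by ring]
    exact mul_le_mul_of_nonneg_right (hT S hS) (sq_nonneg _)
  have hA := Finset.add_sum_erase Finset.univ (fun S => coef φ S ^ 2) (Finset.mem_univ T)
  have hR : 0 ≤ ∑ S ∈ Finset.univ.erase T, coef φ S ^ 2 := Finset.sum_nonneg fun _ _ => sq_nonneg _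
  set R := ∑ S ∈ Finset.univ.erase T, coef φ S ^ 2
  set A := ∑ S, coef φ S ^ 2
  have hm : 0 ≤ coef φ T ^ 2 := sq_nonneg _
  set m := coef φ T ^ 2 with hm_def
  have hα8 : 0 < α ^ 8 := by positivity
  have hA0 : 0 < A := by
    rcases (show 0 ≤ A by linarith).eq_or_lt with h3 | h3
    · rw [← h3] at h hB; nlinarith
    · exact h3
  have hmA : 2 / 3 * A ≤ m := by
    by_contra hc
    push Not at hc
    nlinarith
  have hRm : R ≤ m / 2 := by linarith
  -- Since A ≤ 3m/2, the hypothesis gives 133α⁸ ≤ mA ≤ 3m²/2, hence m² ≥ 88α⁸.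
  have hm2 : (9 * α ^ 4) ^ 2 ≤ m ^ 2 := by nlinarith
  have hm3 : 9 * α ^ 4 ≤ m := le_of_sq_le_sq hm2 hm
  have hm4 : 3 * α ^ 2 ≤ |coef φ T| := by
    rw [← abs_of_nonneg (show 0 ≤ 3 * α ^ 2 by positivity), ← sq_le_sq]
    linarith
  have hcard : T.card = 1 := by
    have : T.card ≠ 0 := by
      intro h
      rw [Finset.card_eq_zero.1 h, h0] at hm4
      have : 0 < α ^ 2 := by positivity
      simp at hm4
      linarith
    have : ¬ 2 ≤ T.card := by
      intro h
      have := h2 T h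
      have : 0 < α ^ 2 := by positivity
      linarith
    omega
  obtain ⟨i, rfl⟩ := Finset.card_eq_one.1 hcard
  exact ⟨i, hm4, hRm⟩

/-- Parseval for the error φ − a x_i bounds both |φ̂({i}) − a|² and the weight off {i}, together, by
a²/16. Hence |φ̂({i})| ≥ 3|a|/4 ≥ 6α², with at most a ninth of φ̂({i})² elsewhere. -/
lemma isolated_estimates {α a : ℝ} {φ : Cube n → ℝ} {i : Fin n} (hα : 0 < α)
    (ha : 8 * α ^ 2 ≤ |a|) (h : ∀ x, |φ x - a * toReal (x i)| ≤ |a| / 4) :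
    Dominant α φ i ∧ 0 < coef φ {i} * a ∧
      2 / 3 * (∑ S, coef φ S ^ 2) ^ 2 + 200 * α ^ 8 ≤ ∑ S, coef φ S ^ 4 := by
  have hα2 : 0 < α ^ 2 := by positivity
  have hcoef : ∀ S, coef (fun x => φ x - a * toReal (x i)) S =
      coef φ S - if S = {i} then a else 0 := by
    intro S
    have h1 : (fun x => φ x - a * toReal (x i)) =
        fun x => ∑ T, (coef φ T - if T = {i} then a else 0) * chi T x := by
      ext x
      simp only [sub_mul, Finset.sum_sub_distrib, ← eq_sum_coef, ite_mul, zero_mul]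
      simp [chi_singleton]
    rw [h1, coef_sum]
  have hsum : ∑ S, coef (fun x => φ x - a * toReal (x i)) S ^ 2 ≤ a ^ 2 / 16 := by
    rw [← expect_sq]
    refine (Finset.expect_le_expect (g := fun _ => a ^ 2 / 16) fun x _ => ?_).trans_eq
      (Fintype.expect_const _)
    have := pow_le_pow_left₀ (abs_nonneg _) (h x) 2
    rw [sq_abs, div_pow, sq_abs] at this
    linarith
  rw [← Finset.add_sum_erase _ _ (Finset.mem_univ {i}), hcoef, if_pos rfl] at hsum
  have hrest : ∑ S ∈ Finset.univ.erase {i}, coef (fun x => φ x - a * toReal (x i)) S ^ 2 =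
      ∑ S ∈ Finset.univ.erase {i}, coef φ S ^ 2 := by
    refine Finset.sum_congr rfl fun S hS => ?_
    rw [hcoef, if_neg (Finset.ne_of_mem_erase hS), sub_zero]
  rw [hrest] at hsum
  have hR : 0 ≤ ∑ S ∈ Finset.univ.erase {i}, coef φ S ^ 2 :=
    Finset.sum_nonneg fun _ _ => sq_nonneg _
  have hA := Finset.add_sum_erase Finset.univ (fun S => coef φ S ^ 2) (Finset.mem_univ {i})
  have hB : coef φ {i} ^ 4 ≤ ∑ S, coef φ S ^ 4 :=
    Finset.single_le_sum (f := fun S => coef φ S ^ 4) (fun S _ => by positivity)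
      (Finset.mem_univ {i})
  unfold Dominant
  set R := ∑ S ∈ Finset.univ.erase {i}, coef φ S ^ 2
  set A := ∑ S, coef φ S ^ 2
  set B := ∑ S, coef φ S ^ 4
  set u := coef φ {i}
  have hau : |u - a| ≤ |a| / 4 := by
    rw [← abs_of_nonneg (show 0 ≤ |a| / 4 by positivity), ← sq_le_sq, div_pow, sq_abs]
    linarith
  have hu : 3 / 4 * |a| ≤ |u| := by
    have h1 := abs_sub_abs_le_abs_sub a u
    rw [abs_sub_comm] at h1
    linarith
  have hu2 : 9 / 16 * a ^ 2 ≤ u ^ 2 := by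
    have := pow_le_pow_left₀ (by positivity) hu 2
    rw [mul_pow, sq_abs, sq_abs] at this
    linarith
  have hRu : R ≤ u ^ 2 / 9 := by nlinarith [sq_nonneg (u - a)]
  have ha2 : 0 < |a| := by linarith
  refine ⟨⟨by linarith, by linarith [sq_nonneg u]⟩, ?_, ?_⟩
  · have h1 : |u - a| ^ 2 ≤ (|a| / 4) ^ 2 := by gcongr
    rw [sq_abs, div_pow, sq_abs] at h1
    have h2 : 0 < a ^ 2 := by rw [← sq_abs]; positivity
    nlinarith [sq_nonneg u]
  -- The margin is u⁴ − (2/3)(10/9)²u⁴ = (43/243)u⁴, and |u| ≥ 6α² makes it at least 229α⁸.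
  · have h1 : A ^ 2 ≤ (10 / 9 * u ^ 2) ^ 2 := by
      apply pow_le_pow_left₀ <;> linarith [sq_nonneg u]
    have h2 : (6 * α ^ 2) ^ 4 ≤ |u| ^ 4 := by
      apply pow_le_pow_left₀ <;> linarith
    rw [show |u| ^ 4 = u ^ 4 by rw [show 4 = 2 * 2 from rfl, pow_mul, sq_abs, ← pow_mul]] at h2
    have hα8 : 0 < α ^ 8 := by positivity
    ring_nf at h1 h2 ⊢
    ring_nf at hB
    linarith

/-! ### The function that is estimated by sampling -/

/-- Half of `H_η h - E[h]³`. -/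
def signal (η : Fin n → ℝ) (h : Cube n → ℤˣ) (x : Cube n) : ℝ :=
  (hastad η h x - (𝔼 y : Cube n, toReal (h y)) ^ 3) / 2

lemma fourierCoeff_empty (h : Cube n → ℤˣ) : fourierCoeff h ∅ = 𝔼 y : Cube n, toReal (h y) := by
  simp [fourierCoeff, chi_empty]

lemma hastad_zero (h : Cube n → ℤˣ) (x : Cube n) :
    hastad 0 h x = (𝔼 y : Cube n, toReal (h y)) ^ 3 := by
  rw [hastad_eq_sum, Finset.sum_eq_single ∅]
  · simp [fourierCoeff_empty, chi_empty]
  · intro S _ hS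
    obtain ⟨i, hi⟩ := Finset.nonempty_iff_ne_empty.2 hS
    rw [Finset.prod_eq_zero hi rfl]
    simp
  · simp

lemma signal_eq_sum (η : Fin n → ℝ) (h : Cube n → ℤˣ) (x : Cube n) :
    signal η h x =
      ∑ S, (if S = ∅ then 0 else fourierCoeff h S ^ 3 * (∏ i ∈ S, η i) / 2) * chi S x := by
  rw [signal, hastad_eq_sum, ← fourierCoeff_empty, ← Finset.add_sum_erase _ _ (Finset.mem_univ ∅),
    ← Finset.add_sum_erase Finset.univ (fun S =>
      (if S = ∅ then 0 else fourierCoeff h S ^ 3 * (∏ i ∈ S, η i) / 2) * chi S x)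
      (Finset.mem_univ ∅)]
  simp only [Finset.prod_empty, chi_empty, mul_one, add_sub_cancel_left, if_true, zero_add,
    Finset.sum_div]
  refine Finset.sum_congr rfl fun S hS => ?_
  rw [if_neg (Finset.ne_of_mem_erase hS)]
  ring

lemma coef_signal (η : Fin n → ℝ) (h : Cube n → ℤˣ) (S : Finset (Fin n)) :
    coef (signal η h) S = if S = ∅ then 0 else fourierCoeff h S ^ 3 * (∏ i ∈ S, η i) / 2 := by
  rw [show signal η h = fun x => _ from funext (signal_eq_sum η h), coef_sum]

lemma alpha_pos {κ : ℝ} (hκ : 0 < κ) : 0 < alpha κ := by unfold alpha; positivity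

lemma alpha_le_one {κ : ℝ} (hκ : 0 < κ) (hκ1 : κ ≤ 1) : alpha κ ≤ 1 := by
  unfold alpha
  have := pow_le_one₀ (n := 3) hκ.le hκ1
  linarith

lemma abs_prod_noiseVec_le {κ : ℝ} (hκ : 0 < κ) (b : Fin n → Bool)
    (S : Finset (Fin n)) : |∏ i ∈ S, noiseVec κ b i| ≤ alpha κ ^ S.card := by
  rw [Finset.abs_prod]
  refine (Finset.prod_le_prod (fun i _ => abs_nonneg _) (g := fun _ => alpha κ)
    fun i _ => ?_).trans_eq (Finset.prod_const _)
  have := alpha_pos hκ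
  unfold noiseVec
  split_ifs <;> simp [abs_of_pos, this, this.le]

/-- Each element of S contributes a factor of at most α ≤ 1. This is the degree gap needed in
`exists_dominant`. -/
lemma abs_coef_signal_le {κ : ℝ} (hκ : 0 < κ) (hκ1 : κ ≤ 1) (b : Fin n → Bool)
    (h : Cube n → ℤˣ) (S : Finset (Fin n)) (hS : 2 ≤ S.card) :
    |coef (signal (noiseVec κ b) h) S| ≤ alpha κ ^ 2 / 2 := by
  have h0 : S ≠ ∅ := by rintro rfl; simp at hS
  rw [coef_signal, if_neg h0, abs_div, abs_mul, abs_pow, abs_two]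
  have h1 : |fourierCoeff h S| ^ 3 ≤ 1 := pow_le_one₀ (abs_nonneg _) (abs_fourierCoeff_le_one h S)
  have h2 : |∏ i ∈ S, noiseVec κ b i| ≤ alpha κ ^ 2 :=
    (abs_prod_noiseVec_le hκ b S).trans
      (pow_le_pow_of_le_one (alpha_pos hκ).le (alpha_le_one hκ hκ1) hS)
  have := mul_le_mul h1 h2 (abs_nonneg _) zero_le_one
  linarith

/-- The sign of a nonzero real number. -/
def signUnit (c : ℝ) : ℤˣ := if 0 < c then 1 else -1

/-- Apply `isolated_estimates` with a = αĥ({i})³/2: the choice α = κ³/16 turns |ĥ({i})| ≥ κ into |a|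
≥ 8α². As φ stays within |a|/4 of a x_i, its sign is that of a x_i, and φ̂({i}) has the sign of a.
-/
lemma Isolates.estimates {κ : ℝ} (hκ : 0 < κ) {h : Cube n → ℤˣ} {b : Fin n → Bool} {i : Fin n}
    (hi : Isolates κ h b i) :
    Dominant (alpha κ) (signal (noiseVec κ b) h) i ∧
      (∀ x, candidate κ h b x = signUnit (coef (signal (noiseVec κ b) h) {i}) * x i) ∧
      2 / 3 * (∑ S, coef (signal (noiseVec κ b) h) S ^ 2) ^ 2 + 200 * alpha κ ^ 8 ≤
        ∑ S, coef (signal (noiseVec κ b) h) S ^ 4 := by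
  have hα := alpha_pos hκ
  set c := fourierCoeff h {i} with hc
  have hc3 : κ ^ 3 ≤ |c| ^ 3 := pow_le_pow_left₀ hκ.le hi.1 3
  have ha : |alpha κ * c ^ 3 / 2| = alpha κ * |c| ^ 3 / 2 := by
    rw [abs_div, abs_mul, abs_of_pos hα, abs_pow, abs_two]
  have h1 : ∀ x, |signal (noiseVec κ b) h x - alpha κ * c ^ 3 / 2 * toReal (x i)| ≤
      |alpha κ * c ^ 3 / 2| / 4 := by
    intro x
    have h2 := hi.2 x
    rw [← hc, fourierCoeff_empty] at h2
    rw [ha, show signal (noiseVec κ b) h x - alpha κ * c ^ 3 / 2 * toReal (x i) =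
      (hastad (noiseVec κ b) h x - (𝔼 y : Cube n, toReal (h y)) ^ 3
        - alpha κ * c ^ 3 * toReal (x i)) / 2 by unfold signal; ring, abs_div, abs_two]
    linarith
  have h8 : 8 * alpha κ ^ 2 ≤ |alpha κ * c ^ 3 / 2| := by
    rw [ha]
    have : 16 * alpha κ ≤ |c| ^ 3 := by unfold alpha; linarith
    nlinarith
  obtain ⟨hd, hs, hB⟩ := isolated_estimates hα h8 h1
  refine ⟨hd, fun x => ?_, hB⟩
  have h2 := abs_le.1 (h1 x)
  have h3 : 0 < |alpha κ * c ^ 3 / 2| := lt_of_lt_of_le (by positivity) h8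
  have h4 : candidate κ h b x = if 0 ≤ signal (noiseVec κ b) h x then 1 else -1 := by
    unfold candidate signal
    refine if_congr ?_ rfl rfl
    constructor <;> intro <;> linarith
  rw [h4]
  set a := alpha κ * c ^ 3 / 2
  set u := coef (signal (noiseVec κ b) h) {i}
  unfold signUnit
  rcases pos_and_pos_or_neg_and_neg_of_mul_pos hs with ⟨hu, hpa⟩ | ⟨hu, hna⟩
  · rw [if_pos hu, abs_of_pos hpa] at *
    rcases Int.units_eq_one_or (x i) with hx | hx <;> rw [hx] at h2 ⊢ <;> simp [toReal] at h2
    · rw [if_pos (by linarith)]; rfl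
    · rw [if_neg (by linarith)]; rfl
  · rw [if_neg hu.not_gt, abs_of_neg hna] at *
    rcases Int.units_eq_one_or (x i) with hx | hx <;> rw [hx] at h2 ⊢ <;> simp [toReal] at h2
    · rw [if_neg (by linarith)]; rfl
    · rw [if_pos (by linarith)]; rfl

end

/-! ### Randomized bits -/

namespace QueryAlg

variable {X : Type} {f : X → ℤˣ}

/-- The expectation of the bit output by `A`. -/
def mean (f : X → ℤˣ) (A : QueryAlg X ℤˣ) : ℝ := rexp (output f A) toReal

/-- The product of two independent bits. -/
def mul (A B : QueryAlg X ℤˣ) : QueryAlg X ℤˣ := A.bind fun a => B.bind fun b => ret (a * b)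

lemma mean_bind {α : Type} [Fintype α] (A : QueryAlg X α) (F : α → QueryAlg X ℤˣ) :
    mean f (A.bind F) = rexp (output f A) fun a => mean f (F a) := by
  simp only [mean, output_bind, rexp_bind]

lemma mean_rand {Ω : Type} [Fintype Ω] (p : PMF Ω) (F : Ω → QueryAlg X ℤˣ) :
    mean f (rand p F) = rexp p fun a => mean f (F a) := by
  simp only [mean, output, rexp_bind]

lemma mean_ret (a : ℤˣ) : mean f (ret a) = toReal a := rexp_pure _ _

lemma mean_query (x : X) (F : ℤˣ → QueryAlg X ℤˣ) :
    mean f (query x F) = mean f (F (f x)) := rfl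

lemma mean_mul (A B : QueryAlg X ℤˣ) : mean f (mul A B) = mean f A * mean f B := by
  simp only [mul, mean_bind, mean_ret, toReal_mul, rexp_const_mul, rexp_mul_const]
  rfl

lemma QueriesAtMost.mul {A B : QueryAlg X ℤˣ} {q r : ℕ} (hA : QueriesAtMost f A q)
    (hB : QueriesAtMost f B r) : QueriesAtMost f (mul A B) (q + r) :=
  hA.bind' fun _ => hB.bind' (r := 0) fun _ => trivial

/-- Decide whether the average of `m` independent copies of the bit `A` is at least `t`. -/
def threshold (m : ℕ) (A : QueryAlg X ℤˣ) (t : ℝ) : QueryAlg X Bool :=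
  (seq m fun _ => A).bind fun v => ret (decide (t * m ≤ ∑ j, toReal (v j)))

lemma queriesAtMost_threshold {m q : ℕ} {A : QueryAlg X ℤˣ} {t : ℝ} (hA : QueriesAtMost f A q) :
    QueriesAtMost f (threshold m A t) (m * q) :=
  (queriesAtMost_seq fun _ => hA).bind' (r := 0) fun _ => trivial

/-- The number of samples for which an average is `ε`-accurate, except with probability `δ`. -/
def samples (ε δ : ℝ) : ℕ := ⌈4 / ε ^ 2 * Real.log (1 / δ)⌉₊

lemma exp_samples_le {ε δ : ℝ} (hε : 0 < ε) (hδ : 0 < δ) :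
    Real.exp (-(ε ^ 2 / 4 * samples ε δ)) ≤ δ := by
  have h : 4 / ε ^ 2 * Real.log (1 / δ) ≤ samples ε δ := Nat.le_ceil _
  have h1 : Real.log (1 / δ) ≤ ε ^ 2 / 4 * samples ε δ := by
    calc Real.log (1 / δ) = ε ^ 2 / 4 * (4 / ε ^ 2 * Real.log (1 / δ)) := by field_simp
      _ ≤ _ := by gcongr
  calc Real.exp (-(ε ^ 2 / 4 * samples ε δ)) ≤ Real.exp (-Real.log (1 / δ)) := by gcongr
    _ = δ := by rw [one_div, Real.log_inv, neg_neg, Real.exp_log hδ]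

lemma pr_threshold_false {A : QueryAlg X ℤˣ} {t ε δ : ℝ} (h0 : 0 < ε) (h1 : ε ≤ 1) (hδ : 0 < δ)
    (hA : t + ε ≤ mean f A) :
    pr (output f (threshold (samples ε δ) A t)) {false} ≤ ENNReal.ofReal δ := by
  rw [threshold, output_bind]
  refine (pr_bind_le _ _ _ {v | ∑ j, toReal (v j) ≤ (mean f A - ε) * samples ε δ} (ε := 0)
    fun v hv => ?_).trans ?_
  · have h2 : t * samples ε δ ≤ ∑ j, toReal (v j) := by
      have h3 : (mean f A - ε) * samples ε δ < ∑ j, toReal (v j) := by simpa using hv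
      have : t * samples ε δ ≤ (mean f A - ε) * samples ε δ := by
        gcongr; linarith
      linarith
    simp [pr, h2, output]
  · rw [add_zero]
    refine (pr_seq_sum_le _ A toReal (fun a => (abs_toReal a).le) rfl h0.le h1).trans ?_
    exact ENNReal.ofReal_le_ofReal (exp_samples_le h0 hδ)

lemma pr_threshold_true {A : QueryAlg X ℤˣ} {t ε δ : ℝ} (h0 : 0 < ε) (h1 : ε ≤ 1) (hδ : 0 < δ)
    (hA : mean f A + ε ≤ t) :
    pr (output f (threshold (samples ε δ) A t)) {true} ≤ ENNReal.ofReal δ := by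
  rw [threshold, output_bind]
  refine (pr_bind_le _ _ _ {v | (mean f A + ε) * samples ε δ ≤ ∑ j, toReal (v j)} (ε := 0)
    fun v hv => ?_).trans ?_
  · have h2 : ¬ t * samples ε δ ≤ ∑ j, toReal (v j) := by
      have h3 : ∑ j, toReal (v j) < (mean f A + ε) * samples ε δ := by simpa using hv
      have : (mean f A + ε) * samples ε δ ≤ t * samples ε δ := by gcongr
      linarith
    simp [pr, h2, output]
  · rw [add_zero]
    refine (pr_seq_sum_ge _ A toReal (fun a => (abs_toReal a).le) rfl h0.le h1).trans ?_
    exact ENNReal.ofReal_le_ofReal (exp_samples_le h0 hδ)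

end QueryAlg

open QueryAlg

section

variable {n : ℕ}

/-- Draw `y` from the product distribution `noiseWeight η`. -/
def drawNoise (η : Fin n → ℝ) : QueryAlg (Cube n) (Cube n) :=
  seq n fun i => rand (coin ((1 + η i) / 2)) fun c => ret (if c then 1 else -1)

lemma rexp_drawNoise (f : Cube n → ℤˣ) {η : Fin n → ℝ} (hη : ∀ i, |η i| ≤ 1) (φ : Cube n → ℝ) :
    rexp (output f (drawNoise η)) φ = ∑ y, noiseWeight η y * φ y := by
  refine Finset.sum_congr rfl fun y _ => ?_
  congr 1
  rw [drawNoise, output_seq_apply, ENNReal.toReal_prod, noiseWeight]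
  refine Finset.prod_congr rfl fun i _ => ?_
  have hi := abs_le.1 (hη i)
  have h : ∀ s : ℤˣ, ((output f (rand (coin ((1 + η i) / 2)) fun c =>
      (ret (if c then 1 else -1) : QueryAlg (Cube n) ℤˣ))) s).toReal
      = rexp (output f (rand (coin ((1 + η i) / 2)) fun c =>
      (ret (if c then 1 else -1) : QueryAlg (Cube n) ℤˣ))) (fun t => if t = s then 1 else 0) := by
    intro s
    simp only [rexp, mul_ite, mul_one, mul_zero, Finset.sum_ite_eq', Finset.mem_univ, if_true]
  rw [h, output, rexp_bind]
  simp only [output_ret, rexp_pure]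
  rw [rexp_coin (by linarith) (by linarith)]
  rcases Int.units_eq_one_or (y i) with hy | hy <;> rw [hy]
  · simp [toReal]
  · simp [toReal]
    ring

lemma mean_drawNoise_bind (f : Cube n → ℤˣ) {η : Fin n → ℝ} (hη : ∀ i, |η i| ≤ 1)
    (F : Cube n → QueryAlg (Cube n) ℤˣ) :
    mean f ((drawNoise η).bind F) = ∑ y, noiseWeight η y * mean f (F y) := by
  rw [mean_bind, rexp_drawNoise f hη]

/-- Draw a uniform point of the cube. -/
def drawPoint : QueryAlg (Cube n) (Cube n) := sample (PMF.uniformOfFintype (Cube n))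

lemma mean_drawPoint_bind (f : Cube n → ℤˣ) (F : Cube n → QueryAlg (Cube n) ℤˣ) :
    mean f (drawPoint.bind F) = 𝔼 y, mean f (F y) := by
  rw [mean_bind, drawPoint, output_sample, rexp_uniform]

/-- A random bit with expectation `signal (noiseVec κ b) (restrict f ρ) x`. -/
def signalBit (κ : ℝ) (ρ : Restriction n) (b : Fin n → Bool) (x : Cube n) :
    QueryAlg (Cube n) ℤˣ :=
  rand (coin (1 / 2)) fun c =>
    drawPoint.bind fun y₁ => drawPoint.bind fun y₂ =>
      (drawNoise (if c then noiseVec κ b else 0)).bind fun y₃ =>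
        query (fun i => (ρ i).getD (y₁ i)) fun a₁ =>
          query (fun i => (ρ i).getD (y₂ i)) fun a₂ =>
            query (fun i => (ρ i).getD ((x * y₁ * y₂ * y₃) i)) fun a₃ =>
              ret ((if c then 1 else -1) * (a₁ * a₂ * a₃))

/-- The two outcomes of the fair coin contribute H_η h/2 and −H_0 h/2. At noise rate 0 the third
query point is uniform and independent of the other two, so H_0 h = E[h]³. -/
lemma mean_signalBit {κ : ℝ} (hκ : 0 < κ) (hκ1 : κ ≤ 1) (f : Cube n → ℤˣ) (ρ : Restriction n)
    (b : Fin n → Bool) (x : Cube n) :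
    mean f (signalBit κ ρ b x) = signal (noiseVec κ b) (restrict f ρ) x := by
  have hα := alpha_pos hκ
  have hη : ∀ i, |noiseVec κ b i| ≤ 1 := by
    intro i
    unfold noiseVec
    split_ifs
    · rw [abs_of_pos hα]; exact alpha_le_one hκ hκ1
    · simp
  have h0 : ∀ i : Fin n, |(0 : Fin n → ℝ) i| ≤ 1 := by simp
  rw [signalBit, mean_rand, rexp_coin (by norm_num) (by norm_num)]
  simp only [mean_drawPoint_bind, mean_query, mean_ret, if_true,
    Bool.false_eq_true, if_false, mean_drawNoise_bind f hη, mean_drawNoise_bind f h0]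
  rw [signal, ← hastad_zero (restrict f ρ) x, hastad, hastad]
  simp only [restrict, toReal_mul, toReal_neg, neg_mul, one_mul, mul_neg,
    Finset.sum_neg_distrib, Finset.expect_neg_distrib, mul_assoc]
  ring

/-- The self-corrected bit at `x`. -/
def correctedBit (κ : ℝ) (ρ : Restriction n) (b : Fin n → Bool) (x : Cube n) :
    QueryAlg (Cube n) ℤˣ :=
  drawPoint.bind fun y => drawPoint.bind fun z =>
    mul (mul (signalBit κ ρ b (x * y * z)) (signalBit κ ρ b y)) (signalBit κ ρ b z)

/-- A random bit whose expectation is large if and only if `signal` is dominated by one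
coefficient of degree one. -/
def linearityBit (κ : ℝ) (ρ : Restriction n) (b : Fin n → Bool) : QueryAlg (Cube n) ℤˣ :=
  -- The probabilities 3/5 and 2/5 weight ∑ φ̂⁴ and −(∑ φ̂²)² in the ratio 1 : 2/3. Two independent
  -- signal bits at a common point have a product of mean φ(x)², which averages to ∑ φ̂².
  rand (coin (3 / 5)) fun c =>
    if c then drawPoint.bind fun x => mul (signalBit κ ρ b x) (correctedBit κ ρ b x)
    else mul (ret (-1)) (mul
      (drawPoint.bind fun x => mul (signalBit κ ρ b x) (signalBit κ ρ b x))
      (drawPoint.bind fun x => mul (signalBit κ ρ b x) (signalBit κ ρ b x)))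

lemma mean_correctedBit {κ : ℝ} (hκ : 0 < κ) (hκ1 : κ ≤ 1) (f : Cube n → ℤˣ) (ρ : Restriction n)
    (b : Fin n → Bool) (x : Cube n) :
    mean f (correctedBit κ ρ b x) =
      ∑ S, coef (signal (noiseVec κ b) (restrict f ρ)) S ^ 3 * chi S x := by
  simp only [correctedBit, mean_drawPoint_bind, mean_mul, mean_signalBit hκ hκ1, expect_conv]

lemma mean_linearityBit {κ : ℝ} (hκ : 0 < κ) (hκ1 : κ ≤ 1) (f : Cube n → ℤˣ) (ρ : Restriction n)
    (b : Fin n → Bool) :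
    mean f (linearityBit κ ρ b) =
      3 / 5 * (∑ S, coef (signal (noiseVec κ b) (restrict f ρ)) S ^ 4 -
        2 / 3 * (∑ S, coef (signal (noiseVec κ b) (restrict f ρ)) S ^ 2) ^ 2) := by
  rw [linearityBit, mean_rand, rexp_coin (by norm_num) (by norm_num)]
  simp only [mean_drawPoint_bind, mean_mul, mean_signalBit hκ hκ1, mean_correctedBit hκ hκ1,
    mean_ret, if_true, Bool.false_eq_true, if_false, expect_mul_sum, ← sq, expect_sq, toReal_neg,
    toReal_one]
  simp only [← pow_succ]
  ring

lemma queriesAtMost_drawNoise (f : Cube n → ℤˣ) (η : Fin n → ℝ) :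
    QueriesAtMost f (drawNoise η) 0 :=
  queriesAtMost_seq (q := 0) fun _ _ _ => trivial

lemma queriesAtMost_drawPoint_bind {f : Cube n → ℤˣ} {α : Type} {F : Cube n → QueryAlg (Cube n) α}
    {q : ℕ} (h : ∀ y, QueriesAtMost f (F y) q) : QueriesAtMost f (drawPoint.bind F) q := by
  rw [← Nat.zero_add q]
  exact (queriesAtMost_sample (PMF.uniformOfFintype (Cube n)) 0).bind' h

lemma queriesAtMost_signalBit (f : Cube n → ℤˣ) (κ : ℝ) (ρ : Restriction n) (b : Fin n → Bool)
    (x : Cube n) : QueriesAtMost f (signalBit κ ρ b x) 3 := by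
  intro c _
  refine queriesAtMost_drawPoint_bind fun y₁ => queriesAtMost_drawPoint_bind fun y₂ => ?_
  rw [show 3 = 0 + 3 from rfl]
  exact (queriesAtMost_drawNoise f _).bind' fun y₃ => trivial

lemma queriesAtMost_correctedBit (f : Cube n → ℤˣ) (κ : ℝ) (ρ : Restriction n)
    (b : Fin n → Bool) (x : Cube n) : QueriesAtMost f (correctedBit κ ρ b x) 9 :=
  queriesAtMost_drawPoint_bind fun _ => queriesAtMost_drawPoint_bind fun _ =>
    ((queriesAtMost_signalBit f κ ρ b _).mul (queriesAtMost_signalBit f κ ρ b _)).mul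
      (queriesAtMost_signalBit f κ ρ b _)

lemma queriesAtMost_linearityBit (f : Cube n → ℤˣ) (κ : ℝ) (ρ : Restriction n)
    (b : Fin n → Bool) : QueriesAtMost f (linearityBit κ ρ b) 12 := by
  intro c _
  cases c
  · have h : QueriesAtMost f
        (drawPoint.bind fun x => mul (signalBit κ ρ b x) (signalBit κ ρ b x)) 6 :=
      queriesAtMost_drawPoint_bind fun x =>
        (queriesAtMost_signalBit f κ ρ b x).mul (queriesAtMost_signalBit f κ ρ b x)
    exact (queriesAtMost_ret _ 0).mul (h.mul h)
  · exact queriesAtMost_drawPoint_bind fun x =>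
      (queriesAtMost_signalBit f κ ρ b x).mul (queriesAtMost_correctedBit f κ ρ b x)

/-! ### The two subroutines -/

/-- Estimate the sign of the self-corrected signal. -/
def evalRoutine (n : ℕ) (κ : ℝ) : EvalRoutine n := fun ρ b x δ =>
  -- For a dominant coefficient the mean has absolute value at least (3α²)³/2 = 13.5α⁶, so accuracy
  -- 8α⁶ determines its sign.
  (threshold (samples (8 * alpha κ ^ 6) δ) (correctedBit κ ρ b x) 0).bind fun c =>
    ret (if c then 1 else -1)

/-- Check that the signal is dominated by one coefficient of degree one. -/
def testRoutine (n : ℕ) (κ : ℝ) : TestRoutine n := fun ρ b _ δ =>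
  -- The mean is at least (3/5)·200α⁸ = 120α⁸ for isolating patterns, and (3/5)·133α⁸ < 80α⁸ already
  -- forces dominance, so cutting at 100α⁸ with accuracy 10α⁸ separates the cases. A union bound
  -- over MT tests of confidence δ/(MT) would exhaust δ; the divisor 16 leaves room for the other
  -- failures.
  threshold (samples (10 * alpha κ ^ 8) (δ / 16)) (linearityBit κ ρ b) (100 * alpha κ ^ 8)

lemma queriesAtMost_evalRoutine (f : Cube n → ℤˣ) (κ : ℝ) (ρ : Restriction n)
    (b : Fin n → Bool) (x : Cube n) (δ : ℝ) :
    QueriesAtMost f (evalRoutine n κ ρ b x δ) (samples (8 * alpha κ ^ 6) δ * 9) :=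
  (queriesAtMost_threshold (queriesAtMost_correctedBit f κ ρ b x)).bind' (r := 0) fun _ => trivial

lemma queriesAtMost_testRoutine (f : Cube n → ℤˣ) (κ : ℝ) (ρ : Restriction n)
    (b : Fin n → Bool) (ν δ : ℝ) :
    QueriesAtMost f (testRoutine n κ ρ b ν δ) (samples (10 * alpha κ ^ 8) (δ / 16) * 12) :=
  queriesAtMost_threshold (queriesAtMost_linearityBit f κ ρ b)

lemma alpha_le {κ : ℝ} (hκ : 0 < κ) (hκ1 : κ ≤ 1) : alpha κ ≤ 1 / 16 := by
  unfold alpha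
  have := pow_le_one₀ (n := 3) hκ.le hκ1
  linarith

lemma le_output_evalRoutine {κ : ℝ} (hκ : 0 < κ) (hκ1 : κ ≤ 1) {f : Cube n → ℤˣ}
    {ρ : Restriction n} {b : Fin n → Bool} {i : Fin n}
    (hd : Dominant (alpha κ) (signal (noiseVec κ b) (restrict f ρ)) i) (x : Cube n) {δ : ℝ}
    (hδ : 0 < δ) :
    ENNReal.ofReal (1 - δ) ≤ (evalRoutine n κ ρ b x δ).output f
      (signUnit (coef (signal (noiseVec κ b) (restrict f ρ)) {i}) * x i) := by
  have hα := alpha_pos hκ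
  have hα1 := alpha_le hκ hκ1
  have hα6 : 0 < alpha κ ^ 6 := by positivity
  have hε0 : 0 < 8 * alpha κ ^ 6 := by positivity
  have hε1 : 8 * alpha κ ^ 6 ≤ 1 := by
    have : alpha κ ^ 6 ≤ (1 / 16) ^ 6 := by gcongr
    norm_num at this ⊢; linarith
  have hG := hd.abs_cube_sub_le x
  rw [← mean_correctedBit hκ hκ1] at hG
  set u := coef (signal (noiseVec κ b) (restrict f ρ)) {i} with hu
  have hu3 : (3 * alpha κ ^ 2) ^ 3 ≤ |u| ^ 3 := by gcongr; exact hd.1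
  have hu3' : 27 * alpha κ ^ 6 ≤ |u| ^ 3 := by
    calc _ = (3 * alpha κ ^ 2) ^ 3 := by ring
      _ ≤ _ := hu3
  rw [← pr_singleton]
  refine le_pr_of_compl_le _ hδ.le ?_
  rw [evalRoutine, output_bind]
  set s := signUnit u * x i with hs
  have hsu : u ^ 3 * toReal (x i) = |u| ^ 3 * toReal s := by
    rw [hs, toReal_mul]
    unfold signUnit
    split_ifs with h
    · rw [abs_of_pos h, toReal_one, one_mul]
    · rw [abs_of_nonpos (not_lt.1 h), toReal_neg, toReal_one]; ring
  rw [hsu] at hG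
  have hG' := abs_le.1 hG
  rcases Int.units_eq_one_or s with h1 | h1
  · rw [h1, toReal_one] at hG'
    refine (pr_bind_le _ _ _ {false} (ε := 0) fun c hc => ?_).trans ?_
    · have : c = true := by simpa using hc
      simp [this, pr, output, h1]
    · rw [add_zero]
      exact pr_threshold_false hε0 hε1 hδ (by linarith)
  · rw [h1, toReal_neg, toReal_one] at hG'
    refine (pr_bind_le _ _ _ {true} (ε := 0) fun c hc => ?_).trans ?_
    · have : c = false := by simpa using hc
      simp [this, pr, output, h1]
    · rw [add_zero]
      exact pr_threshold_true hε0 hε1 hδ (by linarith)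

/-- The procedure `evalRoutine n κ ρ b` computes `s * Dict i`. -/
def EvaluatesDict (f : Cube n → ℤˣ) (κ : ℝ) (c : Restriction n × (Fin n → Bool)) (i : Fin n)
    (s : ℤˣ) : Prop :=
  ∀ (x : Cube n) (δ : ℝ), 0 < δ → δ < 1 →
    ENNReal.ofReal (1 - δ) ≤ (evalRoutine n κ c.1 c.2 x δ).output f (s * x i)

lemma Dominant.evaluatesDict {κ : ℝ} (hκ : 0 < κ) (hκ1 : κ ≤ 1) {f : Cube n → ℤˣ}
    {ρ : Restriction n} {b : Fin n → Bool} {i : Fin n}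
    (hd : Dominant (alpha κ) (signal (noiseVec κ b) (restrict f ρ)) i) :
    EvaluatesDict f κ (ρ, b) i (signUnit (coef (signal (noiseVec κ b) (restrict f ρ)) {i})) :=
  fun x _ hδ _ => le_output_evalRoutine hκ hκ1 hd x hδ

lemma testRoutine_complete {κ : ℝ} (hκ : 0 < κ) (hκ1 : κ ≤ 1) {f : Cube n → ℤˣ}
    {ρ : Restriction n} {b : Fin n → Bool} {i : Fin n} (hi : Isolates κ (restrict f ρ) b i)
    (ν : ℝ) {δ : ℝ} (hδ : 0 < δ) :
    ENNReal.ofReal (1 - δ / 16) ≤ (testRoutine n κ ρ b ν δ).output f true := by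
  have hα := alpha_pos hκ
  have hα1 := alpha_le hκ hκ1
  have hα8 : 0 < alpha κ ^ 8 := by positivity
  have hε1 : 10 * alpha κ ^ 8 ≤ 1 := by
    have : alpha κ ^ 8 ≤ (1 / 16) ^ 8 := by gcongr
    norm_num at this ⊢; linarith
  rw [← pr_singleton]
  refine le_pr_of_compl_le _ (by positivity) ?_
  rw [show ({true} : Set Bool)ᶜ = {false} by ext c; simp]
  refine pr_threshold_false (by positivity) hε1 (by positivity) ?_
  rw [mean_linearityBit hκ hκ1]
  linarith [(hi.estimates hκ).2.2]

lemma testRoutine_sound {κ : ℝ} (hκ : 0 < κ) (hκ1 : κ ≤ 1) {f : Cube n → ℤˣ}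
    {ρ : Restriction n} {b : Fin n → Bool} (h : ¬ ∃ i s, EvaluatesDict f κ (ρ, b) i s)
    (ν : ℝ) {δ : ℝ} (hδ : 0 < δ) :
    (testRoutine n κ ρ b ν δ).output f true ≤ ENNReal.ofReal (δ / 16) := by
  have hα := alpha_pos hκ
  have hα1 := alpha_le hκ hκ1
  have hα8 : 0 < alpha κ ^ 8 := by positivity
  have hε1 : 10 * alpha κ ^ 8 ≤ 1 := by
    have : alpha κ ^ 8 ≤ (1 / 16) ^ 8 := by gcongr
    norm_num at this ⊢; linarith
  rw [← pr_singleton]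
  refine pr_threshold_true (by positivity) hε1 (by positivity) ?_
  rw [mean_linearityBit hκ hκ1]
  by_contra hc
  obtain ⟨i, hi⟩ := exists_dominant hα (by rw [coef_signal, if_pos rfl])
    (abs_coef_signal_le hκ hκ1 b (restrict f ρ)) (by linarith)
  exact h ⟨i, _, hi.evaluatesDict hκ hκ1⟩


/-! ### Random noise patterns isolate a coordinate with a large coefficient -/

/-- The allowed error is at least ακ³/4. Terms of degree at least 2 use α² ∑ |ĥ|³ ≤ α² = ακ³/16,
which leaves 3ακ³/16 for the other marked linear coefficients. -/
lemma isolates_of_sum_le {κ : ℝ} (hκ : 0 < κ) (hκ1 : κ ≤ 1) {h : Cube n → ℤˣ}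
    {b : Fin n → Bool} {i : Fin n} (hi : κ ≤ |fourierCoeff h {i}|) (hb : b i = true)
    (hsum : ∑ j ∈ Finset.univ.erase i, (if b j then |fourierCoeff h {j}| ^ 3 else 0) ≤
      3 / 16 * κ ^ 3) : Isolates κ h b i := by
  refine ⟨hi, fun x => ?_⟩
  have hα := alpha_pos hκ
  have hα1 := alpha_le_one hκ hκ1
  have h1 : hastad (noiseVec κ b) h x - fourierCoeff h ∅ ^ 3
      - alpha κ * fourierCoeff h {i} ^ 3 * toReal (x i) =
      ∑ S ∈ Finset.univ.erase {i}, 2 * coef (signal (noiseVec κ b) h) S * chi S x := by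
    have h2 := eq_sum_coef (signal (noiseVec κ b) h) x
    rw [← Finset.add_sum_erase _ _ (Finset.mem_univ {i}), coef_signal,
      if_neg (Finset.singleton_ne_empty i), chi_singleton, Finset.prod_singleton] at h2
    simp only [mul_assoc, ← Finset.mul_sum]
    rw [fourierCoeff_empty]
    have h3 : noiseVec κ b i = alpha κ := by simp [noiseVec, hb]
    rw [h3, signal] at h2
    linear_combination 2 * h2
  have hterm : ∀ S ∈ Finset.univ.erase ({i} : Finset (Fin n)),
      |2 * coef (signal (noiseVec κ b) h) S * chi S x| ≤ alpha κ ^ 2 * |fourierCoeff h S| ^ 3 +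
        ∑ j ∈ Finset.univ.erase i,
          if S = {j} then alpha κ * (if b j then |fourierCoeff h {j}| ^ 3 else 0) else 0 := by
    intro S hS
    have hnn : ∀ S : Finset (Fin n), 0 ≤ ∑ j ∈ Finset.univ.erase i,
        if S = {j} then alpha κ * (if b j then |fourierCoeff h {j}| ^ 3 else 0) else 0 := by
      intro S
      refine Finset.sum_nonneg fun j _ => ?_
      split_ifs <;> positivity
    rw [abs_mul, abs_chi, mul_one, coef_signal]
    split_ifs with h0
    · rw [mul_zero, abs_zero]
      exact add_nonneg (by positivity) (hnn S)
    · rw [mul_div_cancel₀ _ (two_ne_zero), abs_mul, abs_pow]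
      rcases (Finset.one_le_card.2 (Finset.nonempty_iff_ne_empty.2 h0)).eq_or_lt with h1 | h1
      · obtain ⟨j, rfl⟩ := Finset.card_eq_one.1 h1.symm
        have hj : j ≠ i := by rintro rfl; simp at hS
        rw [Finset.sum_eq_single_of_mem j (by simp [hj])
          (fun l _ hl => if_neg fun h => hl (Finset.singleton_injective h).symm), if_pos rfl,
          Finset.prod_singleton]
        refine le_add_of_nonneg_of_le (by positivity) ?_
        unfold noiseVec
        split_ifs
        · rw [abs_of_pos hα, mul_comm]
        · simp
      · refine le_add_of_le_of_nonneg ?_ (hnn S)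
        rw [mul_comm]
        gcongr
        exact (abs_prod_noiseVec_le hκ b S).trans (pow_le_pow_of_le_one hα.le hα1 h1)
  rw [h1]
  refine (Finset.abs_sum_le_sum_abs _ _).trans ((Finset.sum_le_sum hterm).trans ?_)
  rw [Finset.sum_add_distrib, ← Finset.mul_sum, Finset.sum_comm]
  have h4 : ∀ j ∈ Finset.univ.erase i, (∑ S ∈ Finset.univ.erase ({i} : Finset (Fin n)),
      if S = {j} then alpha κ * (if b j then |fourierCoeff h {j}| ^ 3 else 0) else 0) =
        alpha κ * (if b j then |fourierCoeff h {j}| ^ 3 else 0) := by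
    intro j hj
    have hj' : ({j} : Finset (Fin n)) ∈ Finset.univ.erase ({i} : Finset (Fin n)) := by
      simpa using hj
    rw [Finset.sum_eq_single_of_mem _ hj' (fun S _ hS => if_neg hS), if_pos rfl]
  rw [Finset.sum_congr rfl h4, ← Finset.mul_sum]
  have h5 := sum_abs_fourierCoeff_cube_le h (Finset.univ.erase {i})
  have h6 : κ ^ 3 ≤ |fourierCoeff h {i}| ^ 3 := by gcongr
  have h7 : alpha κ ^ 2 = alpha κ * (κ ^ 3 / 16) := by rw [sq]; rfl
  calc _ ≤ alpha κ ^ 2 * 1 + alpha κ * (3 / 16 * κ ^ 3) := by gcongr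
    _ = alpha κ / 4 * κ ^ 3 := by rw [h7]; ring
    _ ≤ _ := by gcongr

lemma rexp_sampleNoise_prod {κ : ℝ} (hκ : 0 < κ) (hκ1 : κ ≤ 1) (f : Cube n → ℤˣ)
    (J : Finset (Fin n)) :
    rexp (output f (sampleNoise n κ)) (fun b => ∏ j ∈ J, if b j then 1 else 0) =
      (κ ^ 6 / 16) ^ J.card := by
  have h6 : κ ^ 6 ≤ 1 := pow_le_one₀ hκ.le hκ1
  have h := rexp_seq (f := f) n (fun _ => sample (coin (κ ^ 6 / 16)))
    (fun j c => if j ∈ J then if c then 1 else 0 else 1)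
  simp only [Finset.prod_ite_mem, Finset.univ_inter] at h
  rw [sampleNoise, h, ← Finset.prod_const]
  rw [show ∏ _j ∈ J, κ ^ 6 / 16 = ∏ j, if j ∈ J then κ ^ 6 / 16 else 1 by
    simp [Finset.prod_ite_mem]]
  refine Finset.prod_congr rfl fun j _ => ?_
  rw [output_sample, rexp_coin (by positivity) (by linarith)]
  by_cases hj : j ∈ J <;> simp [hj]

/-- Let p = κ⁶/16. Coordinate i is marked with probability p, and by Markov and ∑ |ĥ({j})|³ ≤ 1 it
is marked with an overfull linear sum with probability at most 16p²/(3κ³) = κ⁹/48. The difference is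
at least κ⁶/24. -/
lemma le_pr_isolates {κ : ℝ} (hκ : 0 < κ) (hκ1 : κ ≤ 1) (f : Cube n → ℤˣ) {h : Cube n → ℤˣ}
    {i : Fin n} (hi : κ ≤ |fourierCoeff h {i}|) :
    ENNReal.ofReal (κ ^ 6 / 32) ≤
      pr (output f (sampleNoise n κ)) {b | Isolates κ h b i} := by
  rw [pr_eq_ofReal_rexp]
  refine ENNReal.ofReal_le_ofReal ?_
  have hκ3 : 0 < κ ^ 3 := by positivity
  -- Markov's inequality in pointwise form, with the factor 1[b i] kept inside, so that its
  -- expectation involves only pairs of marks.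
  have hpt : ∀ b : Fin n → Bool, (∏ j ∈ ({i} : Finset (Fin n)), if b j then 1 else 0) +
      -(16 / (3 * κ ^ 3)) * ∑ j ∈ Finset.univ.erase i,
        |fourierCoeff h {j}| ^ 3 * ∏ l ∈ ({i, j} : Finset (Fin n)), (if b l then 1 else 0) ≤
      Set.indicator {b | Isolates κ h b i} 1 b := by
    intro b
    have h1 : ∀ j ∈ Finset.univ.erase i, |fourierCoeff h {j}| ^ 3 *
        ∏ l ∈ ({i, j} : Finset (Fin n)), (if b l then (1 : ℝ) else 0) =
        (if b i then (1 : ℝ) else 0) * if b j then |fourierCoeff h {j}| ^ 3 else 0 := by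
      intro j hj
      rw [Finset.prod_pair (Finset.ne_of_mem_erase hj).symm]
      split_ifs <;> simp
    rw [Finset.sum_congr rfl h1, ← Finset.mul_sum, Finset.prod_singleton]
    by_cases hb : b i = true
    · rw [if_pos hb, one_mul]
      by_cases hs : ∑ j ∈ Finset.univ.erase i, (if b j then |fourierCoeff h {j}| ^ 3 else 0) ≤
          3 / 16 * κ ^ 3
      · rw [Set.indicator_of_mem (show b ∈ {b | Isolates κ h b i} from
          isolates_of_sum_le hκ hκ1 hi hb hs), Pi.one_apply]
        have : 0 ≤ ∑ j ∈ Finset.univ.erase i, (if b j then |fourierCoeff h {j}| ^ 3 else 0) := by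
          refine Finset.sum_nonneg fun j _ => ?_
          split_ifs <;> positivity
        have := mul_nonneg (show 0 ≤ 16 / (3 * κ ^ 3) by positivity) this
        linarith
      · push Not at hs
        have h2 : 1 ≤ 16 / (3 * κ ^ 3) *
            ∑ j ∈ Finset.univ.erase i, (if b j then |fourierCoeff h {j}| ^ 3 else 0) := by
          calc (1 : ℝ) = 16 / (3 * κ ^ 3) * (3 / 16 * κ ^ 3) := by field_simp
            _ ≤ _ := by gcongr
        refine le_trans (by linarith) (Set.indicator_nonneg (fun _ _ => zero_le_one) b)
    · rw [if_neg hb]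
      rw [zero_mul, mul_zero, add_zero]
      exact Set.indicator_nonneg (fun _ _ => zero_le_one) b
  refine le_trans ?_ (rexp_mono _ hpt)
  rw [rexp_add, rexp_const_mul, rexp_sum, rexp_sampleNoise_prod hκ hκ1]
  have h2 : ∀ j ∈ Finset.univ.erase i, rexp (output f (sampleNoise n κ)) (fun b =>
      |fourierCoeff h {j}| ^ 3 * ∏ l ∈ ({i, j} : Finset (Fin n)), (if b l then 1 else 0)) =
      |fourierCoeff h {j}| ^ 3 * (κ ^ 6 / 16) ^ 2 := by
    intro j hj
    rw [rexp_const_mul, rexp_sampleNoise_prod hκ hκ1,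
      Finset.card_pair (Finset.ne_of_mem_erase hj).symm]
  rw [Finset.sum_congr rfl h2, ← Finset.sum_mul, Finset.card_singleton, pow_one]
  have h3 : ∑ j ∈ Finset.univ.erase i, |fourierCoeff h {j}| ^ 3 ≤ 1 := by
    have := sum_abs_fourierCoeff_cube_le h ((Finset.univ.erase i).image fun j => {j})
    rwa [Finset.sum_image (fun a _ b _ h => Finset.singleton_injective h)] at this
  have h4 : 16 / (3 * κ ^ 3) * ((∑ j ∈ Finset.univ.erase i, |fourierCoeff h {j}| ^ 3) *
      (κ ^ 6 / 16) ^ 2) ≤ 16 / (3 * κ ^ 3) * (1 * (κ ^ 6 / 16) ^ 2) := by gcongr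
  have h5 : 16 / (3 * κ ^ 3) * (1 * (κ ^ 6 / 16) ^ 2) = κ ^ 6 * (κ ^ 3 / 48) := by
    field_simp; norm_num
  have h6 : κ ^ 3 ≤ 1 := pow_le_one₀ hκ.le hκ1
  have h7 : κ ^ 6 * (κ ^ 3 / 48) ≤ κ ^ 6 * (1 / 48) := by gcongr
  linarith [show 0 < κ ^ 6 by positivity]

/-! ### Random restrictions keep a large linear coefficient -/

/-- The law of one coordinate of the random restriction. -/
def restrictionLaw (k : ℕ) : PMF (Option ℤˣ) :=
  (coin (1 / k)).bind fun star =>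
    if star then PMF.pure none else (PMF.uniformOfFintype ℤˣ).map some

lemma rexp_restrictionLaw {k : ℕ} (hk : 1 ≤ k) (φ : Option ℤˣ → ℝ) :
    rexp (restrictionLaw k) φ =
      1 / k * φ none + (1 - 1 / k) * ((φ (some 1) + φ (some (-1))) / 2) := by
  have hk' : (1 : ℝ) ≤ k := by exact_mod_cast hk
  have h1 : (1 : ℝ) / k ≤ 1 := by rw [div_le_one (by linarith)]; exact hk'
  rw [restrictionLaw, rexp_bind, rexp_coin (by positivity) h1]
  simp only [if_true, Bool.false_eq_true, if_false, rexp_pure, PMF.map, rexp_bind,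
    rexp_uniform, Fintype.expect_eq_sum_div_card, sum_units, Function.comp_apply,
    Fintype.card_units_int]
  norm_num

lemma rexp_sampleRestriction_prod {k : ℕ} (hk : 1 ≤ k) (f : Cube n → ℤˣ)
    (g : Fin n → Option ℤˣ → ℝ) :
    rexp (output f (sampleRestriction n k)) (fun ρ => ∏ j, g j (ρ j)) =
      ∏ j, (1 / k * g j none + (1 - 1 / k) * ((g j (some 1) + g j (some (-1))) / 2)) := by
  rw [sampleRestriction, rexp_seq]
  refine Finset.prod_congr rfl fun j _ => ?_
  rw [output_sample]
  exact rexp_restrictionLaw hk (g j)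

/-- The contribution of one coordinate to the coefficient of `{i}` in a restricted `chi U`. -/
def restrictFactor (U : Finset (Fin n)) (i j : Fin n) (o : Option ℤˣ) : ℝ :=
  ((if j ∈ U then toReal (o.getD 1) else 1) * (if j = i then toReal 1 else 1) +
    (if j ∈ U then toReal (o.getD (-1)) else 1) * (if j = i then toReal (-1) else 1)) / 2

lemma fourierCoeff_restrict (f : Cube n → ℤˣ) (ρ : Restriction n) (i : Fin n) :
    fourierCoeff (restrict f ρ) {i} =
      ∑ U, fourierCoeff f U * ∏ j, restrictFactor U i j (ρ j) := by
  have h : ∀ U, 𝔼 x : Cube n, chi U (fun j => (ρ j).getD (x j)) * toReal (x i) =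
      ∏ j, restrictFactor U i j (ρ j) := by
    intro U
    rw [show ∏ j, restrictFactor U i j (ρ j) = 𝔼 x : Cube n, ∏ j,
      ((if j ∈ U then toReal ((ρ j).getD (x j)) else 1) * (if j = i then toReal (x j) else 1)) from
      (expect_cube_prod fun j s => (if j ∈ U then toReal ((ρ j).getD s) else 1) *
        (if j = i then toReal s else 1)).symm]
    refine Finset.expect_congr rfl fun x _ => ?_
    rw [Finset.prod_mul_distrib, chi_eq_prod]
    simp
  simp only [← h, fourierCoeff, chi_singleton]
  have h2 : ∀ x : Cube n, toReal (restrict f ρ x) =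
      ∑ U, fourierCoeff f U * chi U (fun j => (ρ j).getD (x j)) := fun x =>
    eq_sum_coef (fun x => toReal (f x)) _
  simp only [h2, Finset.sum_mul, Finset.expect_sum_comm, mul_assoc, ← Finset.mul_expect]
  rfl

lemma fourierCoeff_restrict_of_ne_none {f : Cube n → ℤˣ} {ρ : Restriction n} {i : Fin n}
    (h : ρ i ≠ none) : fourierCoeff (restrict f ρ) {i} = 0 := by
  rw [fourierCoeff_restrict]
  refine Finset.sum_eq_zero fun U _ => ?_
  rw [Finset.prod_eq_zero (Finset.mem_univ i), mul_zero]
  obtain ⟨s, hs⟩ := Option.ne_none_iff_exists'.1 h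
  simp [restrictFactor, hs, toReal_neg, toReal_one]

/-- Expand the square over pairs U, V. A coordinate lying in only one of them gives a factor of mean
0, so U = V. A term with i ∈ U survives exactly when i is starred and the rest of U is fixed, an
event of probability (1/k)(1 − 1/k)^{|U|−1}. -/
lemma rexp_fourierCoeff_restrict_sq {k : ℕ} (hk : 1 ≤ k) (f : Cube n → ℤˣ) (i : Fin n) :
    rexp (output f (sampleRestriction n k)) (fun ρ => fourierCoeff (restrict f ρ) {i} ^ 2) =
      ∑ U, if i ∈ U then fourierCoeff f U ^ 2 * (1 / k * (1 - 1 / k) ^ (U.card - 1)) else 0 := by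
  have hsq : ∀ ρ : Restriction n, fourierCoeff (restrict f ρ) {i} ^ 2 =
      ∑ U, ∑ V, fourierCoeff f U * fourierCoeff f V *
        ∏ j, (restrictFactor U i j (ρ j) * restrictFactor V i j (ρ j)) := by
    intro ρ
    rw [fourierCoeff_restrict, sq, Finset.sum_mul_sum]
    simp only [Finset.prod_mul_distrib]
    refine Finset.sum_congr rfl fun U _ => Finset.sum_congr rfl fun V _ => by ring
  have hprod : ∀ U V : Finset (Fin n), rexp (output f (sampleRestriction n k)) (fun ρ =>
      ∏ j, (restrictFactor U i j (ρ j) * restrictFactor V i j (ρ j))) =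
      if U = V then (if i ∈ U then 1 / (k : ℝ) * (1 - 1 / k) ^ (U.card - 1) else 0) else 0 := by
    intro U V
    rw [rexp_sampleRestriction_prod hk f fun j o => restrictFactor U i j o * restrictFactor V i j o]
    split_ifs with hUV hi
    · subst hUV
      rw [← Finset.mul_prod_erase _ _ (Finset.mem_univ i)]
      congr 1
      · simp [restrictFactor, hi, toReal_neg, toReal_one]
      · rw [← Finset.card_erase_of_mem hi, ← Finset.prod_const,
          show ∏ _j ∈ U.erase i, (1 - 1 / (k : ℝ)) =
            ∏ j ∈ Finset.univ.erase i, if j ∈ U.erase i then 1 - 1 / (k : ℝ) else 1 by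
          rw [Finset.prod_ite_mem]
          congr 1
          ext j; simp]
        refine Finset.prod_congr rfl fun j hj => ?_
        have hji := Finset.ne_of_mem_erase hj
        by_cases hjU : j ∈ U <;> simp [restrictFactor, hjU, hji, toReal_neg, toReal_one]
    · refine Finset.prod_eq_zero (Finset.mem_univ i) ?_
      simp [restrictFactor, hi, toReal_neg, toReal_one]
    · obtain ⟨j, hj⟩ : ∃ j, ¬ (j ∈ U ↔ j ∈ V) := by
        by_contra hc; push Not at hc; exact hUV (Finset.ext hc)
      refine Finset.prod_eq_zero (Finset.mem_univ j) ?_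
      by_cases hji : j = i <;> by_cases h1 : j ∈ U <;> by_cases h2 : j ∈ V <;>
        simp [restrictFactor, h1, h2, hji, toReal_neg, toReal_one] at hj ⊢ <;>
        simp_all
  simp only [hsq, rexp_sum, rexp_const_mul, hprod]
  refine Finset.sum_congr rfl fun U _ => ?_
  simp [sq]

/-- For m ≥ 1, m + 1 ≤ k gives 1 − 1/k ≥ (1 + 1/m)⁻¹, and (1 + 1/m)^m ≤ e ≤ 4. -/
lemma quarter_le_pow {k m : ℕ} (hm : m + 1 ≤ k) : (1 : ℝ) / 4 ≤ (1 - 1 / k) ^ m := by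
  rcases Nat.eq_zero_or_pos m with rfl | hm0
  · norm_num
  have hm0' : (0 : ℝ) < m := by exact_mod_cast hm0
  have hk : (m : ℝ) + 1 ≤ k := by exact_mod_cast hm
  have h1 : (1 + 1 / (m : ℝ))⁻¹ ≤ 1 - 1 / k := by
    rw [show (1 + 1 / (m : ℝ))⁻¹ = 1 - 1 / (m + 1) by field_simp; ring]
    gcongr
  have h2 : (1 + 1 / (m : ℝ)) ^ m ≤ 4 := by
    calc (1 + 1 / (m : ℝ)) ^ m ≤ Real.exp (1 / m) ^ m := by
          gcongr; linarith [Real.add_one_le_exp (1 / (m : ℝ))]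
      _ = Real.exp 1 := by rw [← Real.exp_nat_mul]; congr 1; field_simp
      _ ≤ 4 := by linarith [Real.exp_one_lt_d9]
  calc (1 : ℝ) / 4 ≤ ((1 + 1 / (m : ℝ)) ^ m)⁻¹ := by
        rw [one_div]; gcongr
    _ = ((1 + 1 / (m : ℝ))⁻¹) ^ m := by rw [inv_pow]
    _ ≤ _ := by gcongr

/-- The mean square of the coefficient is at least τ²/(4k³). Values below κ account for at most κ²/k
= τ²/(16k³) of it, and the remainder bounds the probability because coefficients are at most 1. -/
lemma le_pr_fourierCoeff_restrict {k : ℕ} (hk : 1 ≤ k) {τ : ℝ} (f : Cube n → ℤˣ)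
    {i : Fin n} (hi : τ ^ 2 / (k : ℝ) ^ 2 ≤ lowDegInfluence k f i) :
    ENNReal.ofReal (3 / 16 * (τ ^ 2 / k ^ 3)) ≤
      pr (output f (sampleRestriction n k))
        {ρ | kappa k τ ≤ |fourierCoeff (restrict f ρ) {i}|} := by
  have hk' : (1 : ℝ) ≤ k := by exact_mod_cast hk
  have hk0 : (0 : ℝ) < k := by linarith
  rw [pr_eq_ofReal_rexp]
  refine ENNReal.ofReal_le_ofReal ?_
  have hlow : lowDegInfluence k f i * (1 / (4 * k)) ≤ rexp (output f (sampleRestriction n k))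
      (fun ρ => fourierCoeff (restrict f ρ) {i} ^ 2) := by
    rw [rexp_fourierCoeff_restrict_sq hk, lowDegInfluence, Finset.sum_mul]
    refine Finset.sum_le_sum fun U _ => ?_
    have hnn : 0 ≤ 1 - 1 / (k : ℝ) := by
      rw [sub_nonneg, div_le_one hk0]; exact hk'
    split_ifs with h1 h2 h2
    · have hc : U.card - 1 + 1 ≤ k := by
        have := Finset.card_pos.2 ⟨i, h1.1⟩
        omega
      have := quarter_le_pow hc
      rw [show 1 / (4 * (k : ℝ)) = 1 / k * (1 / 4) by field_simp]
      gcongr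
    · exact absurd h1.1 h2
    · rw [zero_mul]; positivity
    · simp
  -- The κ² is charged only when i is starred, since otherwise the coefficient vanishes. Without the
  -- resulting factor 1/k, the loss τ²/(16k²) would swamp the main term for large k.
  have hup : ∀ ρ : Restriction n, fourierCoeff (restrict f ρ) {i} ^ 2 ≤
      Set.indicator {ρ | kappa k τ ≤ |fourierCoeff (restrict f ρ) {i}|} 1 ρ +
        kappa k τ ^ 2 * ∏ j, (if j = i then (if ρ j = none then (1 : ℝ) else 0) else 1) := by
    intro ρ
    rw [Finset.prod_ite_eq' Finset.univ i, if_pos (Finset.mem_univ i)]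
    have hind : 0 ≤ Set.indicator {ρ | kappa k τ ≤ |fourierCoeff (restrict f ρ) {i}|}
      (1 : Restriction n → ℝ) ρ := Set.indicator_nonneg (fun _ _ => zero_le_one) ρ
    by_cases h1 : ρ i = none
    · rw [if_pos h1, mul_one]
      by_cases h2 : kappa k τ ≤ |fourierCoeff (restrict f ρ) {i}|
      · rw [Set.indicator_of_mem (by exact h2), Pi.one_apply]
        have h3 : fourierCoeff (restrict f ρ) {i} ^ 2 ≤ 1 :=
          (sq_le_one_iff_abs_le_one _).2 (abs_fourierCoeff_le_one _ _)
        linarith [sq_nonneg (kappa k τ)]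
      · push Not at h2
        have := pow_le_pow_left₀ (abs_nonneg _) h2.le 2
        rw [sq_abs] at this
        linarith
    · rw [fourierCoeff_restrict_of_ne_none h1, if_neg h1]
      simpa using hind
  have h := hlow.trans (rexp_mono _ hup)
  rw [rexp_add, rexp_const_mul, rexp_sampleRestriction_prod hk f
    fun j o => if j = i then (if o = none then 1 else 0) else 1,
    Finset.prod_eq_single i (by intro j _ hj; simp [hj]) (by simp)] at h
  simp only [if_true, reduceCtorEq, if_false] at h
  have h4 : τ ^ 2 / (k : ℝ) ^ 2 * (1 / (4 * k)) ≤ lowDegInfluence k f i * (1 / (4 * k)) := by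
    gcongr
  have h5 : τ ^ 2 / (k : ℝ) ^ 2 * (1 / (4 * k)) = 1 / 4 * (τ ^ 2 / k ^ 3) := by field_simp
  have h6 : kappa k τ ^ 2 * (1 / (k : ℝ) * 1 + (1 - 1 / k) * ((0 + 0) / 2)) =
      1 / 16 * (τ ^ 2 / k ^ 3) := by unfold kappa; field_simp; ring
  linarith

/-- Few coordinates have large low-degree influence. -/
lemma card_mul_le_of_influential {k : ℕ} {t : ℝ} (f : Cube n → ℤˣ) (I : Finset (Fin n))
    (hI : ∀ i ∈ I, t ≤ lowDegInfluence k f i) : I.card * t ≤ k := by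
  have h1 : I.card * t ≤ ∑ i ∈ I, lowDegInfluence k f i := by
    rw [← nsmul_eq_mul]; exact Finset.card_nsmul_le_sum _ _ _ hI
  have h2 : ∑ i ∈ I, lowDegInfluence k f i ≤ ∑ S, k * fourierCoeff f S ^ 2 := by
    simp only [lowDegInfluence]
    rw [Finset.sum_comm]
    refine Finset.sum_le_sum fun S _ => ?_
    by_cases hS : S.card ≤ k
    · simp only [hS, and_true]
      rw [← Finset.sum_filter, Finset.sum_const, nsmul_eq_mul]
      gcongr
      refine (Finset.card_le_card fun i hi => ?_).trans hS
      simp only [Finset.mem_filter] at hi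
      exact hi.2
    · simp only [hS, and_false, if_false, Finset.sum_const_zero]
      positivity
  rw [← Finset.mul_sum, sum_fourierCoeff_sq, mul_one] at h2
  exact h1.trans h2


/-! ### Signed dictators -/

lemma expect_mul_of_ne {i j : Fin n} (hij : i ≠ j) :
    𝔼 x : Cube n, toReal (x i) * toReal (x j) = 0 := by
  have h := expect_chi_mul_chi ({i} : Finset (Fin n)) {j}
  simpa [chi_singleton, hij] using h

/-- Signed dictators of distinct coordinates are uncorrelated, hence differ on exactly half of the
cube. -/
lemma not_close_of_ne {ν : ℝ} (hν : ν < 1 / 2) {i j : Fin n} (hij : i ≠ j) (s t : ℤˣ) :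
    ¬ Close ν (fun x : Cube n => s * x i) (fun x => t * x j) := by
  intro h
  have h1 : ∀ x : Cube n, toReal s * toReal t * (toReal (x i) * toReal (x j)) =
      1 - 2 * if s * x i ≠ t * x j then 1 else 0 := by
    intro x
    rcases Int.units_eq_one_or s with rfl | rfl <;> rcases Int.units_eq_one_or t with rfl | rfl <;>
    rcases Int.units_eq_one_or (x i) with h1 | h1 <;>
    rcases Int.units_eq_one_or (x j) with h2 | h2 <;> rw [h1, h2] <;> norm_num [toReal]
  have h2 : ∑ x : Cube n, toReal s * toReal t * (toReal (x i) * toReal (x j)) = 0 := by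
    have h3 := expect_mul_of_ne hij
    rw [Fintype.expect_eq_sum_div_card, div_eq_zero_iff] at h3
    rcases h3 with h3 | h3
    · rw [← Finset.mul_sum, h3, mul_zero]
    · simp at h3
  rw [Finset.sum_congr rfl fun x _ => h1 x, Finset.sum_sub_distrib, ← Finset.mul_sum,
    Finset.sum_boole, Finset.sum_const, Finset.card_univ, nsmul_eq_mul, card_cube] at h2
  unfold Close at h
  rw [div_le_iff₀ (by positivity)] at h
  have h4 : (0 : ℝ) < 2 ^ n := by positivity
  nlinarith

lemma nearDict_iff {ν : ℝ} (h0 : 0 ≤ ν) (h1 : ν < 1 / 2) (s : ℤˣ) (i j : Fin n) :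
    NearDict ν (fun x : Cube n => s * x i) j ↔ i = j := by
  constructor
  · intro h
    by_contra hij
    rcases h with h | h
    · refine not_close_of_ne h1 hij s 1 ?_
      simp only [one_mul]
      exact h
    · refine not_close_of_ne h1 hij s (-1) ?_
      simp only [neg_mul, one_mul]
      exact h
  · rintro rfl
    rcases Int.units_eq_one_or s with rfl | rfl
    · left; simp [Close, Dict, h0]
    · right; simp [Close, Dict, h0]

lemma eq_of_mul_dict_eq {i j : Fin n} {s t : ℤˣ} (h : ∀ x : Cube n, s * x i = t * x j) :
    i = j := by
  by_contra hij
  have h1 := h 1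
  have h2 := h (Function.update 1 i (-1))
  simp only [Pi.one_apply, mul_one] at h1
  rw [Function.update_self, Function.update_of_ne (Ne.symm hij), h1] at h2
  simp only [Pi.one_apply, mul_one] at h2
  rcases Int.units_eq_one_or t with rfl | rfl <;> revert h2 <;> decide

/-- Two distinct outputs cannot both have probability at least 3/4, so the two signed dictators
agree at every point. This makes `dictIndex` well defined. -/
lemma EvaluatesDict.index_unique {f : Cube n → ℤˣ} {κ : ℝ} {c : Restriction n × (Fin n → Bool)}
    {i j : Fin n} {s t : ℤˣ} (h1 : EvaluatesDict f κ c i s) (h2 : EvaluatesDict f κ c j t) :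
    i = j := by
  refine eq_of_mul_dict_eq (s := s) (t := t) fun x => ?_
  by_contra hne
  have h3 := h1 x (1 / 4) (by norm_num) (by norm_num)
  have h4 := h2 x (1 / 4) (by norm_num) (by norm_num)
  rw [← pr_singleton] at h3 h4
  have h5 := pr_compl_le _ h3
  have h6 : pr ((evalRoutine n κ c.1 c.2 x (1 / 4)).output f) {t * x j} ≤
      pr ((evalRoutine n κ c.1 c.2 x (1 / 4)).output f) {s * x i}ᶜ :=
    by
    refine pr_mono _ ?_
    rw [Set.singleton_subset_iff]
    exact fun h => hne h.symm
  have h7 := h4.trans (h6.trans h5)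
  rw [ENNReal.ofReal_le_ofReal_iff (by norm_num)] at h7
  norm_num at h7

open Classical in
/-- The coordinate whose dictator is computed, up to sign, by the procedure of a candidate. -/
def dictIndex (f : Cube n → ℤˣ) (κ : ℝ) (c : Restriction n × (Fin n → Bool)) : Option (Fin n) :=
  if h : ∃ i s, EvaluatesDict f κ c i s then some h.choose else none

lemma EvaluatesDict.dictIndex_eq {f : Cube n → ℤˣ} {κ : ℝ} {c : Restriction n × (Fin n → Bool)}
    {i : Fin n} {s : ℤˣ} (h : EvaluatesDict f κ c i s) : dictIndex f κ c = some i := by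
  have h1 : ∃ i s, EvaluatesDict f κ c i s := ⟨i, s, h⟩
  rw [dictIndex, dif_pos h1]
  obtain ⟨t, ht⟩ := h1.choose_spec
  rw [ht.index_unique h]

/-! ### Cleaning up -/

lemma length_clean_le {γ : Type} {N : ℕ} (l : List (γ × (Fin N → ℤˣ))) :
    (clean l).length ≤ l.length := by
  induction l with
  | nil => simp [clean]
  | cons c l ih =>
    rw [clean]
    split_ifs <;> simp <;> omega

/-- An entry is dropped only in favour of a kept entry correlated with it. When correlation means
equality of labels, the kept entries are a system of representatives of the labels. -/
lemma clean_spec {γ ι : Type} {N : ℕ} (lab : γ → ι) (l : List (γ × (Fin N → ℤˣ)))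
    (h : ∀ a ∈ l, ∀ b ∈ l, (1 / 2 ≤ |empCorr a.2 b.2| ↔ lab a.1 = lab b.1)) :
    (∀ a ∈ clean l, a ∈ l) ∧ (clean l).Pairwise (fun a b => lab a.1 ≠ lab b.1) ∧
      ∀ a ∈ l, ∃ b ∈ clean l, lab b.1 = lab a.1 := by
  induction l with
  | nil => simp [clean]
  | cons c l ih =>
    obtain ⟨h1, h2, h3⟩ := ih fun a ha b hb => h a (List.mem_cons_of_mem _ ha) b
      (List.mem_cons_of_mem _ hb)
    have hc : ∀ d ∈ clean l, (1 / 2 ≤ |empCorr c.2 d.2| ↔ lab c.1 = lab d.1) := fun d hd =>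
      h c List.mem_cons_self d (List.mem_cons_of_mem _ (h1 d hd))
    rw [clean]
    split_ifs with hd
    · refine ⟨fun a ha => List.mem_cons_of_mem _ (h1 a ha), h2, fun a ha => ?_⟩
      rcases List.mem_cons.1 ha with rfl | ha
      · obtain ⟨d, hd, hcd⟩ := hd
        exact ⟨d, hd, ((hc d hd).1 hcd).symm⟩
      · exact h3 a ha
    · refine ⟨fun a ha => ?_, List.pairwise_cons.2 ⟨fun d hdl heq => hd ⟨d, hdl, (hc d hdl).2 heq⟩,
        h2⟩, fun a ha => ?_⟩
      · rcases List.mem_cons.1 ha with rfl | ha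
        · exact List.mem_cons_self
        · exact List.mem_cons_of_mem _ (h1 a ha)
      · rcases List.mem_cons.1 ha with rfl | ha
        · exact ⟨a, List.mem_cons_self, rfl⟩
        · obtain ⟨b, hb, hab⟩ := h3 a ha
          exact ⟨b, List.mem_cons_of_mem _ hb, hab⟩

/-- Take g_j to be the signed dictator computed by the j-th candidate. For ν < 1/2 it is near a
dictator of its own coordinate only, so distinct indices give both injectivity and uniqueness. -/
lemma isNuOracle_of_pairwise {f : Cube n → ℤˣ} {κ ν : ℝ} (h0 : 0 ≤ ν) (h1 : ν < 1 / 2)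
    {q : ℝ → ℝ} (hq : ∀ δ, 0 < δ → δ < 1 → (samples (8 * alpha κ ^ 6) δ * 9 : ℕ) ≤ q δ)
    {L : List (Restriction n × (Fin n → Bool))}
    (hL : ∀ c ∈ L, ∃ i s, EvaluatesDict f κ c i s)
    (hpair : L.Pairwise fun a b => dictIndex f κ a ≠ dictIndex f κ b) :
    IsNuOracle f ν q (evaluators (evalRoutine n κ) L)
      {i | ∃ c ∈ L, dictIndex f κ c = some i} := by
  have hlen : (evaluators (evalRoutine n κ) L).length = L.length := by simp [evaluators]
  choose i s his using hL
  let c : Fin (evaluators (evalRoutine n κ) L).length → Restriction n × (Fin n → Bool) :=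
    fun j => L.get (j.cast hlen)
  have hcL : ∀ j, c j ∈ L := fun j => List.get_mem _ _
  have hidx : ∀ j, dictIndex f κ (c j) = some (i (c j) (hcL j)) := fun j => (his _ (hcL j)).dictIndex_eq
  have hinj : ∀ j l, i (c j) (hcL j) = i (c l) (hcL l) → j = l := by
    intro j l hjl
    have h2 : dictIndex f κ (c j) = dictIndex f κ (c l) := by rw [hidx, hidx, hjl]
    by_contra hne
    rw [List.pairwise_iff_get] at hpair
    rcases lt_or_gt_of_ne hne with hlt | hlt
    · exact hpair (j.cast hlen) (l.cast hlen) hlt h2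
    · exact hpair (l.cast hlen) (j.cast hlen) hlt h2.symm
  have hnear : ∀ j l, NearDict ν (fun x : Cube n => s (c j) (hcL j) * x (i (c j) (hcL j))) l ↔ i (c j) (hcL j) = l :=
    fun j l => nearDict_iff h0 h1 _ _ _
  refine ⟨fun j x => s (c j) (hcL j) * x (i (c j) (hcL j)), fun j l hjl => ?_, fun j => ?_, ?_, fun j => ?_⟩
  · exact hinj j l (eq_of_mul_dict_eq fun x => congrFun hjl x)
  · exact ⟨i (c j) (hcL j), ⟨c j, hcL j, hidx j⟩, (hnear j _).2 rfl⟩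
  · rintro l ⟨d, hd, hdl⟩
    obtain ⟨m, rfl⟩ := List.get_of_mem hd
    have hm : c (m.cast hlen.symm) = L.get m := rfl
    rw [← hm, hidx] at hdl
    refine ⟨m.cast hlen.symm, (hnear _ _).2 (Option.some_injective _ hdl), fun j hj => ?_⟩
    exact hinj _ _ (((hnear _ _).1 hj).trans (Option.some_injective _ hdl).symm)
  · intro x δ hδ hδ1
    have hget : (evaluators (evalRoutine n κ) L).get j = evalRoutine n κ (c j).1 (c j).2 :=
      List.getElem_map _
    rw [hget]
    exact ⟨his _ (hcL j) x δ hδ hδ1, _, hq δ hδ hδ1, queriesAtMost_evalRoutine f κ _ _ x δ⟩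

/-! ### The rounds of the algorithm -/

/-- One inner round: a candidate for the restriction `ρ`, if it is accepted. -/
def innerRound (test : TestRoutine n) (κ ν δt : ℝ) (ρ : Restriction n) :
    QueryAlg (Cube n) (Option (Restriction n × (Fin n → Bool))) :=
  (sampleNoise n κ).bind fun b => (test ρ b ν δt).bind fun accepted =>
    ret (if accepted then some (ρ, b) else none)

/-- One outer round. -/
def outerRound (test : TestRoutine n) (k M : ℕ) (κ ν δt : ℝ) :
    QueryAlg (Cube n) (Fin M → Option (Restriction n × (Fin n → Bool))) :=
  (sampleRestriction n k).bind fun ρ => seq M fun _ => innerRound test κ ν δt ρ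

/-- The list of the accepted candidates. -/
def candidates {T M : ℕ} {γ : Type} (rounds : Fin T → Fin M → Option γ) : List γ :=
  (List.ofFn fun t => (List.ofFn (rounds t)).reduceOption).flatten

/-- The second phase: remove repetitions among the candidates `D`. -/
def removeRepetitions (eval : EvalRoutine n) (N : ℕ) (δe : ℝ)
    (D : List (Restriction n × (Fin n → Bool))) :
    QueryAlg (Cube n) (List (Restriction n × (Fin n → Bool))) :=
  (seq N fun _ => drawPoint).bind fun pts =>
    (seq D.length fun j => seq N fun l => eval (D.get j).1 (D.get j).2 (pts l) δe).bind fun vals =>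
      ret ((clean (List.ofFn fun j => (D.get j, vals j))).map Prod.fst)

/-- The number of sample points. -/
def numPoints (C : ℝ) (k : ℕ) (τ δ : ℝ) : ℕ :=
  ⌈C * Real.log (innerRounds C k τ δ * outerRounds C k τ δ / δ)⌉₊

lemma constructCoordinateOracle_eq (C : ℝ) (eval : EvalRoutine n) (test : TestRoutine n)
    (k : ℕ) (τ ν δ : ℝ) :
    constructCoordinateOracle C eval test k τ ν δ =
      (seq (outerRounds C k τ δ) fun _ => outerRound test k (innerRounds C k τ δ) (kappa k τ) ν
        (δ / (innerRounds C k τ δ * outerRounds C k τ δ))).bind fun rounds =>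
          removeRepetitions eval (numPoints C k τ δ)
            (δ / (C * innerRounds C k τ δ * outerRounds C k τ δ * numPoints C k τ δ))
            (candidates rounds) := rfl

lemma mem_candidates {T M : ℕ} {γ : Type} {rounds : Fin T → Fin M → Option γ} {c : γ} :
    c ∈ candidates rounds ↔ ∃ t m, rounds t m = some c := by
  simp [candidates, List.mem_flatten, List.mem_ofFn, List.reduceOption_mem_iff]

lemma length_candidates_le {T M : ℕ} {γ : Type} (rounds : Fin T → Fin M → Option γ) :
    (candidates rounds).length ≤ T * M := by
  rw [candidates, List.length_flatten, List.map_ofFn, List.sum_ofFn]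
  refine (Finset.sum_le_card_nsmul _ _ M fun t _ => ?_).trans (by simp)
  exact (List.reduceOption_length_le _).trans (by simp)

/-- The candidate `o`, if there is one, is not usable. -/
def badCandidates (f : Cube n → ℤˣ) (κ : ℝ) : Set (Option (Restriction n × (Fin n → Bool))) :=
  {o | ∃ c, o = some c ∧ ¬ ∃ i s, EvaluatesDict f κ c i s}

/-- There is a candidate, and it isolates the coordinate `i`. -/
def isolatingCandidates (f : Cube n → ℤˣ) (κ : ℝ) (i : Fin n) :
    Set (Option (Restriction n × (Fin n → Bool))) :=
  {o | ∃ c, o = some c ∧ Isolates κ (restrict f c.1) c.2 i}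

/-- If the drawn candidate is usable, nothing bad can be output; if not, the bad event is
acceptance, controlled by the soundness of the test. -/
lemma pr_innerRound_bad {κ : ℝ} (hκ : 0 < κ) (hκ1 : κ ≤ 1) (f : Cube n → ℤˣ) (ν : ℝ) {δ : ℝ}
    (hδ : 0 < δ) (ρ : Restriction n) :
    pr (output f (innerRound (testRoutine n κ) κ ν δ ρ)) (badCandidates f κ) ≤
      ENNReal.ofReal (δ / 16) := by
  rw [innerRound, output_bind]
  refine (pr_bind_le _ _ _ ∅ fun b _ => ?_).trans_eq
    (show pr _ ∅ + ENNReal.ofReal (δ / 16) = _ by simp [pr])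
  rw [output_bind]
  by_cases hb : ∃ i s, EvaluatesDict f κ (ρ, b) i s
  · refine (pr_bind_le _ _ _ ∅ (ε := 0) fun c _ => ?_).trans (by simp [pr])
    refine (pr_ret_of_notMem ?_).le
    rintro ⟨d, hd, hbad⟩
    cases c
    · cases hd
    · cases hd
      exact hbad hb
  · refine (pr_bind_le _ _ _ {true} (ε := 0) fun c hc => ?_).trans ?_
    · refine (pr_ret_of_notMem ?_).le
      rintro ⟨d, hd, -⟩
      rw [if_neg (show ¬ c = true from hc)] at hd
      cases hd
    · rw [add_zero, pr_singleton]
      exact testRoutine_sound hκ hκ1 hb ν hδ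

lemma le_pr_innerRound_isolating {κ : ℝ} (hκ : 0 < κ) (hκ1 : κ ≤ 1) (f : Cube n → ℤˣ) (ν : ℝ)
    {δ : ℝ} (hδ : 0 < δ) (hδ1 : δ ≤ 1) {ρ : Restriction n} {i : Fin n}
    (hi : κ ≤ |fourierCoeff (restrict f ρ) {i}|) :
    ENNReal.ofReal (κ ^ 6 / 64) ≤
      pr (output f (innerRound (testRoutine n κ) κ ν δ ρ)) (isolatingCandidates f κ i) := by
  rw [innerRound, output_bind]
  refine le_trans ?_ (le_pr_bind _ _ _ {b | Isolates κ (restrict f ρ) b i}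
    (ε := ENNReal.ofReal (1 / 2)) fun b hb => ?_)
  · rw [show κ ^ 6 / 64 = κ ^ 6 / 32 * (1 / 2) by ring, ENNReal.ofReal_mul (by positivity)]
    gcongr
    exact le_pr_isolates hκ hκ1 f hi
  · rw [output_bind]
    refine le_trans ?_ (le_pr_bind _ _ _ {true} (ε := 1) fun c hc => ?_)
    · rw [mul_one, pr_singleton]
      exact (ENNReal.ofReal_le_ofReal (by linarith)).trans (testRoutine_complete hκ hκ1 hb ν hδ)
    · refine (pr_ret_of_mem ?_).ge
      exact ⟨(ρ, b), if_pos hc, hb⟩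

/-- Once the restriction has a coefficient of size κ, each inner round succeeds with probability at
least κ⁶/64. All M of them fail with probability at most e⁻¹ ≤ 1/2, which halves the constant 3/16.
-/
lemma le_pr_outerRound_isolating {k M : ℕ} (hk : 1 ≤ k) {τ : ℝ} (hκ : 0 < kappa k τ)
    (hκ1 : kappa k τ ≤ 1) (hM : 1 ≤ kappa k τ ^ 6 / 64 * M) (f : Cube n → ℤˣ) (ν : ℝ) {δ : ℝ}
    (hδ : 0 < δ) (hδ1 : δ ≤ 1) {i : Fin n} (hi : τ ^ 2 / (k : ℝ) ^ 2 ≤ lowDegInfluence k f i) :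
    ENNReal.ofReal (3 / 32 * (τ ^ 2 / k ^ 3)) ≤
      pr (output f (outerRound (testRoutine n (kappa k τ)) k M (kappa k τ) ν δ))
        {v | ∃ m, v m ∈ isolatingCandidates f (kappa k τ) i} := by
  rw [outerRound, output_bind]
  refine le_trans ?_ (le_pr_bind _ _ _ {ρ | kappa k τ ≤ |fourierCoeff (restrict f ρ) {i}|}
    (ε := ENNReal.ofReal (1 - 1 / 2)) fun ρ hρ => ?_)
  · rw [show 3 / 32 * (τ ^ 2 / (k : ℝ) ^ 3) = 3 / 16 * (τ ^ 2 / k ^ 3) * (1 - 1 / 2) by ring,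
      ENNReal.ofReal_mul (by positivity)]
    gcongr
    exact le_pr_fourierCoeff_restrict hk f hi
  · refine le_pr_of_compl_le _ (by norm_num) ?_
    rw [show {v : Fin M → _ | ∃ m, v m ∈ isolatingCandidates f (kappa k τ) i}ᶜ =
      {v | ∀ m, v m ∉ isolatingCandidates f (kappa k τ) i} by ext v; simp]
    refine (pr_seq_forall_le M _ _ (le_pr_innerRound_isolating hκ hκ1 f ν hδ hδ1 hρ)).trans
      (ENNReal.ofReal_le_ofReal ?_)
    calc Real.exp (-(kappa k τ ^ 6 / 64 * M)) ≤ Real.exp (-1) := by gcongr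
      _ = (Real.exp 1)⁻¹ := Real.exp_neg 1
      _ ≤ 1 / 2 := by
        rw [one_div]
        gcongr
        linarith [Real.add_one_le_exp (1 : ℝ)]

/-- Every accepted candidate is usable, and every influential coordinate is isolated by one. -/
def goodRounds (f : Cube n → ℤˣ) (k : ℕ) (τ : ℝ) (T M : ℕ) :
    Set (Fin T → Fin M → Option (Restriction n × (Fin n → Bool))) :=
  {rounds | (∀ c ∈ candidates rounds, ∃ i s, EvaluatesDict f (kappa k τ) c i s) ∧
    ∀ i, τ ^ 2 / (k : ℝ) ^ 2 ≤ lowDegInfluence k f i →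
      ∃ c ∈ candidates rounds, Isolates (kappa k τ) (restrict f c.1) c.2 i}

/-- The first term is a union bound over the TM tests. The second is one over the at most k³/τ²
influential coordinates, each missed by all T outer rounds. -/
lemma pr_goodRounds_compl {k T M : ℕ} (hk : 1 ≤ k) {τ : ℝ} (hτ : 0 < τ) (hκ : 0 < kappa k τ)
    (hκ1 : kappa k τ ≤ 1) (hM : 1 ≤ kappa k τ ^ 6 / 64 * M) (f : Cube n → ℤˣ) (ν : ℝ) {δ : ℝ}
    (hδ : 0 < δ) (hδ1 : δ ≤ 1) :
    pr (output f (seq T fun _ => outerRound (testRoutine n (kappa k τ)) k M (kappa k τ) ν δ))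
      (goodRounds f k τ T M)ᶜ ≤ ENNReal.ofReal (T * (M * (δ / 16))) +
        ENNReal.ofReal (k ^ 3 / τ ^ 2 * Real.exp (-(3 / 32 * (τ ^ 2 / k ^ 3) * T))) := by
  classical
  have hk0 : (0 : ℝ) < k := by exact_mod_cast hk
  set I : Finset (Fin n) :=
    Finset.univ.filter fun i => τ ^ 2 / (k : ℝ) ^ 2 ≤ lowDegInfluence k f i with hI
  have hsub : (goodRounds f k τ T M)ᶜ ⊆
      {v | ∃ t, v t ∈ {w : Fin M → _ | ∃ m, w m ∈ badCandidates f (kappa k τ)}} ∪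
      ⋃ i ∈ I, {v | ∀ t, v t ∉ {w : Fin M → _ | ∃ m, w m ∈ isolatingCandidates f (kappa k τ) i}} := by
    intro v hv
    by_contra hc
    simp only [Set.mem_union, not_or, Set.mem_iUnion, not_exists, Set.mem_ofPred_eq, hI,
      Finset.mem_filter, Finset.mem_univ, true_and] at hc
    refine hv ⟨fun c hc' => ?_, fun i hi => ?_⟩
    · obtain ⟨t, m, htm⟩ := mem_candidates.1 hc'
      by_contra hb
      exact hc.1 t m ⟨c, htm, hb⟩
    · have h1 := hc.2 i hi
      push Not at h1
      obtain ⟨t, m, c, htm, hiso⟩ := h1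
      exact ⟨c, mem_candidates.2 ⟨t, m, htm⟩, hiso⟩
  refine (pr_mono _ hsub).trans ((pr_union_le _ _ _).trans (add_le_add ?_ ?_))
  · refine (pr_seq_exists_le T _ _ (ε := M * ENNReal.ofReal (δ / 16)) fun t => ?_).trans_eq ?_
    · rw [outerRound, output_bind]
      refine (pr_bind_le _ _ _ ∅ fun ρ _ => ?_).trans_eq
        (show pr _ ∅ + M * ENNReal.ofReal (δ / 16) = _ by simp [pr])
      exact pr_seq_exists_le M _ _ fun _ => pr_innerRound_bad hκ hκ1 f ν hδ ρ
    · rw [ENNReal.ofReal_mul (by positivity), ENNReal.ofReal_mul (by positivity),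
        ENNReal.ofReal_natCast, ENNReal.ofReal_natCast]
  · refine (pr_biUnion_le _ _ _).trans ?_
    refine (Finset.sum_le_sum fun i hi => pr_seq_forall_le T _ _
      (le_pr_outerRound_isolating hk hκ hκ1 hM f ν hδ hδ1 (Finset.mem_filter.1 hi).2)).trans ?_
    rw [Finset.sum_const, nsmul_eq_mul, ← ENNReal.ofReal_natCast, ← ENNReal.ofReal_mul (by positivity)]
    refine ENNReal.ofReal_le_ofReal ?_
    gcongr
    have h := card_mul_le_of_influential f I fun i hi => (Finset.mem_filter.1 hi).2
    rw [le_div_iff₀ (by positivity)]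
    calc (I.card : ℝ) * τ ^ 2 = (I.card * (τ ^ 2 / (k : ℝ) ^ 2)) * (k : ℝ) ^ 2 := by field_simp
      _ ≤ (k : ℝ) * (k : ℝ) ^ 2 := by gcongr
      _ = (k : ℝ) ^ 3 := by ring


/-! ### The second phase -/

/-- The signs s and t drop out of the absolute value, and for equal coordinates the remaining
correlation is exactly 1. -/
lemma abs_empCorr_dict {N : ℕ} (hN : 0 < N) (pts : Fin N → Cube n) {i j : Fin n} (s t : ℤˣ)
    (h : i ≠ j → |∑ l, toReal (pts l i) * toReal (pts l j)| < 1 / 2 * N) :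
    1 / 2 ≤ |empCorr (fun l => s * pts l i) (fun l => t * pts l j)| ↔ i = j := by
  have hN' : (0 : ℝ) < N := by exact_mod_cast hN
  have h1 : |empCorr (fun l => s * pts l i) (fun l => t * pts l j)| =
      |∑ l, toReal (pts l i) * toReal (pts l j)| / N := by
    have h2 : ∀ l, toReal (s * pts l i) * toReal (t * pts l j) =
        toReal s * toReal t * (toReal (pts l i) * toReal (pts l j)) := by
      intro l
      rw [toReal_mul, toReal_mul]; ring
    rw [empCorr, Finset.sum_congr rfl fun l _ => h2 l, ← Finset.mul_sum, abs_div, abs_mul, abs_mul,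
      abs_toReal, abs_toReal, one_mul, one_mul, abs_of_pos hN']
  rw [h1, le_div_iff₀ hN']
  constructor
  · intro h2
    by_contra hij
    exact absurd h2 (not_le.2 (h hij))
  · rintro rfl
    simp only [toReal_mul_self, Finset.sum_const, Finset.card_univ, Fintype.card_fin, nsmul_eq_mul,
      mul_one]
    rw [abs_of_pos hN']
    linarith

lemma pr_sum_dict_mul_dict_ge (f : Cube n → ℤˣ) (N : ℕ) {i j : Fin n} (hij : i ≠ j) :
    pr (output f (seq N fun _ => drawPoint (n := n)))
      {pts | 1 / 2 * (N : ℝ) ≤ |∑ l, toReal (pts l i) * toReal (pts l j)|} ≤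
        ENNReal.ofReal (2 * Real.exp (-(N / 16))) := by
  have hμ : rexp (output f (drawPoint (n := n))) (fun x => toReal (x i) * toReal (x j)) = 0 := by
    rw [drawPoint, output_sample, rexp_uniform, expect_mul_of_ne hij]
  have hY : ∀ x : Cube n, |toReal (x i) * toReal (x j)| ≤ 1 := fun x => by
    rw [abs_mul, abs_toReal, abs_toReal, one_mul]
  have h1 := pr_seq_sum_ge N drawPoint _ hY hμ (ε := 1 / 2) (by norm_num) (by norm_num)
  have h2 := pr_seq_sum_le N drawPoint _ hY hμ (ε := 1 / 2) (by norm_num) (by norm_num)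
  refine (pr_mono _ fun pts hpts => ?_).trans ((pr_union_le _ _ _).trans
    ((add_le_add h1 h2).trans_eq ?_))
  · rcases le_abs.1 (show 1 / 2 * (N : ℝ) ≤ |_| from hpts) with h3 | h3
    · left
      show (0 + 1 / 2) * (N : ℝ) ≤ _
      linarith
    · right
      show _ ≤ (0 - 1 / 2) * (N : ℝ)
      linarith
  · rw [← ENNReal.ofReal_add (Real.exp_pos _).le (Real.exp_pos _).le, ← two_mul]
    norm_num
    ring_nf

/-- `L` contains one representative of every class of candidates in `D`. -/
def Represents (f : Cube n → ℤˣ) (κ : ℝ) (D L : List (Restriction n × (Fin n → Bool))) : Prop :=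
  (∀ c ∈ L, c ∈ D) ∧ L.Pairwise (fun a b => dictIndex f κ a ≠ dictIndex f κ b) ∧
    ∀ c ∈ D, ∃ d ∈ L, dictIndex f κ d = dictIndex f κ c

/-- Two things can go wrong: the points make two distinct coordinates look correlated (first term,
over pairs), or one of the evaluations errs (second term). Otherwise `clean_spec` applies with the
dictator index as label. -/
lemma pr_removeRepetitions {f : Cube n → ℤˣ} {κ : ℝ} {N : ℕ} (hN : 0 < N) {δe : ℝ}
    (hδ : 0 < δe) (hδ1 : δe < 1) {D : List (Restriction n × (Fin n → Bool))}
    (hD : ∀ c ∈ D, ∃ i s, EvaluatesDict f κ c i s) :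
    pr (output f (removeRepetitions (evalRoutine n κ) N δe D)) {L | Represents f κ D L}ᶜ ≤
      ENNReal.ofReal ((D.length : ℝ) ^ 2 * (2 * Real.exp (-(N / 16)))) +
        ENNReal.ofReal (D.length * (N * δe)) := by
  choose i s his using fun j : Fin D.length => hD (D.get j) (D.get_mem j)
  rw [removeRepetitions, output_bind]
  refine (pr_bind_le _ _ _ (⋃ p ∈ (Finset.univ : Finset (Fin D.length × Fin D.length)),
    {pts : Fin N → Cube n | i p.1 ≠ i p.2 ∧
      1 / 2 * (N : ℝ) ≤ |∑ l, toReal (pts l (i p.1)) * toReal (pts l (i p.2))|})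
    (ε := ENNReal.ofReal (D.length * (N * δe))) fun pts hpts => ?_).trans ?_
  · rw [output_bind]
    refine (pr_bind_le _ _ _ {vals : Fin D.length → Fin N → ℤˣ |
      ∃ j, vals j ∈ {v | ∃ l, v l ∈ ({s j * pts l (i j)} : Set ℤˣ)ᶜ}} (ε := 0)
      fun vals hvals => ?_).trans ?_
    · refine (pr_ret_of_notMem (not_not.2 ?_)).le
      have hv : ∀ j, vals j = fun l => s j * pts l (i j) := by
        intro j
        ext1 l
        by_contra h
        exact hvals ⟨j, l, h⟩
      have hp : ∀ j m, i j ≠ i m →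
          |∑ l, toReal (pts l (i j)) * toReal (pts l (i m))| < 1 / 2 * N := by
        intro j m hjm
        by_contra h
        exact hpts (Set.mem_biUnion (Finset.mem_coe.2 (Finset.mem_univ (j, m)))
          ⟨hjm, not_lt.1 h⟩)
      have hidx : ∀ j, dictIndex f κ (D.get j) = some (i j) := fun j => (his j).dictIndex_eq
      obtain ⟨h1, h2, h3⟩ := clean_spec (dictIndex f κ)
        (List.ofFn fun j => (D.get j, vals j)) (by
          intro a ha b hb
          obtain ⟨j, rfl⟩ := (List.mem_ofFn' _ _).1 ha
          obtain ⟨m, rfl⟩ := (List.mem_ofFn' _ _).1 hb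
          show 1 / 2 ≤ |empCorr (vals j) (vals m)| ↔
            dictIndex f κ (D.get j) = dictIndex f κ (D.get m)
          rw [hv, hv, hidx, hidx, abs_empCorr_dict hN pts _ _ (hp j m), Option.some_inj])
      refine ⟨fun c hc => ?_, List.pairwise_map.2 h2, fun c hc => ?_⟩
      · obtain ⟨a, ha, rfl⟩ := List.mem_map.1 hc
        obtain ⟨j, rfl⟩ := (List.mem_ofFn' _ _).1 (h1 a ha)
        exact D.get_mem j
      · obtain ⟨j, rfl⟩ := List.get_of_mem hc
        obtain ⟨b, hb, hbj⟩ := h3 _ ((List.mem_ofFn' _ _).2 ⟨j, rfl⟩)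
        exact ⟨b.1, List.mem_map.2 ⟨b, hb, rfl⟩, hbj⟩
    · rw [add_zero]
      refine (pr_seq_exists_le _ _ _ (ε := N * ENNReal.ofReal δe) fun j => ?_).trans_eq ?_
      · refine pr_seq_exists_le N _ (fun l => ({s j * pts l (i j)} : Set ℤˣ)ᶜ) fun l => ?_
        refine pr_compl_le _ ?_
        rw [pr_singleton]
        exact his j (pts l) δe hδ hδ1
      · rw [ENNReal.ofReal_mul (by positivity), ENNReal.ofReal_mul (by positivity),
          ENNReal.ofReal_natCast, ENNReal.ofReal_natCast]
  · gcongr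
    refine (pr_biUnion_le _ _ _).trans ((Finset.sum_le_sum (g := fun _ =>
      ENNReal.ofReal (2 * Real.exp (-(N / 16)))) fun p _ => ?_).trans_eq ?_)
    · by_cases hp : i p.1 = i p.2
      · simp [hp, pr]
      · exact (pr_mono _ fun pts h => h.2).trans (pr_sum_dict_mul_dict_ge f N hp)
    · rw [Finset.sum_const, Finset.card_univ, Fintype.card_prod, Fintype.card_fin, nsmul_eq_mul,
        ENNReal.ofReal_mul (show 0 ≤ (D.length : ℝ) ^ 2 by positivity), ← sq, ← Nat.cast_pow,
        ENNReal.ofReal_natCast]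

lemma length_le_of_mem_support {f : Cube n → ℤˣ} {eval : EvalRoutine n} {N : ℕ} {δe : ℝ}
    {D L : List (Restriction n × (Fin n → Bool))}
    (hL : L ∈ (output f (removeRepetitions eval N δe D)).support) : L.length ≤ D.length := by
  simp only [removeRepetitions, output_bind, output_ret, PMF.mem_support_bind_iff,
    PMF.mem_support_pure_iff] at hL
  obtain ⟨pts, -, vals, -, rfl⟩ := hL
  rw [List.length_map]
  exact (length_clean_le _).trans (by simp)

lemma queriesAtMost_removeRepetitions {f : Cube n → ℤˣ} {eval : EvalRoutine n} {N q r : ℕ} {δe : ℝ}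
    {D : List (Restriction n × (Fin n → Bool))} (hD : D.length ≤ r)
    (h : ∀ ρ b x, QueriesAtMost f (eval ρ b x δe) q) :
    QueriesAtMost f (removeRepetitions eval N δe D) (r * (N * q)) := by
  have h1 : QueriesAtMost f (seq N fun _ => drawPoint (n := n)) 0 :=
    queriesAtMost_seq (q := 0) fun _ => queriesAtMost_sample _ 0
  refine (h1.bind' (r := D.length * (N * q) + 0) fun pts => ?_).mono ?_
  · refine QueriesAtMost.bind' ?_ fun _ => trivial
    exact queriesAtMost_seq fun j => queriesAtMost_seq fun l => h _ _ _
  · simpa using Nat.mul_le_mul_right _ hD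

lemma queriesAtMost_outerRound {f : Cube n → ℤˣ} {test : TestRoutine n} {k M q : ℕ} {κ ν δt : ℝ}
    (h : ∀ ρ b, QueriesAtMost f (test ρ b ν δt) q) :
    QueriesAtMost f (outerRound test k M κ ν δt) (M * q) := by
  have h1 : QueriesAtMost f (sampleRestriction n k) 0 :=
    queriesAtMost_seq (q := 0) fun _ => queriesAtMost_sample _ 0
  have h2 : QueriesAtMost f (sampleNoise n κ) 0 :=
    queriesAtMost_seq (q := 0) fun _ => queriesAtMost_sample _ 0
  rw [← Nat.zero_add (M * q)]
  refine h1.bind' fun ρ => queriesAtMost_seq fun _ => ?_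
  rw [← Nat.zero_add q]
  exact h2.bind' fun b => (h ρ b).bind' (r := 0) fun _ => trivial

end

/-! ### Numerical estimates -/

section

variable {k : ℕ} {τ δ : ℝ}

lemma half_lt_log_one_div (hδ : 0 < δ) (hδ1 : δ ≤ 1 / 2) : 1 / 2 < Real.log (1 / δ) := by
  have h : Real.log 2 ≤ Real.log (1 / δ) := by
    apply Real.log_le_log (by norm_num)
    rw [le_div_iff₀ hδ]; linarith
  linarith [Real.log_two_gt_d9]

lemma kappa_pos (hk : 1 ≤ k) (hτ : 0 < τ) : 0 < kappa k τ := by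
  have hk0 : (0 : ℝ) < k := by exact_mod_cast hk
  unfold kappa; positivity

lemma kappa_le_one (hk : 1 ≤ k) (hτ1 : τ ≤ 1) : kappa k τ ≤ 1 := by
  have hk0 : (1 : ℝ) ≤ k := by exact_mod_cast hk
  unfold kappa
  rw [div_le_one (by linarith)]
  linarith

lemma inv_alpha_kappa (hk : 1 ≤ k) (hτ : 0 < τ) :
    (alpha (kappa k τ))⁻¹ = 1024 * k ^ 3 * τ⁻¹ ^ 3 := by
  have hk0 : (0 : ℝ) < k := by exact_mod_cast hk
  unfold alpha kappa
  field_simp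
  norm_num

lemma one_le_mul_inv (hk : 1 ≤ k) (hτ : 0 < τ) (hτ1 : τ ≤ 1) : 1 ≤ k * τ⁻¹ := by
  have hk0 : (1 : ℝ) ≤ k := by exact_mod_cast hk
  have : 1 ≤ τ⁻¹ := (one_le_inv₀ hτ).2 hτ1
  nlinarith

lemma innerRounds_pos (hk : 1 ≤ k) (hτ : 0 < τ) (hδ : 0 < δ) (hδ1 : δ ≤ 1 / 2) :
    0 < innerRounds 1000000 k τ δ := by
  have hk0 : (0 : ℝ) < k := by exact_mod_cast hk
  have hL := half_lt_log_one_div hδ hδ1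
  exact Nat.ceil_pos.2 (by positivity)

lemma outerRounds_pos (hk : 1 ≤ k) (hτ : 0 < τ) (hδ : 0 < δ) (hδ1 : δ ≤ 1 / 2) :
    0 < outerRounds 1000000 k τ δ := by
  have hk0 : (0 : ℝ) < k := by exact_mod_cast hk
  have hL := half_lt_log_one_div hδ hδ1
  exact Nat.ceil_pos.2 (by positivity)

/-- Here 262144 = 64·4⁶ comes from κ⁶/64; the spare factors are k/τ ≥ 1 and log(1/δ) > 1/2. -/
lemma one_le_mul_innerRounds (hk : 1 ≤ k) (hτ : 0 < τ) (hτ1 : τ ≤ 1) (hδ : 0 < δ)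
    (hδ1 : δ ≤ 1 / 2) : 1 ≤ kappa k τ ^ 6 / 64 * innerRounds 1000000 k τ δ := by
  have hk0 : (0 : ℝ) < k := by exact_mod_cast hk
  have hL := half_lt_log_one_div hδ hδ1
  have hu := one_le_mul_inv hk hτ hτ1
  have hM : 1000000 * (k : ℝ) ^ 7 * τ⁻¹ ^ 7 * Real.log (1 / δ) ≤ innerRounds 1000000 k τ δ :=
    Nat.le_ceil _
  calc (1 : ℝ) ≤ 1000000 / 262144 * (k * τ⁻¹ * Real.log (1 / δ)) := by nlinarith
    _ = kappa k τ ^ 6 / 64 * (1000000 * (k : ℝ) ^ 7 * τ⁻¹ ^ 7 * Real.log (1 / δ)) := by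
      unfold kappa; field_simp; norm_num
    _ ≤ _ := by gcongr

/-- With u = k/τ and L = log(1/δ), the exponent exceeds L + 2 + 3 log u. These three summands supply
δ, a factor below 1/4, and u⁻³, which cancels k³/τ² ≤ u³. -/
lemma mul_exp_outerRounds_le (hk : 1 ≤ k) (hτ : 0 < τ) (hτ1 : τ ≤ 1) (hδ : 0 < δ)
    (hδ1 : δ ≤ 1 / 2) :
    k ^ 3 / τ ^ 2 * Real.exp (-(3 / 32 * (τ ^ 2 / k ^ 3) * outerRounds 1000000 k τ δ)) ≤
      δ / 4 := by
  have hk1 : (1 : ℝ) ≤ k := by exact_mod_cast hk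
  have hk0 : (0 : ℝ) < k := by linarith
  have hL := half_lt_log_one_div hδ hδ1
  have hu := one_le_mul_inv hk hτ hτ1
  have hτi : 1 ≤ τ⁻¹ := (one_le_inv₀ hτ).2 hτ1
  have hT : 1000000 * (k : ℝ) ^ 5 * τ⁻¹ ^ 5 * Real.log (1 / δ) ≤ outerRounds 1000000 k τ δ :=
    Nat.le_ceil _
  set L := Real.log (1 / δ) with hLdef
  set u := (k : ℝ) * τ⁻¹ with hudef
  have hE : 9 * (u * L) ≤ 3 / 32 * (τ ^ 2 / k ^ 3) * outerRounds 1000000 k τ δ := by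
    calc 9 * (u * L) ≤ 93750 * (u * L) * 1 := by nlinarith
      _ ≤ 93750 * (u * L) * (k * τ⁻¹ ^ 2) := by
        gcongr
        nlinarith
      _ = 3 / 32 * (τ ^ 2 / k ^ 3) * (1000000 * (k : ℝ) ^ 5 * τ⁻¹ ^ 5 * L) := by
        rw [hudef]; field_simp; norm_num
      _ ≤ _ := by gcongr
  have hE2 : L + 2 + 3 * Real.log u ≤ 9 * (u * L) := by
    have := Real.log_le_sub_one_of_pos (show 0 < u by linarith)
    nlinarith
  have h3 : Real.exp (-(L + 2 + 3 * Real.log u)) ≤ δ * (1 / 4) * (u ^ 3)⁻¹ := by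
    rw [neg_add, neg_add, Real.exp_add, Real.exp_add]
    have e1 : Real.exp (-L) = δ := by
      rw [hLdef, one_div, Real.log_inv, neg_neg, Real.exp_log hδ]
    have e2 : Real.exp (-2) ≤ 1 / 4 := by
      rw [Real.exp_neg, one_div]
      have : Real.exp 2 = Real.exp 1 * Real.exp 1 := by rw [← Real.exp_add]; norm_num
      have := Real.exp_one_gt_d9
      gcongr
      nlinarith
    have e3 : Real.exp (-(3 * Real.log u)) = (u ^ 3)⁻¹ := by
      rw [Real.exp_neg, show 3 * Real.log u = ((3 : ℕ) : ℝ) * Real.log u by norm_num,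
        Real.exp_nat_mul, Real.exp_log (by linarith)]
    rw [e1, e3]
    gcongr
  calc k ^ 3 / τ ^ 2 * Real.exp (-(3 / 32 * (τ ^ 2 / k ^ 3) * outerRounds 1000000 k τ δ))
      ≤ u ^ 3 * (δ * (1 / 4) * (u ^ 3)⁻¹) := by
        gcongr
        · rw [hudef, mul_pow, div_eq_mul_inv, ← inv_pow]
          gcongr
          norm_num
        · refine le_trans ?_ h3
          gcongr
          linarith
    _ = δ / 4 := by
      have : u ^ 3 ≠ 0 := by positivity
      field_simp

lemma two_le_ratio {m : ℝ} (hm : 1 ≤ m) (hδ : 0 < δ) (hδ1 : δ ≤ 1 / 2) : 2 ≤ m / δ := by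
  rw [le_div_iff₀ hδ]; linarith

/-- The size of N gives e^{−N/16} ≤ (δ/m)⁴, and 2δ⁴/m² ≤ δ/4 because δ ≤ 1/2. It is applied with m =
MT, an upper bound for the number of candidates. -/
lemma sq_mul_exp_le {m N : ℝ} (hm : 1 ≤ m) (hδ : 0 < δ) (hδ1 : δ ≤ 1 / 2)
    (hN : 1000000 * Real.log (m / δ) ≤ N) : m ^ 2 * (2 * Real.exp (-(N / 16))) ≤ δ / 4 := by
  have hQ := two_le_ratio hm hδ hδ1
  have hlog : 0 ≤ Real.log (m / δ) := Real.log_nonneg (by linarith)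
  have h1 : Real.exp (-(N / 16)) ≤ ((m / δ) ^ 4)⁻¹ := by
    calc Real.exp (-(N / 16)) ≤ Real.exp (-(((4 : ℕ) : ℝ) * Real.log (m / δ))) := by
          gcongr
          push_cast
          linarith
      _ = _ := by rw [Real.exp_neg, Real.exp_nat_mul, Real.exp_log (by linarith)]
  calc m ^ 2 * (2 * Real.exp (-(N / 16))) ≤ m ^ 2 * (2 * ((m / δ) ^ 4)⁻¹) := by gcongr
    _ = 2 * δ ^ 4 / m ^ 2 := by field_simp
    _ ≤ 2 * δ ^ 4 / 1 := by
      gcongr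
      nlinarith
    _ = 2 * (δ * δ ^ 3) := by ring
    _ ≤ 2 * (δ * (1 / 2) ^ 3) := by gcongr
    _ = δ / 4 := by ring

lemma numPoints_pos (hk : 1 ≤ k) (hτ : 0 < τ) (hδ : 0 < δ) (hδ1 : δ ≤ 1 / 2) :
    0 < numPoints 1000000 k τ δ := by
  have hM : (1 : ℝ) ≤ innerRounds 1000000 k τ δ := by
    exact_mod_cast innerRounds_pos hk hτ hδ hδ1
  have hT : (1 : ℝ) ≤ outerRounds 1000000 k τ δ := by
    exact_mod_cast outerRounds_pos hk hτ hδ hδ1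
  have hQ := two_le_ratio (one_le_mul_of_one_le_of_one_le hM hT) hδ hδ1
  refine Nat.ceil_pos.2 (mul_pos (by norm_num) (Real.log_pos (by linarith)))

lemma samples_mul_le {ε B : ℝ} (c : ℕ) (hε : 0 < ε) (hB : Real.log (1 / δ) ≤ B) (hB0 : 0 ≤ B) :
    (samples ε δ * c : ℕ) ≤ (c : ℝ) * (4 / ε ^ 2 * B + 1) := by
  push_cast
  rw [mul_comm]
  gcongr
  have h1 : 4 / ε ^ 2 * Real.log (1 / δ) ≤ 4 / ε ^ 2 * B := by gcongr
  refine (Nat.cast_le.2 (Nat.ceil_mono h1)).trans ?_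
  exact (Nat.ceil_lt_add_one (by positivity)).le

end

/-! ### The cost polynomials -/

open MvPolynomial in
/-- The inverse `α⁻¹` of the noise size. -/
def polyInvAlpha : MvPolynomial (Fin 3) ℝ := C 1024 * X 0 ^ 3 * X 1 ^ 3

open MvPolynomial in
/-- The evaluation cost, as a function of the logarithm of the confidence. -/
def polyEval (P : MvPolynomial (Fin 3) ℝ) : MvPolynomial (Fin 3) ℝ :=
  C 9 * (C (1 / 16) * polyInvAlpha ^ 12 * P + 1)

open MvPolynomial in
/-- The cost of the test, as a function of the logarithm of the confidence. -/
def polyTest (P : MvPolynomial (Fin 3) ℝ) : MvPolynomial (Fin 3) ℝ :=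
  C 12 * (C (1 / 25) * polyInvAlpha ^ 16 * (P + C 3) + 1)

open MvPolynomial in
/-- The number of outer rounds. -/
def polyOuter : MvPolynomial (Fin 3) ℝ := C 1000000 * X 0 ^ 5 * X 1 ^ 5 * X 2 + 1

open MvPolynomial in
/-- The number of inner rounds. -/
def polyInner : MvPolynomial (Fin 3) ℝ := C 1000000 * X 0 ^ 7 * X 1 ^ 7 * X 2 + 1

open MvPolynomial in
/-- The number of sample points. -/
def polyPoints : MvPolynomial (Fin 3) ℝ := C 1000000 * (X 2 + polyInner * polyOuter) + 1

open MvPolynomial in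
/-- The total number of queries. -/
def polyQuery : MvPolynomial (Fin 3) ℝ :=
  polyOuter * polyInner * polyTest (X 2 + polyInner * polyOuter) +
    polyOuter * polyInner * (polyPoints *
      polyEval (X 2 + C 1000000 * polyInner * polyOuter * polyPoints))

section

variable {k : ℕ} {τ δ : ℝ}

lemma polyVal_polyInvAlpha (hk : 1 ≤ k) (hτ : 0 < τ) :
    polyVal polyInvAlpha k τ δ = (alpha (kappa k τ))⁻¹ := by
  rw [inv_alpha_kappa hk hτ]
  simp [polyVal, polyInvAlpha]

lemma polyVal_polyEval (hk : 1 ≤ k) (hτ : 0 < τ) (P : MvPolynomial (Fin 3) ℝ) :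
    polyVal (polyEval P) k τ δ = 9 * (4 / (8 * alpha (kappa k τ) ^ 6) ^ 2 * polyVal P k τ δ + 1) := by
  have h := polyVal_polyInvAlpha (δ := δ) hk hτ
  have hα := alpha_pos (kappa_pos hk hτ)
  simp only [polyVal, polyEval, map_add, map_mul, map_pow, MvPolynomial.eval_C, map_one] at h ⊢
  rw [h]
  field_simp
  ring

lemma polyVal_polyTest (hk : 1 ≤ k) (hτ : 0 < τ) (P : MvPolynomial (Fin 3) ℝ) :
    polyVal (polyTest P) k τ δ =
      12 * (4 / (10 * alpha (kappa k τ) ^ 8) ^ 2 * (polyVal P k τ δ + 3) + 1) := by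
  have h := polyVal_polyInvAlpha (δ := δ) hk hτ
  have hα := alpha_pos (kappa_pos hk hτ)
  simp only [polyVal, polyTest, map_add, map_mul, map_pow, MvPolynomial.eval_C, map_one] at h ⊢
  rw [h]
  field_simp
  ring

lemma polyVal_X_two : polyVal (MvPolynomial.X 2) k τ δ = Real.log (1 / δ) := by
  simp [polyVal]

lemma outerRounds_le (hτ : 0 < τ) (hL : 0 ≤ Real.log (1 / δ)) :
    outerRounds 1000000 k τ δ ≤ polyVal polyOuter k τ δ := by
  refine (Nat.ceil_lt_add_one (by positivity)).le.trans_eq ?_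
  simp [polyVal, polyOuter]

lemma innerRounds_le (hτ : 0 < τ) (hL : 0 ≤ Real.log (1 / δ)) :
    innerRounds 1000000 k τ δ ≤ polyVal polyInner k τ δ := by
  refine (Nat.ceil_lt_add_one (by positivity)).le.trans_eq ?_
  simp [polyVal, polyInner]

/-- The crude bound log m ≤ m keeps the costs polynomial: logarithms of round numbers are replaced
by the round numbers themselves. -/
lemma log_div_le {m B : ℝ} (hm : 0 < m) (hmB : m ≤ B) (hδ : 0 < δ) :
    Real.log (m / δ) ≤ Real.log (1 / δ) + B := by
  rw [show m / δ = 1 / δ * m by ring, Real.log_mul (by positivity) hm.ne']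
  linarith [Real.log_le_sub_one_of_pos hm]

lemma numPoints_le (hk : 1 ≤ k) (hτ : 0 < τ) (hδ : 0 < δ) (hδ1 : δ ≤ 1 / 2) :
    numPoints 1000000 k τ δ ≤ polyVal polyPoints k τ δ := by
  have hL := half_lt_log_one_div hδ hδ1
  have hT := outerRounds_le (k := k) hτ (by linarith : 0 ≤ Real.log (1 / δ))
  have hM := innerRounds_le (k := k) hτ (by linarith : 0 ≤ Real.log (1 / δ))
  have hT0 : (1 : ℝ) ≤ outerRounds 1000000 k τ δ := by
    exact_mod_cast outerRounds_pos hk hτ hδ hδ1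
  have hM0 : (1 : ℝ) ≤ innerRounds 1000000 k τ δ := by
    exact_mod_cast innerRounds_pos hk hτ hδ hδ1
  unfold numPoints
  generalize (outerRounds 1000000 k τ δ : ℝ) = T at *
  generalize (innerRounds 1000000 k τ δ : ℝ) = M at *
  have hm := one_le_mul_of_one_le_of_one_le hM0 hT0
  have h1 : Real.log (M * T / δ) ≤
      Real.log (1 / δ) + polyVal polyInner k τ δ * polyVal polyOuter k τ δ :=
    log_div_le (by linarith) (mul_le_mul hM hT (by linarith) (by linarith)) hδ
  have h2 : 0 ≤ Real.log (M * T / δ) :=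
    Real.log_nonneg (by linarith [two_le_ratio hm hδ hδ1])
  refine (Nat.ceil_lt_add_one (by positivity)).le.trans ?_
  have h3 : polyVal polyPoints k τ δ = 1000000 * (Real.log (1 / δ) +
      polyVal polyInner k τ δ * polyVal polyOuter k τ δ) + 1 := by
    simp [polyVal, polyPoints]
  rw [h3]
  gcongr

end

section

variable {n k : ℕ} {τ δ : ℝ}

/-! ### The cost of the subroutines -/

lemma samples_eval_le (hk : 1 ≤ k) (hτ : 0 < τ) {δ' : ℝ} (h0 : 0 < δ') (h1 : δ' < 1) :
    (samples (8 * alpha (kappa k τ) ^ 6) δ' * 9 : ℕ) ≤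
      polyVal (polyEval (MvPolynomial.X 2)) k τ δ' := by
  have hα := alpha_pos (kappa_pos hk hτ)
  rw [polyVal_polyEval hk hτ, polyVal_X_two]
  refine samples_mul_le 9 (by positivity) le_rfl (Real.log_nonneg ?_)
  rw [le_div_iff₀ h0]; linarith

lemma log_sixteen_le : Real.log 16 ≤ 3 := by
  rw [show (16 : ℝ) = 2 ^ 4 by norm_num, Real.log_pow]
  push_cast
  linarith [Real.log_two_lt_d9]

/-- The summand 3 pays for log 16, which the internal confidence δt/16 adds to log(1/δt). -/
lemma samples_test_le (hk : 1 ≤ k) (hτ : 0 < τ) {δt B : ℝ} (h0 : 0 < δt)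
    (hB : Real.log (1 / δt) ≤ B) (hB0 : 0 ≤ B) :
    (samples (10 * alpha (kappa k τ) ^ 8) (δt / 16) * 12 : ℕ) ≤
      12 * (4 / (10 * alpha (kappa k τ) ^ 8) ^ 2 * (B + 3) + 1) := by
  have hα := alpha_pos (kappa_pos hk hτ)
  refine samples_mul_le 12 (by positivity) ?_ (by linarith)
  rw [show 1 / (δt / 16) = 1 / δt * 16 by field_simp, Real.log_mul (by positivity) (by norm_num)]
  linarith [log_sixteen_le]

lemma evaluatesCandidates_evalRoutine (hk : 1 ≤ k) (hτ : 0 < τ) (hτ1 : τ ≤ 1) :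
    EvaluatesCandidates (kappa k τ) (polyVal (polyEval (MvPolynomial.X 2)) k τ)
      (evalRoutine n (kappa k τ)) := by
  rintro f ρ b ⟨i, hi⟩ x δ' h0 h1
  have hκ := kappa_pos hk hτ
  obtain ⟨hd, hc, -⟩ := hi.estimates hκ
  refine ⟨?_, _, samples_eval_le hk hτ h0 h1, queriesAtMost_evalRoutine f _ ρ b x δ'⟩
  rw [hc]
  exact le_output_evalRoutine hκ (kappa_le_one hk hτ1) hd x h0

lemma testsDictators_testRoutine (hk : 1 ≤ k) (hτ : 0 < τ) (hτ1 : τ ≤ 1) :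
    TestsDictators (kappa k τ) (polyVal (polyEval (MvPolynomial.X 2)) k τ)
      (polyVal (polyTest (MvPolynomial.X 2)) k τ) (evalRoutine n (kappa k τ))
      (testRoutine n (kappa k τ)) := by
  intro f ρ b ν δt hν hν1 h0 h1
  have hκ := kappa_pos hk hτ
  have hκ1 := kappa_le_one hk hτ1
  have hα := alpha_pos hκ
  have hlog : 0 ≤ Real.log (1 / δt) := Real.log_nonneg (by rw [le_div_iff₀ h0]; linarith)
  refine ⟨⟨_, ?_, queriesAtMost_testRoutine f _ ρ b ν δt⟩, ?_, fun h => ?_⟩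
  · rw [polyVal_polyTest hk hτ, polyVal_X_two]
    refine (samples_test_le hk hτ h0 le_rfl hlog).trans (le_mul_of_one_le_left (by positivity) ?_)
    rw [one_le_inv₀ hν]; linarith
  · rintro ⟨i, hi⟩
    exact (ENNReal.ofReal_le_ofReal (by linarith)).trans (testRoutine_complete hκ hκ1 hi ν h0)
  · refine (testRoutine_sound hκ hκ1 ?_ ν h0).trans (ENNReal.ofReal_le_ofReal (by linarith))
    rintro ⟨i, s, his⟩
    refine h ⟨fun x => s * x i, i, fun x δ' h0 h1 => ⟨his x δ' h0 h1, _,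
      samples_eval_le hk hτ h0 h1, queriesAtMost_evalRoutine f _ ρ b x δ'⟩, ?_⟩
    exact (nearDict_iff hν.le (by linarith) s i i).2 rfl

/-! ### The three properties of the algorithm -/

/-- The failure budget is δ/16 for wrong acceptances, δ/4 for missed coordinates, δ/4 for misleading
sample points and δ/4 for evaluation errors. -/
lemma le_pr_isNuOracle (hk : 1 ≤ k) (hτ : 0 < τ) (hτ1 : τ ≤ 1) {ν : ℝ} (hν : 0 < ν)
    (hν1 : ν ≤ 1 / 8) (hδ : 0 < δ) (hδ1 : δ ≤ 1 / 2) (f : Cube n → ℤˣ) :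
    ENNReal.ofReal (1 - δ) ≤ pr ((constructCoordinateOracle 1000000 (evalRoutine n (kappa k τ))
        (testRoutine n (kappa k τ)) k τ ν δ).output f)
      {L | ∃ S : Set (Fin n), {i | τ ^ 2 / (k : ℝ) ^ 2 ≤ lowDegInfluence k f i} ⊆ S ∧
        IsNuOracle f ν (polyVal (polyEval (MvPolynomial.X 2)) k τ)
          (evaluators (evalRoutine n (kappa k τ)) L) S} := by
  have hκ := kappa_pos hk hτ
  have hκ1 := kappa_le_one hk hτ1
  have hT0 := outerRounds_pos hk hτ hδ hδ1
  have hM0 := innerRounds_pos hk hτ hδ hδ1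
  have hN0 := numPoints_pos hk hτ hδ hδ1
  have hM := one_le_mul_innerRounds hk hτ hτ1 hδ hδ1
  have hT := mul_exp_outerRounds_le hk hτ hτ1 hδ hδ1
  have hN : 1000000 * Real.log (innerRounds 1000000 k τ δ * outerRounds 1000000 k τ δ / δ) ≤
    numPoints 1000000 k τ δ := Nat.le_ceil _
  rw [constructCoordinateOracle_eq]
  refine le_pr_of_compl_le _ hδ.le ?_
  generalize outerRounds 1000000 k τ δ = T at *
  generalize innerRounds 1000000 k τ δ = M at *
  generalize numPoints 1000000 k τ δ = N at *
  have hT1 : (1 : ℝ) ≤ T := by exact_mod_cast hT0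
  have hM1 : (1 : ℝ) ≤ M := by exact_mod_cast hM0
  have hN1 : (1 : ℝ) ≤ N := by exact_mod_cast hN0
  have hMT : (1 : ℝ) ≤ M * T := one_le_mul_of_one_le_of_one_le hM1 hT1
  have hMTN : (1 : ℝ) ≤ M * T * N := one_le_mul_of_one_le_of_one_le hMT hN1
  have hδt0 : 0 < δ / (M * T) := by positivity
  have hδt1 : δ / (M * T) ≤ 1 := by rw [div_le_one (by positivity)]; linarith
  have hδe0 : 0 < δ / (1000000 * M * T * N) := by positivity
  have hδe1 : δ / (1000000 * M * T * N) < 1 := by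
    rw [div_lt_one (by positivity), mul_assoc, mul_assoc, ← mul_assoc (M : ℝ)]
    linarith
  rw [output_bind]
  refine (pr_bind_le _ _ _ (goodRounds f k τ T M)ᶜ (ε := ENNReal.ofReal (δ / 2))
    fun rounds hr => ?_).trans ?_
  · obtain ⟨hgood, hinf⟩ := not_not.1 hr
    set D := candidates rounds
    have hDlen : (D.length : ℝ) ≤ M * T := by
      rw [mul_comm]; exact_mod_cast length_candidates_le rounds
    refine (pr_mono _ (Set.compl_subset_compl.2 fun L hL => ?_)).trans
      ((pr_removeRepetitions hN0 hδe0 hδe1 hgood).trans ?_)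
    · obtain ⟨hLD, hpair, hrep⟩ := hL
      refine ⟨{i | ∃ c ∈ L, dictIndex f (kappa k τ) c = some i}, fun i hi => ?_,
        isNuOracle_of_pairwise hν.le (by linarith) (fun δ' h0 h1 => samples_eval_le hk hτ h0 h1)
          (fun c hc => hgood c (hLD c hc)) hpair⟩
      obtain ⟨c, hcD, hiso⟩ := hinf i hi
      obtain ⟨d, hdL, hd⟩ := hrep c hcD
      exact ⟨d, hdL, hd.trans
        ((hiso.estimates hκ).1.evaluatesDict hκ hκ1).dictIndex_eq⟩
    · rw [← ENNReal.ofReal_add (by positivity) (by positivity)]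
      refine ENNReal.ofReal_le_ofReal ?_
      have h1 : (D.length : ℝ) ^ 2 * (2 * Real.exp (-(N / 16))) ≤ δ / 4 :=
        le_trans (by gcongr) (sq_mul_exp_le hMT hδ hδ1 hN)
      have h2 : (D.length : ℝ) * (N * (δ / (1000000 * M * T * N))) ≤ δ / 4 := by
        calc (D.length : ℝ) * (N * (δ / (1000000 * M * T * N)))
            ≤ (M * T) * (N * (δ / (1000000 * M * T * N))) := by gcongr
          _ = δ / 1000000 := by field_simp
          _ ≤ δ / 4 := by gcongr; norm_num
      linarith
  · refine (add_le_add_left ((pr_goodRounds_compl hk hτ hκ hκ1 hM f ν hδt0 hδt1).trans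
      -- The first phase is charged δ/16 + δ/4; the other δ/2 was reserved for the second phase.
      (add_le_add_right (ENNReal.ofReal_le_ofReal hT) _)) _).trans ?_
    rw [← ENNReal.ofReal_add (by positivity) (by positivity),
      ← ENNReal.ofReal_add (by positivity) (by positivity)]
    refine ENNReal.ofReal_le_ofReal ?_
    have h3 : (T : ℝ) * (M * (δ / (M * T) / 16)) = δ / 16 := by field_simp
    linarith

lemma length_le_polyVal (eval : EvalRoutine n) (test : TestRoutine n) (hτ : 0 < τ) {ν : ℝ}
    (hδ : 0 < δ) (hδ1 : δ ≤ 1 / 2) (f : Cube n → ℤˣ)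
    {L : List (Restriction n × (Fin n → Bool))}
    (hL : L ∈ ((constructCoordinateOracle 1000000 eval test k τ ν δ).output f).support) :
    (L.length : ℝ) ≤ polyVal (polyOuter * polyInner) k τ δ := by
  have hlog := half_lt_log_one_div hδ hδ1
  have hT := outerRounds_le (k := k) hτ (by linarith : 0 ≤ Real.log (1 / δ))
  have hM := innerRounds_le (k := k) hτ (by linarith : 0 ≤ Real.log (1 / δ))
  rw [constructCoordinateOracle_eq, output_bind, PMF.mem_support_bind_iff] at hL
  obtain ⟨rounds, -, hL⟩ := hL
  have h1 := (length_le_of_mem_support hL).trans (length_candidates_le rounds)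
  have h2 : polyVal (polyOuter * polyInner) k τ δ =
      polyVal polyOuter k τ δ * polyVal polyInner k τ δ := by simp [polyVal]
  rw [h2]
  refine (Nat.cast_le.2 h1).trans ?_
  rw [Nat.cast_mul]
  exact mul_le_mul hT hM (Nat.cast_nonneg _) ((Nat.cast_nonneg _).trans hT)

lemma exists_queriesAtMost_construct (hk : 1 ≤ k) (hτ : 0 < τ) {ν : ℝ} (hν : 0 < ν)
    (hν1 : ν ≤ 1 / 8) (hδ : 0 < δ) (hδ1 : δ ≤ 1 / 2) (f : Cube n → ℤˣ) :
    ∃ m : ℕ, (m : ℝ) ≤ ν⁻¹ * polyVal polyQuery k τ δ ∧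
      (constructCoordinateOracle 1000000 (evalRoutine n (kappa k τ))
        (testRoutine n (kappa k τ)) k τ ν δ).QueriesAtMost f m := by
  have hα := alpha_pos (kappa_pos hk hτ)
  have hlog := half_lt_log_one_div hδ hδ1
  have hT := outerRounds_le (k := k) hτ (by linarith : 0 ≤ Real.log (1 / δ))
  have hM := innerRounds_le (k := k) hτ (by linarith : 0 ≤ Real.log (1 / δ))
  have hN := numPoints_le hk hτ hδ hδ1
  have hT0 := outerRounds_pos hk hτ hδ hδ1
  have hM0 := innerRounds_pos hk hτ hδ hδ1
  have hN0 := numPoints_pos hk hτ hδ hδ1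
  have hval : polyVal polyQuery k τ δ = polyVal polyOuter k τ δ * polyVal polyInner k τ δ *
        polyVal (polyTest (MvPolynomial.X 2 + polyInner * polyOuter)) k τ δ +
      polyVal polyOuter k τ δ * polyVal polyInner k τ δ * (polyVal polyPoints k τ δ *
        polyVal (polyEval (MvPolynomial.X 2 +
          MvPolynomial.C 1000000 * polyInner * polyOuter * polyPoints)) k τ δ) := by
    simp only [polyVal, polyQuery, map_add, map_mul]
  have hvt : polyVal (MvPolynomial.X 2 + polyInner * polyOuter) k τ δ =
      Real.log (1 / δ) + polyVal polyInner k τ δ * polyVal polyOuter k τ δ := by simp [polyVal]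
  have hve : polyVal (MvPolynomial.X 2 +
      MvPolynomial.C 1000000 * polyInner * polyOuter * polyPoints) k τ δ =
      Real.log (1 / δ) + 1000000 * polyVal polyInner k τ δ * polyVal polyOuter k τ δ *
        polyVal polyPoints k τ δ := by simp [polyVal]
  rw [polyVal_polyTest hk hτ, polyVal_polyEval hk hτ, hvt, hve] at hval
  rw [hval, constructCoordinateOracle_eq]
  generalize outerRounds 1000000 k τ δ = T at *
  generalize innerRounds 1000000 k τ δ = M at *
  generalize numPoints 1000000 k τ δ = N at *
  generalize polyVal polyOuter k τ δ = T' at *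
  generalize polyVal polyInner k τ δ = M' at *
  generalize polyVal polyPoints k τ δ = N' at *
  have hT1 : (1 : ℝ) ≤ T := by exact_mod_cast hT0
  have hM1 : (1 : ℝ) ≤ M := by exact_mod_cast hM0
  have hN1 : (1 : ℝ) ≤ N := by exact_mod_cast hN0
  have hT2 : 0 ≤ T' := by linarith
  have hM2 : 0 ≤ M' := by linarith
  have hN2 : 0 ≤ N' := by linarith
  have ht : Real.log (1 / (δ / (M * T))) ≤ Real.log (1 / δ) + M' * T' := by
    rw [one_div_div]
    exact log_div_le (by positivity) (by gcongr) hδ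
  have he : Real.log (1 / (δ / (1000000 * M * T * N))) ≤
      Real.log (1 / δ) + 1000000 * M' * T' * N' := by
    rw [one_div_div]
    exact log_div_le (by positivity) (by gcongr) hδ
  have hmt := samples_test_le hk hτ (δt := δ / (M * T)) (by positivity) ht (by positivity)
  have hme := samples_mul_le (ε := 8 * alpha (kappa k τ) ^ 6) 9 (by positivity) he (by positivity)
  have hq := (queriesAtMost_seq (m := T) fun _ => queriesAtMost_outerRound (M := M)
    (k := k) (κ := kappa k τ) fun ρ b => queriesAtMost_testRoutine f (kappa k τ) ρ b ν
      (δ / (M * T))).bind' (F := fun rounds => removeRepetitions (evalRoutine n (kappa k τ)) N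
        (δ / (1000000 * M * T * N)) (candidates rounds)) fun rounds =>
      queriesAtMost_removeRepetitions (length_candidates_le rounds)
        fun ρ b x => queriesAtMost_evalRoutine f (kappa k τ) ρ b x _
  refine ⟨_, ?_, hq⟩
  generalize samples (10 * alpha (kappa k τ) ^ 8) (δ / (M * T) / 16) * 12 = mt at *
  generalize samples (8 * alpha (kappa k τ) ^ 6) (δ / (1000000 * M * T * N)) * 9 = me at *
  have hνi : 1 ≤ ν⁻¹ := by rw [one_le_inv₀ hν]; linarith
  -- The query count is bounded without ν; inserting ν⁻¹ ≥ 1 only weakens the bound.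
  refine le_trans ?_ (le_mul_of_one_le_left (by positivity) hνi)
  push_cast at hme ⊢
  rw [← mul_assoc]
  gcongr

end

end

end CoordOracle

open CoordOracle
theorem lemma9 :
    ∃ (C : ℝ) (Peval Ptest Psize Pquery : MvPolynomial (Fin 3) ℝ)
      (eval : (n : ℕ) → (k : ℕ) → (τ : ℝ) → EvalRoutine n)
      (test : (n : ℕ) → (k : ℕ) → (τ : ℝ) → TestRoutine n),
      0 < C ∧
      ∀ (n k : ℕ) (τ : ℝ), 1 ≤ k → 0 < τ → τ ≤ 1 →
        EvaluatesCandidates (kappa k τ) (polyVal Peval k τ) (eval n k τ) ∧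
        TestsDictators (kappa k τ) (polyVal Peval k τ) (polyVal Ptest k τ)
          (eval n k τ) (test n k τ) ∧
        ∀ (ν δ : ℝ), 0 < ν → ν ≤ 1 / 8 → 0 < δ → δ ≤ 1 / 2 → ∀ f : Cube n → ℤˣ,
          ENNReal.ofReal (1 - δ) ≤
            ((constructCoordinateOracle C (eval n k τ) (test n k τ) k τ ν δ).output
              f).toOuterMeasure
              {L | ∃ S : Set (Fin n), {i | τ ^ 2 / (k : ℝ) ^ 2 ≤ lowDegInfluence k f i} ⊆ S ∧
                IsNuOracle f ν (polyVal Peval k τ) (evaluators (eval n k τ) L) S} ∧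
          (∀ L ∈ ((constructCoordinateOracle C (eval n k τ) (test n k τ) k τ ν δ).output
              f).support,
            (L.length : ℝ) ≤ polyVal Psize k τ δ) ∧
          (∃ m : ℕ, (m : ℝ) ≤ ν⁻¹ * polyVal Pquery k τ δ ∧
            (constructCoordinateOracle C (eval n k τ) (test n k τ) k τ ν δ).QueriesAtMost
              f m) := by
  refine ⟨1000000, polyEval (MvPolynomial.X 2), polyTest (MvPolynomial.X 2),
    polyOuter * polyInner, polyQuery, fun n k τ => evalRoutine n (kappa k τ),
    fun n k τ => testRoutine n (kappa k τ), by norm_num, fun n k τ hk hτ hτ1 =>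
    ⟨evaluatesCandidates_evalRoutine hk hτ hτ1, testsDictators_testRoutine hk hτ hτ1,
      fun ν δ hν hν1 hδ hδ1 f => ⟨le_pr_isNuOracle hk hτ hτ1 hν hν1 hδ hδ1 f,
        fun L hL => length_le_polyVal _ _ hτ hδ hδ1 f hL,
        exists_queriesAtMost_construct hk hτ hν hν1 hδ hδ1 f⟩⟩⟩
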